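/- **Quantum algebra.** Let $U_q$ be the $\mathbb C(q)$-algebra generated by $x^\pm_k$ ($k\in\mathbb Z$), $a_m$ ($m\in\mathbb Z\setminus\{0\}$), $t_1^{\pm1}$ with relations $[t_1,a_m]=[a_m,a_k]=0$, $t_1x_k^\pm t_1^{-1}=q^{\pm2}x_k^\pm$, $[a_m,x_k^\pm]=\pm\frac{[2m]}{m}x^\pm_{k+m}$, $x^\pm_{k+1}x^\pm_l-q^{\pm2}x^\pm_lx^\pm_{k+1}=q^{\pm2}x^\pm_kx^\pm_{l+1}-x^\pm_{l+1}x^\pm_k$, $[x^+_k,x^-_l]=\frac{\varphi^+_{k+l}-\varphi^-_{k+l}}{q-q^{-1}}$, where $[k]=\frac{q^k-q^{-k}}{q-q^{-1}}$ and $\sum_k\varphi^\pm_{\pm k}z^k=t_1^{\pm1}\exp\bigl(\pm(q-q^{-1})\sum_{m\ge1}a_{\pm m}z^m\bigr)$. Put $y^{(r)}=y^r/[r]!$ and $\tilde a_m=\frac{m}{[m]}a_m$. Let $U_q^{\rm res}$ be the $\mathbb C[q^{\pm1}]$-subalgebra generated by all $(x_k^\pm)^{(r)}$, $t_1^{\pm1}$,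 $\tilde a_m$ and $\prod_{s=1}^r\frac{t_1q^{c-s+1}-t_1^{-1}q^{-c+s-1}}{q^s-q^{-s}}$ ($c\in\mathbb Z$, $r\ge0$), and $B_q^+$ the one generated by $(x_k^\pm)^{(r)}$ ($k,r\ge0$), $\tilde a_m$ ($m>0$), $t_1^{\pm1}$. Let $i=\sqrt{-1}$, let $U_{i}=U_q^{\rm res}\otimes_{\mathbb C[q^{\pm1}]}\mathbb C$ with $q\mapsto i$, and let $B^+_{i}\subset U_{i}$ be the image of $B_q^+\otimes\mathbb C$. Set $\mathcal X^\pm_{\ge0}(t)=\sum_{k\ge0}x^\pm_k(q^{-1}t)^k$, similarly $\mathcal X^\pm_{>0},\mathcal X^\pm_{\le0},\mathcal X^\pm_{<0}$, and $a_\pm(t)=\sum_{\pm m>0}\tilde a_mt^m$; $Y^{(2)}=Y^2/[2]!$. **The module.** Fix $n\ge0$, let $K_n=\mathbb C(z_1,\dots,z_n)$, and let $A_n=\bigoplus_{l=0}^nA_{n,l}$, where $A_{n,l}$ is the space of skew-symmetric polynomials $P(X_1,\dots,X_l)$ over $K_n$ of degree at most $n-1$ in each $X_j$. Let $\wedge$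 be the product $(P_1\wedge P_2)(X_1,\dots,X_{a+b})=\frac1{a!\,b!}\sum_{\sigma\in\mathfrak S_{a+b}}{\rm sgn}(\sigma)P_1(X_{\sigma(1)},\dots,X_{\sigma(a)})P_2(X_{\sigma(a+1)},\dots,X_{\sigma(a+b)})$. With $\Theta(X)=\prod_{j=1}^n(1-z_jX)$, $\Theta(X,Y)=\Theta(X)\Theta(Y)-\Theta(-X)\Theta(-Y)$, $$F(t|X)=\frac{t}{2(X-t)}\frac{\Theta(t,-X)}{\Theta(t)},$$ $$F^{(2)}(t|X,Y)=\frac{t}{X+t}\frac{t}{Y+t}\frac{X-Y}{X+Y}\Theta(X,Y)+\frac{t}{X-t}\frac{t}{Y+t}\frac{\Theta(-Y)}{\Theta(t)}\Theta(t,-X)-\frac{t}{Y-t}\frac{t}{X+t}\frac{\Theta(-X)}{\Theta(t)}\Theta(t,-Y),$$ the generators act on $P\in A_{n,l}$ by the following formulas, expanded at $t=0$: - $t_1^{\pm1}.P=i^{\pm(n-2l)}P$, $\ \mathcal X^-_{>0}(t).P=F(t|\cdot)\wedge P$, $\ -4i\,\mathcal X^-_{>0}(t)^{(2)}.P=F^{(2)}(t|\cdot,\cdot)\wedge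 P$; - $a_+(t).P=\sum_j\frac{z_jt}{1-z_jt}P+\sum_{p=1}^l\Bigl\{\frac{t}{X_p-t}\Bigl(\frac{\Theta(X_p)}{\Theta(t)}P|_{X_p\to t}-P\Bigr)+(t\to-t)\Bigr\}$; - $i^{1-n}\mathcal X^+_{\ge0}(t).P=\frac{1}{\Theta(t)}P(X_1,\dots,X_{l-1},t)$ (and $0$ if $l=0$); - $i(-1)^{n+1}\mathcal X^+_{\ge0}(t)^{(2)}.P=\sum_{a=1}^n{\rm res}_{u=z_a^{-1}}\frac{P(X_1,\dots,X_{l-2},-u,u)}{\Theta(-u)\Theta(u)}\frac{du}{u-t}$ (and $0$ if $l\le1$). The actions of $-\mathcal X^-_{\le0}(t)$, $-4i\,\mathcal X^-_{\le0}(t)^{(2)}$, $-i^{1-n}\mathcal X^+_{<0}(t)$ and $i(-1)^{n+1}\mathcal X^+_{<0}(t)^{(2)}$ are given by the expansions at $t=\infty$ of the right hand sides for $\mathcal X^-_{>0}(t)$, $-4i\,\mathcal X^-_{>0}(t)^{(2)}$, $i^{1-n}\mathcal X^+_{\ge0}(t)$ and $i(-1)^{n+1}\mathcal X^+_{\ge0}(t)^{(2)}$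 (again $0$ for small $l$ in the last two cases), and $a_-(t).P$ is the expansion at $t=\infty$ of $-\sum_j\frac1{1-z_jt}P-\sum_{p=1}^l\Bigl\{\frac{t}{X_p-t}\Bigl(\frac{\Theta(X_p)}{\Theta(t)}P|_{X_p\to t}-\frac{X_p}{t}P\Bigr)+(t\to-t)\Bigr\}$. $A_n$ is regarded as a $U_{i}$-module, $K_n$-linearly, by these formulas. **Deformed cycles.** Let $R_n$ (resp. $\widehat R_n$) be the ring of symmetric polynomials (resp. symmetric Laurent polynomials) in $z_1,\dots,z_n$ over $\mathbb C$, and let $C_{n,l}$ (resp. $\widehat C_{n,l}$) be the set of $P\in A_{n,l}$ with coefficients in $R_n$ (resp. $\widehat R_n$). Call $P$ *weakly minimal* if $P=0$ whenever $X_{l-1}^{-1}=-X_l^{-1}=z_{n-1}=-z_n$, and *minimal* if $P=0$ whenever $X_l^{-1}=z_{n-1}=-z_n$ (no condition when the variables in question do not all exist). Let $\widehat D_{n,l}$, $\widehat W_{n,l}\subset\widehat C_{n,l}$ and $D_{n,l}$, $W_{n,l}\subset C_{n,l}$ be the subspaces of weakly minimal, resp. minimal elements, and $\widehat D_n=\bigoplus_l\widehat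 D_{n,l}$, etc. **Lemma.** 1. $\widehat D_n$ and $\widehat W_n$ are $U_{\sqrt{-1}}$-submodules of $A_n$. More precisely, each of the formulas above maps $\widehat D_{n,l}$ into $\widehat D_n$ and $\widehat W_{n,l}$ into $\widehat W_n$, coefficientwise in $t$; and for every $U_{\sqrt{-1}}$-module structure on $A_n$ given by these formulas, $\widehat D_n$ and $\widehat W_n$ are stable under all of $U_{\sqrt{-1}}$. 2. $D_n$ and $W_n$ are $B^+_{\sqrt{-1}}$-submodules of $A_n$, in the same sense, where the formulas are those for the generators $t_1^{\pm1}$, $\mathcal X^-_{>0}(t)$, $\mathcal X^-_{>0}(t)^{(2)}$, $x_0^-$, $(x_0^-)^{(2)}$, $a_+(t)$, $\mathcal X^+_{\ge0}(t)$, $\mathcal X^+_{\ge0}(t)^{(2)}$ of $B^+_{\sqrt{-1}}$. In particular, for $P\in\widehat D_{n,l}$ with $l\ge2$, all coefficients of the expansions at $t=0$ and at $t=\infty$ of $\sum_{a}{\rm res}_{u=z_a^{-1}}\frac{P(X_1,\dots,X_{l-2},-u,u)}{\Theta(-u)\Theta(u)}\frac{du}{u-t}$ lie in $\widehat C_{n,l-2}$,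 so that they have no poles at $z_a+z_b=0$. -/

import Mathlib

open scoped LaurentPolynomial TensorProduct DirectSum

noncomputable section

/-! ## The quantum loop algebra and its specialization at `q = √-1` -/

namespace QLoop

/-- The field `ℂ(q)`. -/
abbrev Cq : Type := RatFunc ℂ

/-- The indeterminate `q`. -/
def q : Cq := RatFunc.X

theorem q_ne_zero : q ≠ 0 := RatFunc.X_ne_zero

/-- `[k] = (q^k - q^{-k}) / (q - q^{-1})`. -/
def qInt (k : ℤ) : Cq := (q ^ k - q ^ (-k)) / (q - q⁻¹)

/-- `[r]! = [1][2]⋯[r]`. -/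
def qFact (r : ℕ) : Cq := ∏ j ∈ Finset.range r, qInt ((j : ℤ) + 1)

/-- The generators: `x s k` is `x^±_k` (with the sign `s = ±1`), `a m` (`m ≠ 0`), `t₁`, `t₁⁻¹`. -/
inductive Letter : Type
  | x (s : ℤˣ) (k : ℤ)
  | a (m : ℤ) (hm : m ≠ 0)
  | t
  | tInv

/-- The free algebra on the generators. -/
abbrev Free : Type := FreeAlgebra Cq Letter

namespace Free

def x (s : ℤˣ) (k : ℤ) : Free := FreeAlgebra.ι Cq (Letter.x s k)
def a (m : ℤ) (hm : m ≠ 0) : Free := FreeAlgebra.ι Cq (Letter.a m hm)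
def t : Free := FreeAlgebra.ι Cq Letter.t
def tInv : Free := FreeAlgebra.ι Cq Letter.tInv

/-- The series `s (q - q⁻¹) ∑_{m ≥ 1} a_{s m} z^m`, for a sign `s = ±1`. -/
def logSeries (s : ℤˣ) : PowerSeries Free :=
  PowerSeries.mk fun m =>
    if hm : m = 0 then 0
    else (((s : ℤ) : Cq) * (q - q⁻¹)) •
      a ((s : ℤ) * m) (mul_ne_zero s.ne_zero (by exact_mod_cast hm))

/-- `φ^s_m`, given by `∑_{m ≥ 0} φ^s_{s m} z^m = t₁^s exp (s (q - q⁻¹) ∑_{m ≥ 1} a_{s m} z^m)`,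
and `φ^s_m = 0` for `s m < 0`. The series in the exponent has no constant term, so that the
coefficient of `z^m` in the exponential only involves its powers up to the `m`-th. -/
def phi (s : ℤˣ) (m : ℤ) : Free :=
  if 0 ≤ (s : ℤ) * m then
    (if s = 1 then t else tInv) *
      ∑ r ∈ Finset.range (m.natAbs + 1),
        ((r.factorial : Cq)⁻¹) • PowerSeries.coeff m.natAbs (logSeries s ^ r)
  else 0

end Free

open Free in
/-- The defining relations of `U_q` (Drinfeld's realization, level zero). -/
inductive Rel : Free → Free → Prop
  | t_mul_tInv : Rel (t * tInv) 1
  | tInv_mul_t : Rel (tInv * t) 1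
  | t_a (m : ℤ) (hm : m ≠ 0) : Rel (t * a m hm) (a m hm * t)
  | a_a (m : ℤ) (hm : m ≠ 0) (k : ℤ) (hk : k ≠ 0) :
      Rel (a m hm * a k hk) (a k hk * a m hm)
  | t_x (s : ℤˣ) (k : ℤ) : Rel (t * x s k * tInv) (q ^ (2 * (s : ℤ)) • x s k)
  | a_x (m : ℤ) (hm : m ≠ 0) (s : ℤˣ) (k : ℤ) :
      Rel (a m hm * x s k - x s k * a m hm)
        ((((s : ℤ) : Cq) * (qInt (2 * m) / (m : Cq))) • x s (k + m))
  | x_x (s : ℤˣ) (k l : ℤ) :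
      Rel (x s (k + 1) * x s l - q ^ (2 * (s : ℤ)) • (x s l * x s (k + 1)))
        (q ^ (2 * (s : ℤ)) • (x s k * x s (l + 1)) - x s (l + 1) * x s k)
  | xp_xm (k l : ℤ) :
      Rel (x 1 k * x (-1) l - x (-1) l * x 1 k)
        ((q - q⁻¹)⁻¹ • (phi 1 (k + l) - phi (-1) (k + l)))

/-- The quantum loop algebra of `sl₂` over `ℂ(q)`. -/
def Uq : Type := RingQuot Rel

instance : Ring Uq := inferInstanceAs (Ring (RingQuot Rel))
instance : Algebra Cq Uq := inferInstanceAs (Algebra Cq (RingQuot Rel))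

/-- The projection from the free algebra. -/
def Uq.mk : Free →ₐ[Cq] Uq := RingQuot.mkAlgHom Cq Rel

namespace Uq

def x (s : ℤˣ) (k : ℤ) : Uq := mk (Free.x s k)
def a (m : ℤ) (hm : m ≠ 0) : Uq := mk (Free.a m hm)
def t : Uq := mk Free.t
def tInv : Uq := mk Free.tInv

/-- The divided power `y^{(r)} = y^r / [r]!`. -/
def divPow (y : Uq) (r : ℕ) : Uq := (qFact r)⁻¹ • y ^ r

/-- `ã_m = (m / [m]) a_m`. -/
def aTilde (m : ℤ) (hm : m ≠ 0) : Uq := ((m : Cq) / qInt m) • a m hm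

/-- The `q`-binomial `[t₁; c over r] = ∏_{s=1}^r (t₁ q^{c-s+1} - t₁⁻¹ q^{-c+s-1}) / (q^s - q^{-s})`. -/
def tBinom (c : ℤ) (r : ℕ) : Uq :=
  ((List.range r).map fun j : ℕ =>
    (q ^ ((j : ℤ) + 1) - q ^ (-((j : ℤ) + 1)))⁻¹ •
      (q ^ (c - j) • t - q ^ ((j : ℤ) - c) • tInv)).prod

end Uq

/-- The embedding `ℂ[q, q⁻¹] → ℂ(q)`. -/
def evalQ : ℂ[T;T⁻¹] →+* Cq :=
  LaurentPolynomial.eval₂ (algebraMap ℂ Cq) (Units.mk0 q q_ne_zero)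

instance : Algebra ℂ[T;T⁻¹] Uq :=
  ((algebraMap Cq Uq).comp evalQ).toAlgebra' fun c y => Algebra.commutes (evalQ c) y

/-- The restricted form `U_q^res`, a `ℂ[q, q⁻¹]`-subalgebra of `U_q`. -/
def Ures : Subalgebra ℂ[T;T⁻¹] Uq :=
  Algebra.adjoin ℂ[T;T⁻¹]
    ({y | ∃ (s : ℤˣ) (k : ℤ) (r : ℕ), y = Uq.divPow (Uq.x s k) r} ∪
      {Uq.t, Uq.tInv} ∪
      {y | ∃ (c : ℤ) (r : ℕ), y = Uq.tBinom c r} ∪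
      {y | ∃ (m : ℤ) (hm : m ≠ 0), y = Uq.aTilde m hm})

/-- The `ℂ[q, q⁻¹]`-subalgebra `B^+_q`. -/
def BplusQ : Subalgebra ℂ[T;T⁻¹] Uq :=
  Algebra.adjoin ℂ[T;T⁻¹]
    ({y | ∃ (s : ℤˣ) (k r : ℕ), y = Uq.divPow (Uq.x s k) r} ∪
      {Uq.t, Uq.tInv} ∪
      {y | ∃ (m : ℤ) (hm : 0 < m), y = Uq.aTilde m hm.ne'})

/-- The field `ℂ` as an algebra over `ℂ[q, q⁻¹]` through `q ↦ √-1`. -/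
def AtI : Type := ℂ

instance : CommRing AtI := inferInstanceAs (CommRing ℂ)
instance : Algebra ℂ AtI := inferInstanceAs (Algebra ℂ ℂ)
instance : Algebra ℂ[T;T⁻¹] AtI :=
  (LaurentPolynomial.eval₂ (algebraMap ℂ AtI)
    (Units.map (algebraMap ℂ AtI).toMonoidHom (Units.mk0 Complex.I Complex.I_ne_zero))).toAlgebra

/-- The specialization `U_{√-1} = ℂ ⊗_{ℂ[q, q⁻¹]} U_q^res`, with `q ↦ √-1`. -/
abbrev Ui : Type := AtI ⊗[ℂ[T;T⁻¹]] Ures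

/-- The image `1 ⊗ u` in `U_{√-1}` of `u ∈ U_q^res`. -/
def spec : Ures →+* Ui :=
  (Algebra.TensorProduct.includeRight : Ures →ₐ[ℂ[T;T⁻¹]] Ui).toRingHom

/-- The subalgebra `B^+_{√-1}` of `U_{√-1}`: the image of `B^+_q`. -/
def Bplus : Subalgebra ℂ Ui :=
  Algebra.adjoin ℂ (spec '' {u : Ures | (u : Uq) ∈ BplusQ})

/-! ### The half currents -/

/-- `𝒳^±_{≥ 0}(t) = ∑_{k ≥ 0} x^±_k (q⁻¹ t)^k`, a power series in `t`. -/
def curNonneg (s : ℤˣ) : PowerSeries Uq :=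
  PowerSeries.mk fun k => q ^ (-(k : ℤ)) • Uq.x s k

/-- `𝒳^±_{> 0}(t) = ∑_{k > 0} x^±_k (q⁻¹ t)^k`, a power series in `t`. -/
def curPos (s : ℤˣ) : PowerSeries Uq :=
  PowerSeries.mk fun k => if k = 0 then 0 else q ^ (-(k : ℤ)) • Uq.x s k

/-- `𝒳^±_{≤ 0}(t) = ∑_{k ≥ 0} x^±_{-k} (q⁻¹ t)^{-k}`, a power series in `t⁻¹`. -/
def curNonpos (s : ℤˣ) : PowerSeries Uq :=
  PowerSeries.mk fun k => q ^ (k : ℤ) • Uq.x s (-(k : ℤ))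

/-- `𝒳^±_{< 0}(t) = ∑_{k > 0} x^±_{-k} (q⁻¹ t)^{-k}`, a power series in `t⁻¹`. -/
def curNeg (s : ℤˣ) : PowerSeries Uq :=
  PowerSeries.mk fun k => if k = 0 then 0 else q ^ (k : ℤ) • Uq.x s (-(k : ℤ))

/-- `a_+(t) = ∑_{m > 0} ã_m t^m` (for `s = 1`), a power series in `t`, and
`a_-(t) = ∑_{m < 0} ã_m t^m` (for `s = -1`), a power series in `t⁻¹`. -/
def curA (s : ℤˣ) : PowerSeries Uq :=
  PowerSeries.mk fun m =>
    if hm : m = 0 then 0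
    else Uq.aTilde ((s : ℤ) * m) (mul_ne_zero s.ne_zero (by exact_mod_cast hm))

/-- The coefficient of index `j` in the divided square `Y^{(2)} = Y² / [2]!` of a series `Y`. -/
def sqCoeff (Y : PowerSeries Uq) (j : ℕ) : Uq :=
  (qFact 2)⁻¹ • PowerSeries.coeff j (Y ^ 2)

/-- Names for `t₁^{±1}` and for the coefficients of the half currents and of their divided squares.
The index `j` is the exponent of `t` for `xmPos`, `xpNonneg`, `aPos`, and the exponent of `t⁻¹` for
`xmNonpos`, `xpNeg`, `aNeg`. -/
inductive Gen : Type
  | t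
  | tInv
  | xmPos (j : ℕ)
  | xmNonpos (j : ℕ)
  | xmPosSq (j : ℕ)
  | xmNonposSq (j : ℕ)
  | aPos (j : ℕ)
  | aNeg (j : ℕ)
  | xpNonneg (j : ℕ)
  | xpNeg (j : ℕ)
  | xpNonnegSq (j : ℕ)
  | xpNegSq (j : ℕ)

/-- The element of `U_q` with the given name. -/
def Gen.elt : Gen → Uq
  | .t => Uq.t
  | .tInv => Uq.tInv
  | .xmPos j => PowerSeries.coeff j (curPos (-1))
  | .xmNonpos j => PowerSeries.coeff j (curNonpos (-1))
  | .xmPosSq j => sqCoeff (curPos (-1)) j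
  | .xmNonposSq j => sqCoeff (curNonpos (-1)) j
  | .aPos j => PowerSeries.coeff j (curA 1)
  | .aNeg j => PowerSeries.coeff j (curA (-1))
  | .xpNonneg j => PowerSeries.coeff j (curNonneg 1)
  | .xpNeg j => PowerSeries.coeff j (curNeg 1)
  | .xpNonnegSq j => sqCoeff (curNonneg 1) j
  | .xpNegSq j => sqCoeff (curNeg 1) j

/-- Those of the named elements that are listed as generators of `B^+_{√-1}`; the coefficients of
index `0` of `𝒳^-_{≤ 0}(t)` and `𝒳^-_{≤ 0}(t)^{(2)}` are `x^-_0` and `(x^-_0)^{(2)}`. -/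
inductive Gen.InBplus : Gen → Prop
  | t : Gen.InBplus .t
  | tInv : Gen.InBplus .tInv
  | xmPos (j : ℕ) : Gen.InBplus (.xmPos j)
  | xmPosSq (j : ℕ) : Gen.InBplus (.xmPosSq j)
  | xmZero : Gen.InBplus (.xmNonpos 0)
  | xmZeroSq : Gen.InBplus (.xmNonposSq 0)
  | aPos (j : ℕ) : Gen.InBplus (.aPos j)
  | xpNonneg (j : ℕ) : Gen.InBplus (.xpNonneg j)
  | xpNonnegSq (j : ℕ) : Gen.InBplus (.xpNonnegSq j)

end QLoop

/-! ## The space `A_n` and the deformed cycles -/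

namespace Cycles

open MvPolynomial

/-- The field `K_n = ℂ(z_1, …, z_n)`. -/
def K (n : ℕ) : Type := FractionRing (MvPolynomial (Fin n) ℂ)

instance (n : ℕ) : Field (K n) := inferInstanceAs (Field (FractionRing (MvPolynomial (Fin n) ℂ)))
instance (n : ℕ) : Algebra (MvPolynomial (Fin n) ℂ) (K n) :=
  inferInstanceAs (Algebra _ (FractionRing (MvPolynomial (Fin n) ℂ)))
instance (n : ℕ) : IsFractionRing (MvPolynomial (Fin n) ℂ) (K n) :=
  inferInstanceAs (IsFractionRing _ (FractionRing (MvPolynomial (Fin n) ℂ)))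
instance (n : ℕ) : Algebra ℂ (K n) :=
  inferInstanceAs (Algebra ℂ (FractionRing (MvPolynomial (Fin n) ℂ)))
instance (n : ℕ) : IsScalarTower ℂ (MvPolynomial (Fin n) ℂ) (K n) :=
  inferInstanceAs (IsScalarTower ℂ _ (FractionRing (MvPolynomial (Fin n) ℂ)))

/-- The inclusion of `ℂ[z_1, …, z_n]` in `K_n`. -/
abbrev toK (n : ℕ) : MvPolynomial (Fin n) ℂ →+* K n := algebraMap _ _

/-- The element `z_j` of `K_n`. -/
def z {n : ℕ} (j : Fin n) : K n := toK n (X j)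

/-- `A_{n,l}`: the skew-symmetric polynomials in `X_1, …, X_l` over `K_n`, of degree at most `n - 1`
in each `X_i`. -/
def A (n l : ℕ) : Submodule (K n) (MvPolynomial (Fin l) (K n)) where
  carrier := {P | (∀ σ : Equiv.Perm (Fin l),
      rename σ P = (((Equiv.Perm.sign σ : ℤˣ) : ℤ) : K n) • P) ∧
    ∀ m ∈ P.support, ∀ i, m i < n}
  add_mem' := by
    rintro P Q ⟨hP, hP'⟩ ⟨hQ, hQ'⟩
    refine ⟨fun σ => by rw [map_add, hP, hQ, smul_add], fun m hm i => ?_⟩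
    rcases Finset.mem_union.1 (support_add hm) with h | h
    · exact hP' m h i
    · exact hQ' m h i
  zero_mem' := ⟨fun σ => by simp, fun m hm => by simp at hm⟩
  smul_mem' := by
    rintro c P ⟨hP, hP'⟩
    exact ⟨fun σ => by rw [map_smul, hP, smul_comm], fun m hm i => hP' m (support_smul hm) i⟩

/-- `A_n = ⊕_l A_{n,l}`. (`A_{n,l} = 0` for `l > n`.) -/
abbrev ATot (n : ℕ) : Type := ⨁ l : ℕ, A n l

/-- The inclusion of `A_{n,l}` in `A_n`. -/
def incl {n : ℕ} (l : ℕ) : A n l →ₗ[K n] ATot n := DirectSum.lof (K n) ℕ (fun l => A n l) l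

/-- The product `z_1 ⋯ z_n`. -/
def zProd (n : ℕ) : MvPolynomial (Fin n) ℂ := ∏ j, X j

/-- The ring `R_n` of symmetric polynomials in `z_1, …, z_n`, inside `K_n`. -/
def R (n : ℕ) : Subalgebra ℂ (K n) :=
  (symmetricSubalgebra (Fin n) ℂ).map (IsScalarTower.toAlgHom ℂ (MvPolynomial (Fin n) ℂ) (K n))

/-- The ring `R̂_n` of symmetric Laurent polynomials in `z_1, …, z_n`, inside `K_n`: the quotients
of a symmetric polynomial by a power of `z_1 ⋯ z_n`. -/
def RHat (n : ℕ) : Subalgebra ℂ (K n) where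
  carrier := {f | ∃ (N : ℕ) (p : MvPolynomial (Fin n) ℂ),
    p.IsSymmetric ∧ toK n p = toK n (zProd n) ^ N * f}
  mul_mem' := by
    rintro f g ⟨N, p, hp, h⟩ ⟨M, r, hr, h'⟩
    exact ⟨N + M, p * r, hp.mul hr, by rw [map_mul, h, h']; ring⟩
  add_mem' := by
    rintro f g ⟨N, p, hp, h⟩ ⟨M, r, hr, h'⟩
    have hz : (zProd n).IsSymmetric := fun σ => by
      rw [zProd, map_prod]
      simp only [rename_X]
      exact Equiv.prod_comp σ (fun j => (X j : MvPolynomial (Fin n) ℂ))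
    have hpow : ∀ k : ℕ, (zProd n ^ k).IsSymmetric := fun k σ => by
      rw [map_pow, hz σ]
    exact ⟨N + M, zProd n ^ M * p + zProd n ^ N * r,
      ((hpow M).mul hp).add ((hpow N).mul hr), by
        rw [map_add, map_mul, map_mul, h, h', map_pow, map_pow]; ring⟩
  algebraMap_mem' := by
    intro c
    exact ⟨0, C c, fun σ => by simp, by
      rw [pow_zero, one_mul, IsScalarTower.algebraMap_apply ℂ (MvPolynomial (Fin n) ℂ) (K n)]
      rfl⟩

/-- The elements of `A_{n,l}` with coefficients in a subring `S` of `K_n`: this is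
`Ĉ_{n,l} = ⋀^l (⊕_{j<n} R̂_n X^j)` for `S = R̂_n` and `C_{n,l}` for `S = R_n`. -/
def withCoeffs {n : ℕ} (S : Subalgebra ℂ (K n)) (l : ℕ) : Submodule ℂ (A n l) where
  carrier := {P | ∀ m, coeff m (P : MvPolynomial (Fin l) (K n)) ∈ S}
  add_mem' := fun {_ _} hP hQ m => by
    simpa using S.add_mem (hP m) (hQ m)
  zero_mem' := fun m => by simp
  smul_mem' := fun c P hP m => by
    have h : ((c • P : A n l) : MvPolynomial (Fin l) (K n)) = c • (P : MvPolynomial _ _) := rfl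
    rw [h, coeff_smul]
    exact S.smul_mem (hP m) c

/-- The value at `X = x`, `z = w` of a polynomial `p(X_1, …, X_l | z_1, …, z_n)`. -/
def value {n l : ℕ} (x : Fin l → ℂ) (w : Fin n → ℂ) :
    MvPolynomial (Fin l) (MvPolynomial (Fin n) ℂ) →+* ℂ :=
  eval₂Hom (eval w) x

/-- The elements `P` of `A_{n,l}` with Laurent polynomial coefficients that vanish at all points
`X = x`, `z = w` of `S` with all `w_j` non-zero. If `(z_1 ⋯ z_n)^N P = p` is a polynomial in the
`X_i` and `z_j`, then the value of `P` at such a point is `p(x | w) / (w_1 ⋯ w_n)^N`. -/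
def vanishingOn {n l : ℕ} (S : Set ((Fin l → ℂ) × (Fin n → ℂ))) : Submodule ℂ (A n l) where
  carrier := {P | ∃ (N : ℕ) (p : MvPolynomial (Fin l) (MvPolynomial (Fin n) ℂ)),
    map (toK n) p = C (toK n (zProd n) ^ N) * (P : MvPolynomial (Fin l) (K n)) ∧
    ∀ y ∈ S, (∀ j, y.2 j ≠ 0) → value y.1 y.2 p = 0}
  add_mem' := by
    rintro P Q ⟨N, p, h, hp⟩ ⟨M, r, h', hr⟩
    refine ⟨N + M, C (zProd n ^ M) * p + C (zProd n ^ N) * r, ?_, fun y hy hy' => ?_⟩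
    · rw [map_add, map_mul, map_mul, h, h']
      simp only [map_C, map_pow, Submodule.coe_add]
      ring
    · rw [map_add, map_mul, map_mul, hp y hy hy', hr y hy hy', mul_zero, mul_zero, add_zero]
  zero_mem' := ⟨0, 0, by simp, fun y _ _ => by simp⟩
  smul_mem' := by
    rintro c P ⟨N, p, h, hp⟩
    refine ⟨N, C (C c) * p, ?_, fun y hy hy' => by rw [map_mul, hp y hy hy', mul_zero]⟩
    have h1 : ((c • P : A n l) : MvPolynomial (Fin l) (K n))
        = C (toK n (C c)) * (P : MvPolynomial _ _) := by
      have h2 : ((c • P : A n l) : MvPolynomial (Fin l) (K n)) = c • (P : MvPolynomial _ _) := rfl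
      have h3 : toK n (C c) = algebraMap ℂ (K n) c :=
        (IsScalarTower.algebraMap_apply ℂ (MvPolynomial (Fin n) ℂ) (K n) c).symm
      rw [h2, h3, ← smul_eq_C_mul, algebraMap_smul]
    rw [map_mul, h, h1, map_C]
    ring

/-- The locus `X_{l-1}⁻¹ = -X_l⁻¹ = z_{n-1} = -z_n` (empty if `l < 2` or `n < 2`). -/
def weakLocus (n l : ℕ) : Set ((Fin l → ℂ) × (Fin n → ℂ)) :=
  {y | ∃ (a b : Fin l) (c d : Fin n),
    (a : ℕ) + 2 = l ∧ (b : ℕ) + 1 = l ∧ (c : ℕ) + 2 = n ∧ (d : ℕ) + 1 = n ∧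
    (y.1 a)⁻¹ = y.2 c ∧ -(y.1 b)⁻¹ = y.2 c ∧ -(y.2 d) = y.2 c}

/-- The locus `X_l⁻¹ = z_{n-1} = -z_n` (empty if `l < 1` or `n < 2`). -/
def minLocus (n l : ℕ) : Set ((Fin l → ℂ) × (Fin n → ℂ)) :=
  {y | ∃ (b : Fin l) (c d : Fin n),
    (b : ℕ) + 1 = l ∧ (c : ℕ) + 2 = n ∧ (d : ℕ) + 1 = n ∧
    (y.1 b)⁻¹ = y.2 c ∧ -(y.2 d) = y.2 c}

/-- The deformed cycles `Ĉ_{n,l}`. -/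
def CHat (n l : ℕ) : Submodule ℂ (A n l) := withCoeffs (RHat n) l

/-- The weakly minimal deformed cycles `D̂_{n,l}`. -/
def DHat (n l : ℕ) : Submodule ℂ (A n l) := CHat n l ⊓ vanishingOn (weakLocus n l)

/-- The minimal deformed cycles `Ŵ_{n,l}`. -/
def WHat (n l : ℕ) : Submodule ℂ (A n l) := CHat n l ⊓ vanishingOn (minLocus n l)

/-- `C_{n,l}`. -/
def CPol (n l : ℕ) : Submodule ℂ (A n l) := withCoeffs (R n) l

/-- `D_{n,l}`. -/
def DPol (n l : ℕ) : Submodule ℂ (A n l) := CPol n l ⊓ vanishingOn (weakLocus n l)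

/-- `W_{n,l}`. -/
def WPol (n l : ℕ) : Submodule ℂ (A n l) := CPol n l ⊓ vanishingOn (minLocus n l)

/-- The subspace `⊕_l M_l` of `A_n`, for subspaces `M_l` of `A_{n,l}`. -/
def total {n : ℕ} (M : ∀ l : ℕ, Submodule ℂ (A n l)) : Submodule ℂ (ATot n) where
  carrier := {P | ∀ l, P l ∈ M l}
  add_mem' := fun {_ _} hP hQ l => (M l).add_mem (hP l) (hQ l)
  zero_mem' := fun l => (M l).zero_mem
  smul_mem' := fun c _ hP l => (M l).smul_mem c (hP l)

/-! ## The action on `A_n` -/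

section Formulas

variable {n : ℕ} {E : Type} [Field E] [Algebra (K n) E]

/-- `Θ_n(x) = ∏_j (1 - z_j x)`. -/
def Theta (n : ℕ) {E : Type} [Field E] [Algebra (K n) E] (x : E) : E :=
  ∏ j : Fin n, (1 - algebraMap (K n) E (z j) * x)

/-- `Θ_n(x, y) = Θ_n(x) Θ_n(y) - Θ_n(-x) Θ_n(-y)`. -/
def Theta2 (n : ℕ) {E : Type} [Field E] [Algebra (K n) E] (x y : E) : E :=
  Theta n x * Theta n y - Theta n (-x) * Theta n (-y)

/-- `F_n(t | x)`. -/
def F (n : ℕ) {E : Type} [Field E] [Algebra (K n) E] (t x : E) : E :=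
  t / (2 * (x - t)) * (Theta2 n t (-x) / Theta n t)

/-- `F^{(2)}_n(t | x, y)`. -/
def F2 (n : ℕ) {E : Type} [Field E] [Algebra (K n) E] (t x y : E) : E :=
  t / (x + t) * (t / (y + t)) * ((x - y) / (x + y)) * Theta2 n x y
    + t / (x - t) * (t / (y + t)) * (Theta n (-y) / Theta n t) * Theta2 n t (-x)
    - t / (y - t) * (t / (x + t)) * (Theta n (-x) / Theta n t) * Theta2 n t (-y)

/-- `f ∧ g = (a! b!)⁻¹ Skew (f(X_1, …, X_a) g(X_{a+1}, …, X_{a+b}))`. -/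
def wedge {a b : ℕ} (f : (Fin a → E) → E) (g : (Fin b → E) → E) (x : Fin (a + b) → E) : E :=
  ((a.factorial : E) * (b.factorial : E))⁻¹ *
    ∑ σ : Equiv.Perm (Fin (a + b)), (((Equiv.Perm.sign σ : ℤˣ) : ℤ) : E) *
      (f (fun i => x (σ (Fin.castAdd b i))) * g (fun i => x (σ (Fin.natAdd a i))))

/-- `F_n(t) ∧ P`. -/
def formXm {l : ℕ} (P : MvPolynomial (Fin l) (K n)) (t : E) (x : Fin (1 + l) → E) : E :=
  wedge (fun y : Fin 1 → E => F n t (y 0)) (fun y => aeval y P) x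

/-- `F^{(2)}_n(t) ∧ P`. -/
def formXmSq {l : ℕ} (P : MvPolynomial (Fin l) (K n)) (t : E) (x : Fin (2 + l) → E) : E :=
  wedge (fun y : Fin 2 → E => F2 n t (y 0) (y 1)) (fun y => aeval y P) x

/-- The formula for `a_+(t).P`. -/
def formAPos {l : ℕ} (P : MvPolynomial (Fin l) (K n)) (t : E) (x : Fin l → E) : E :=
  (∑ j : Fin n, algebraMap (K n) E (z j) * t / (1 - algebraMap (K n) E (z j) * t)) * aeval x P
    + ∑ p : Fin l, (br t p + br (-t) p)
where
  /-- The expression in braces, before its symmetrization under `t → -t`. -/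
  br (t : E) (p : Fin l) : E :=
    t / (x p - t) *
      (Theta n (x p) / Theta n t * aeval (Function.update x p t) P - aeval x P)

/-- The formula for `a_-(t).P`. -/
def formANeg {l : ℕ} (P : MvPolynomial (Fin l) (K n)) (t : E) (x : Fin l → E) : E :=
  -(∑ j : Fin n, 1 / (1 - algebraMap (K n) E (z j) * t)) * aeval x P
    - ∑ p : Fin l, (br t p + br (-t) p)
where
  /-- The expression in braces, before its symmetrization under `t → -t`. -/
  br (t : E) (p : Fin l) : E :=
    t / (x p - t) *
      (Theta n (x p) / Theta n t * aeval (Function.update x p t) P - x p / t * aeval x P)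

/-- `P(X_1, …, X_{l-1}, t) / Θ_n(t)`. -/
def formXp {l : ℕ} (P : MvPolynomial (Fin (l + 1)) (K n)) (t : E) (x : Fin l → E) : E :=
  1 / Theta n t * aeval (Fin.snoc x t : Fin (l + 1) → E) P

/-- The residue at `u = c` of a rational function `f(u)`: the coefficient of `ε⁻¹` in the Laurent
expansion of `f(c + ε)`. -/
def residue (f : LaurentSeries E → LaurentSeries E) (c : E) : E :=
  (f (HahnSeries.C c + HahnSeries.single 1 1)).coeff (-1)

/-- `∑_a res_{u = z_a⁻¹} P(X_1, …, X_{l-2}, -u, u) / (Θ_n(-u) Θ_n(u)) du / (u - t)`. -/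
def formXpSq {l : ℕ} (P : MvPolynomial (Fin (l + 2)) (K n)) (t : E) (x : Fin l → E) : E :=
  ∑ a : Fin n, residue
    (fun u => aeval (Fin.snoc (Fin.snoc (fun i => HahnSeries.C (x i)) (-u) :
          Fin (l + 1) → LaurentSeries E) u : Fin (l + 2) → LaurentSeries E) P
        / (Theta n (-u) * Theta n u) * (1 / (u - HahnSeries.C t)))
    (algebraMap (K n) E (z a)⁻¹)

end Formulas

/-- The field `K_n(X_1, …, X_l)`. -/
def KX (n l : ℕ) : Type := FractionRing (MvPolynomial (Fin l) (K n))

instance (n l : ℕ) : Field (KX n l) :=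
  inferInstanceAs (Field (FractionRing (MvPolynomial (Fin l) (K n))))
instance (n l : ℕ) : Algebra (MvPolynomial (Fin l) (K n)) (KX n l) :=
  inferInstanceAs (Algebra _ (FractionRing (MvPolynomial (Fin l) (K n))))
instance (n l : ℕ) : IsFractionRing (MvPolynomial (Fin l) (K n)) (KX n l) :=
  inferInstanceAs (IsFractionRing _ (FractionRing (MvPolynomial (Fin l) (K n))))
instance (n l : ℕ) : Algebra (K n) (KX n l) :=
  inferInstanceAs (Algebra (K n) (FractionRing (MvPolynomial (Fin l) (K n))))
instance (n l : ℕ) : IsScalarTower (K n) (MvPolynomial (Fin l) (K n)) (KX n l) :=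
  inferInstanceAs (IsScalarTower (K n) _ (FractionRing (MvPolynomial (Fin l) (K n))))

/-- The field `K_n(X_1, …, X_l)((T))`, in which the formulas are expanded. -/
abbrev Ser (n l : ℕ) : Type := LaurentSeries (KX n l)

/-- The variable `X_i` in this field. -/
def xVar (n l : ℕ) (i : Fin l) : Ser n l :=
  HahnSeries.C (algebraMap (MvPolynomial (Fin l) (K n)) (KX n l) (X i))

/-- Expansion at `t = 0`: put `t = T`; the coefficient of `T^j` is the one of `t^j`. -/
def tZero (n l : ℕ) : Ser n l := HahnSeries.single 1 1

/-- Expansion at `t = ∞`: put `t = T⁻¹`; the coefficient of `T^j` is the one of `t^{-j}`. -/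
def tInf (n l : ℕ) : Ser n l := HahnSeries.single (-1) 1

/-- The coefficient of `T^j` in `f` is the polynomial `c Q`, where `Q ∈ A_{n,l}`, `c ∈ ℂ`. -/
def IsCoeff {n l : ℕ} (f : Ser n l) (j : ℕ) (c : ℂ) (Q : A n l) : Prop :=
  f.coeff (j : ℤ) =
    algebraMap (MvPolynomial (Fin l) (K n)) (KX n l)
      (c • (Q : MvPolynomial (Fin l) (K n)))

open QLoop Complex in
/-- The rule for the action: `Rule n g P Q` says that, for a homogeneous `P`, the formula defining
`g.P` yields the element `Q` of `A_n`. -/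
inductive Rule (n : ℕ) : Gen → ATot n → ATot n → Prop
  | t (l : ℕ) (P : A n l) :
      Rule n .t (incl l P) (I ^ ((n : ℤ) - 2 * l) • incl l P)
  | tInv (l : ℕ) (P : A n l) :
      Rule n .tInv (incl l P) (I ^ (-((n : ℤ) - 2 * l)) • incl l P)
  | xmPos (j l : ℕ) (P : A n l) (Q : A n (1 + l))
      (h : IsCoeff (formXm P.1 (tZero n (1 + l)) (xVar n (1 + l))) j 1 Q) :
      Rule n (.xmPos j) (incl l P) (incl (1 + l) Q)
  | xmNonpos (j l : ℕ) (P : A n l) (Q : A n (1 + l))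
      (h : IsCoeff (formXm P.1 (tInf n (1 + l)) (xVar n (1 + l))) j (-1) Q) :
      Rule n (.xmNonpos j) (incl l P) (incl (1 + l) Q)
  | xmPosSq (j l : ℕ) (P : A n l) (Q : A n (2 + l))
      (h : IsCoeff (formXmSq P.1 (tZero n (2 + l)) (xVar n (2 + l))) j (-4 * I) Q) :
      Rule n (.xmPosSq j) (incl l P) (incl (2 + l) Q)
  | xmNonposSq (j l : ℕ) (P : A n l) (Q : A n (2 + l))
      (h : IsCoeff (formXmSq P.1 (tInf n (2 + l)) (xVar n (2 + l))) j (-4 * I) Q) :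
      Rule n (.xmNonposSq j) (incl l P) (incl (2 + l) Q)
  | aPos (j l : ℕ) (P Q : A n l)
      (h : IsCoeff (formAPos P.1 (tZero n l) (xVar n l)) j 1 Q) :
      Rule n (.aPos j) (incl l P) (incl l Q)
  | aNeg (j l : ℕ) (P Q : A n l)
      (h : IsCoeff (formANeg P.1 (tInf n l) (xVar n l)) j 1 Q) :
      Rule n (.aNeg j) (incl l P) (incl l Q)
  | xpNonneg_zero (j : ℕ) (P : A n 0) : Rule n (.xpNonneg j) (incl 0 P) 0
  | xpNeg_zero (j : ℕ) (P : A n 0) : Rule n (.xpNeg j) (incl 0 P) 0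
  | xpNonneg (j l : ℕ) (P : A n (l + 1)) (Q : A n l)
      (h : IsCoeff (formXp P.1 (tZero n l) (xVar n l)) j (I ^ (1 - (n : ℤ))) Q) :
      Rule n (.xpNonneg j) (incl (l + 1) P) (incl l Q)
  | xpNeg (j l : ℕ) (P : A n (l + 1)) (Q : A n l)
      (h : IsCoeff (formXp P.1 (tInf n l) (xVar n l)) j (-I ^ (1 - (n : ℤ))) Q) :
      Rule n (.xpNeg j) (incl (l + 1) P) (incl l Q)
  | xpNonnegSq_zero (j : ℕ) (P : A n 0) : Rule n (.xpNonnegSq j) (incl 0 P) 0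
  | xpNonnegSq_one (j : ℕ) (P : A n 1) : Rule n (.xpNonnegSq j) (incl 1 P) 0
  | xpNegSq_zero (j : ℕ) (P : A n 0) : Rule n (.xpNegSq j) (incl 0 P) 0
  | xpNegSq_one (j : ℕ) (P : A n 1) : Rule n (.xpNegSq j) (incl 1 P) 0
  | xpNonnegSq (j l : ℕ) (P : A n (l + 2)) (Q : A n l)
      (h : IsCoeff (formXpSq P.1 (tZero n l) (xVar n l)) j (I * (-1) ^ (n + 1)) Q) :
      Rule n (.xpNonnegSq j) (incl (l + 2) P) (incl l Q)
  | xpNegSq (j l : ℕ) (P : A n (l + 2)) (Q : A n l)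
      (h : IsCoeff (formXpSq P.1 (tInf n l) (xVar n l)) j (I * (-1) ^ (n + 1)) Q) :
      Rule n (.xpNegSq j) (incl (l + 2) P) (incl l Q)

/-- The formulas for the generators in `G` map homogeneous elements of `M` into `M`; in particular
they do define elements of `A_n` there. -/
def StableUnderRule {n : ℕ} (G : Set QLoop.Gen) (M : ∀ l : ℕ, Submodule ℂ (A n l)) : Prop :=
  ∀ g ∈ G, ∀ (l : ℕ) (P : A n l), P ∈ M l → ∃ Q ∈ total M, Rule n g (incl l P) Q

/-- The `U_{√-1}`-module structure `ρ` on `A_n` is given by the rule: if `u ∈ U_q^res` is the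
generator `g`, then `1 ⊗ u` acts on homogeneous elements by the formula for `g`. (The `q`-binomials
`[t₁; c over 2]` do not occur in the rule: their action is determined by the other generators.) -/
def FollowsRule {n : ℕ} (ρ : QLoop.Ui →ₐ[ℂ] Module.End (K n) (ATot n)) : Prop :=
  ∀ (g : QLoop.Gen) (u : QLoop.Ures), (u : QLoop.Uq) = g.elt →
    ∀ P Q : ATot n, Rule n g P Q → ρ (QLoop.spec u) P = Q

end Cycles

end

open QLoop Cycles

noncomputable section
namespace Cycles
open MvPolynomial

/-! ## Polynomials in the `X_i`, the `z_j` and `t` -/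

/-! All the formulas are handled by one scheme. On a cycle with polynomial coefficients, each of
them is a sum of terms (scalar series) × (polynomial in t, the X_i and the z_j), where the scalar is
made of constants, t and 1/Θ(±t), and where the polynomial is `Good`: skew-symmetric, of degree less
than n in each X_i, symmetric in the z_j, and zero on the locus for every value of t. The
coefficients of its powers of t are then cycles again (`exists_good`, `Good.hasCoeffs`). At t = 0
the scalars have coefficients in R_n since Θ(0) = 1. At t = ∞ the leading coefficient of Θ(±t) is ±
z_1⋯z_n, and the coefficients are in R̂_n. Laurent coefficients are reduced to polynomial ones by
clearing a power of z_1⋯z_n, the formulas being K_n-homogeneous (`hasCoeffs_of_smul`).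

Vanishing on the locus rests on one remark (`th_eval_eq_zero`): if z_d = -z_c and X = ±1/z_c, then
Θ(X) = Θ(-X) = 0. Hence the kernels F and F^{(2)}, once their apparent poles are divided out, vanish
as soon as one of their arguments is special, and in a wedge product either the kernel or P vanishes
(`good_wedgePoly`). The same dichotomy works for the brackets of a_±(t) (`good_bracket_sum`).

The divided square of the raising current is the substantial case. With s(t) = P(X, -t, t), the sum
of residues is N(t)/Θ(t), where N is the polynomial of degree less than n in t with N(-t)Θ(t) -
N(t)Θ(-t) = s(t) (`formXpSq_eq`). Interpolation at the points 1/z_a gives N with denominators ∏(z_a²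
- z_b²). The poles at z_a = z_b cancel between two terms; those at z_a = -z_b are absent because
s(1/z_a) vanishes there, which is weak minimality (`exists_diffOp_eq`). Uniqueness of N transports
all symmetries from s. On the locus N vanishes at n distinct points 1/z_j when the remaining z_j are
generic, hence identically (`Good.van_of_generic`).

For B^+ the operators x_0^- and (x_0^-)^{(2)} are constant terms at t = ∞, where Laurent
coefficients might appear. They do not, as t enters through Θ(-t)/Θ(t) and t/(X ± t), whose constant
terms are ±1 (`F_mem_constR`, `F2_mem_constR`).

Finally, stability under the formulas must give stability under the whole algebra. The even
coefficients of the divided square of a current are, up to a power of q, ± x_k^{(2)} plus products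
of degree-one elements (`exists_sqCoeff_eq`). Higher divided powers follow from y^{(r)} y^{(2)} =
([r+1][r+2]/[2]) y^{(r+2)}, whose coefficient does not vanish at q = √-1 (`exists_evalQ_eq`). The
q-binomial [t₁; 0 over 2] is read off from the product of (x^+_0)^{(2)} and (x^-_0)^{(2)}
(`xp_sq_mul_xm_sq`), and the others follow by recursion. -/

/-- The polynomials in `X_1, …, X_l` with coefficients in `ℂ[z_1, …, z_n][t]`. -/
abbrev Poly (n l : ℕ) : Type := MvPolynomial (Fin l) (Polynomial (MvPolynomial (Fin n) ℂ))

instance (n l : ℕ) : CommRing (Poly n l) := inferInstance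

section Evaluation

variable {n l : ℕ} {B B' : Type*} [CommSemiring B] [CommSemiring B']

/-- The substitution of `t` and `x` for `t` and the `X_i`, with `φ` on `ℂ[z_1, …, z_n]`. -/
def ev (φ : MvPolynomial (Fin n) ℂ →+* B) (t : B) (x : Fin l → B) : Poly n l →+* B :=
  eval₂Hom (Polynomial.eval₂RingHom φ t) x

/-- The variable `t`. -/
def tv {n l : ℕ} : Poly n l := C Polynomial.X

/-- The inclusion of `ℂ[z_1, …, z_n]`. -/
def zc {n l : ℕ} : MvPolynomial (Fin n) ℂ →+* Poly n l := (C).comp Polynomial.C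

@[simp] theorem ev_tv (φ : MvPolynomial (Fin n) ℂ →+* B) (t : B) (x : Fin l → B) :
    ev φ t x tv = t := by simp [ev, tv]

@[simp] theorem ev_zc (φ : MvPolynomial (Fin n) ℂ →+* B) (t : B) (x : Fin l → B)
    (a : MvPolynomial (Fin n) ℂ) : ev φ t x (zc a) = φ a := by simp [ev, zc]

@[simp] theorem ev_X (φ : MvPolynomial (Fin n) ℂ →+* B) (t : B) (x : Fin l → B) (i : Fin l) :
    ev φ t x (X i) = x i := by simp [ev]

@[simp] theorem ev_C (φ : MvPolynomial (Fin n) ℂ →+* B) (t : B) (x : Fin l → B)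
    (c : Polynomial (MvPolynomial (Fin n) ℂ)) : ev φ t x (C c) = c.eval₂ φ t := by simp [ev]

@[simp] theorem ev_comp_zc (φ : MvPolynomial (Fin n) ℂ →+* B) (t : B) (x : Fin l → B) :
    (ev φ t x).comp zc = φ := by ext <;> simp

theorem ringHom_ext' {f g : Poly n l →+* B} (h1 : f.comp zc = g.comp zc) (h2 : f tv = g tv)
    (h3 : ∀ i, f (X i) = g (X i)) : f = g := by
  refine MvPolynomial.ringHom_ext' (Polynomial.ringHom_ext' ?_ ?_) h3
  · exact h1
  · exact h2

/-- Both sides are ring homomorphisms in q which agree on ℂ[z], t and the X_i. Through this an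
identity in `Poly n l` can be read at complex points, at Laurent series or after a substitution of
polynomials. -/
theorem map_ev (f : B →+* B') (φ : MvPolynomial (Fin n) ℂ →+* B) (t : B) (x : Fin l → B)
    (q : Poly n l) : f (ev φ t x q) = ev (f.comp φ) (f t) (fun i => f (x i)) q := by
  have : f.comp (ev φ t x) = ev (f.comp φ) (f t) (fun i => f (x i)) :=
    ringHom_ext' (by rw [RingHom.comp_assoc, ev_comp_zc, ev_comp_zc]) (by simp) (by simp)
  exact DFunLike.congr_fun this q

theorem ev_ev {k : ℕ} (φ : MvPolynomial (Fin n) ℂ →+* B) (t : B) (x : Fin l → B)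
    (s : Poly n l) (y : Fin k → Poly n l) (q : Poly n k) :
    ev φ t x (ev zc s y q) = ev φ (ev φ t x s) (fun i => ev φ t x (y i)) q := by
  rw [map_ev, ev_comp_zc]

@[simp] theorem ev_self (q : Poly n l) : ev zc tv X q = q := by
  have : ev zc tv X = RingHom.id (Poly n l) := ringHom_ext' (by simp) (by simp) (by simp)
  exact DFunLike.congr_fun this q

theorem ev_rename {k : ℕ} (φ : MvPolynomial (Fin n) ℂ →+* B) (t : B) (x : Fin l → B)
    (f : Fin k → Fin l) (q : Poly n k) : ev φ t x (rename f q) = ev φ t (fun i => x (f i)) q := by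
  simp only [ev, coe_eval₂Hom, eval₂_rename]
  rfl

theorem rename_eq_ev {k : ℕ} (f : Fin k → Fin l) (q : Poly n k) :
    rename f q = ev zc tv (fun i => X (f i)) q := by
  rw [← ev_rename, ev_self]

theorem aeval_eq_ev {k : ℕ} (y : Fin k → Poly n l) (q : Poly n k) :
    aeval y q = ev zc tv y q := by
  have h : Polynomial.eval₂RingHom (zc (n := n) (l := l)) tv = C :=
    Polynomial.ringHom_ext' (by ext <;> simp [zc]) (by simp [tv])
  rw [aeval_def, ev, h]
  rfl

end Evaluation

/-- If `g` vanishes for `X_a = r`, then `X_a - r` divides `g`. -/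
theorem X_sub_dvd {σ R : Type*} [CommRing R] [DecidableEq σ] (a : σ) (r g : MvPolynomial σ R)
    (h : aeval (Function.update X a r) g = 0) : X a - r ∣ g := by
  rw [← Ideal.mem_span_singleton, ← Ideal.Quotient.eq_zero_iff_mem]
  set I := Ideal.span {X a - r}
  have h1 : (Ideal.Quotient.mkₐ R I).comp (aeval (Function.update X a r))
      = Ideal.Quotient.mkₐ R I := by
    ext i
    by_cases hi : i = a
    · subst hi
      simp only [AlgHom.comp_apply, aeval_X, Function.update_self, Ideal.Quotient.mkₐ_eq_mk]
      rw [Eq.comm, Ideal.Quotient.eq]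
      exact Ideal.mem_span_singleton_self _
    · simp [Function.update_of_ne hi]
  have h2 := DFunLike.congr_fun h1 g
  rw [AlgHom.comp_apply, h, map_zero] at h2
  exact h2.symm

theorem exists_mul_eq {n l : ℕ} (a : Fin l) (r g : Poly n l)
    (h : ev zc tv (Function.update X a r) g = 0) : ∃ q, (X a - r) * q = g := by
  obtain ⟨q, hq⟩ := X_sub_dvd a r g (by rw [aeval_eq_ev, h])
  exact ⟨q, hq.symm⟩

/-! ### The product Θ over an arbitrary ring -/

section Theta

variable {n l : ℕ} {B B' : Type*} [CommRing B] [CommRing B']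

/-- `Θ_n(r)` in an arbitrary ring. -/
def th (φ : MvPolynomial (Fin n) ℂ →+* B) (r : B) : B := ∏ j, (1 - φ (X j) * r)

theorem map_th (f : B →+* B') (φ : MvPolynomial (Fin n) ℂ →+* B) (r : B) :
    f (th φ r) = th (f.comp φ) (f r) := by simp [th, map_prod]

@[simp] theorem ev_th (φ : MvPolynomial (Fin n) ℂ →+* B) (t : B) (x : Fin l → B) (r : Poly n l) :
    ev φ t x (th zc r) = th φ (ev φ t x r) := by rw [map_th, ev_comp_zc]

theorem th_comp_rename (φ : MvPolynomial (Fin n) ℂ →+* B) (r : B) (σ : Equiv.Perm (Fin n)) :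
    th (φ.comp (rename σ : MvPolynomial (Fin n) ℂ →ₐ[ℂ] _).toRingHom) r = th φ r := by
  simp only [th]
  rw [← Equiv.prod_comp σ (fun j => 1 - φ (X j) * r)]
  simp

theorem Theta_eq_th {E : Type} [Field E] [Algebra (K n) E] (r : E) :
    Theta n r = th ((algebraMap (K n) E).comp (toK n)) r := rfl

theorem th_eq_zero_of_mul_eq_one (φ : MvPolynomial (Fin n) ℂ →+* B) (r : B) (j : Fin n)
    (h : r * φ (X j) = 1) : th φ r = 0 :=
  Finset.prod_eq_zero (Finset.mem_univ j) (by rw [mul_comm, h, sub_self])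

end Theta

/-! ## Good polynomials -/

section Good

variable {n l : ℕ}

/-- The locus `X_a⁻¹ = z_c = -z_d` for some `a` and some `c ≠ d`, where, if `κ` holds, also
`X_b⁻¹ = -z_c` for some `b`. -/
def Locus (κ : Prop) (x : Fin l → ℂ) (w : Fin n → ℂ) : Prop :=
  ∃ c d, c ≠ d ∧ w d = -w c ∧ (∃ a, x a * w c = 1) ∧ (κ → ∃ b, x b * w c = -1)

/-- `q` is of degree less than `n` in each `X_i`. -/
def DegLT (q : Poly n l) : Prop := ∀ m ∈ q.support, ∀ i, m i < n

/-- The coefficients of `q` are symmetric in the `z_j`. -/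
def Sym (q : Poly n l) : Prop :=
  ∀ σ : Equiv.Perm (Fin n),
    ev ((zc (l := l)).comp (rename σ : MvPolynomial (Fin n) ℂ →ₐ[ℂ] _).toRingHom) tv X q = q

/-- Skew-symmetric polynomials `q` of degree less than `n` in each `X_i`, with coefficients
symmetric in the `z_j`, which vanish on the locus. -/
structure Good (κ : Prop) (q : Poly n l) : Prop where
  skew : ∀ σ : Equiv.Perm (Fin l), rename σ q = ((Equiv.Perm.sign σ : ℤ) : Poly n l) * q
  deg : DegLT q
  sym : Sym q
  van : ∀ (τ : ℂ) (x : Fin l → ℂ) (w : Fin n → ℂ), (∀ j, w j ≠ 0) → Locus κ x w →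
    ev (eval w) τ x q = 0

theorem Sym.ev_comp {q : Poly n l} (hq : Sym q) {B : Type*} [CommRing B]
    (φ : MvPolynomial (Fin n) ℂ →+* B) (t : B) (x : Fin l → B) (σ : Equiv.Perm (Fin n)) :
    ev (φ.comp (rename σ : MvPolynomial (Fin n) ℂ →ₐ[ℂ] _).toRingHom) t x q = ev φ t x q := by
  conv_rhs => rw [← hq σ]
  rw [map_ev, ← RingHom.comp_assoc, ev_comp_zc]
  simp

theorem Good.ev_perm {κ : Prop} {q : Poly n l} (hq : Good κ q) {B : Type*} [CommRing B]
    (φ : MvPolynomial (Fin n) ℂ →+* B) (t : B) (x : Fin l → B) (σ : Equiv.Perm (Fin l)) :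
    ev φ t (fun i => x (σ i)) q = ((Equiv.Perm.sign σ : ℤ) : B) * ev φ t x q := by
  rw [← ev_rename, hq.skew, map_mul, map_intCast]

/-- A skew-symmetric polynomial vanishes if two arguments coincide. -/
theorem Good.ev_eq_zero {κ : Prop} {q : Poly n l} (hq : Good κ q) {B : Type*} [Field B] [CharZero B]
    (φ : MvPolynomial (Fin n) ℂ →+* B) (t : B) (x : Fin l → B) {i j : Fin l} (hij : i ≠ j)
    (h : x i = x j) : ev φ t x q = 0 := by
  have h1 := hq.ev_perm φ t x (Equiv.swap i j)
  have h2 : (fun k => x (Equiv.swap i j k)) = x := by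
    funext k
    by_cases hi : k = i
    · subst hi; simp [h]
    · by_cases hj : k = j
      · subst hj; simp [h]
      · rw [Equiv.swap_apply_of_ne_of_ne hi hj]
  rw [h2, Equiv.Perm.sign_swap hij] at h1
  simpa using self_eq_neg.1 (by simpa using h1)

theorem skew_of_swap {q : Poly n l}
    (h : ∀ i j, i ≠ j → rename (Equiv.swap i j) q = -q) (σ : Equiv.Perm (Fin l)) :
    rename σ q = ((Equiv.Perm.sign σ : ℤ) : Poly n l) * q := by
  induction σ using Equiv.Perm.swap_induction_on with
  | one => simp
  | swap_mul f i j hij ih =>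
    rw [Equiv.Perm.coe_mul, ← rename_rename, ih, map_mul, h i j hij, map_intCast,
      Equiv.Perm.sign_mul, Equiv.Perm.sign_swap hij]
    simp [mul_comm]

/-- The kernels and brackets below are known only as exact quotients. Cancelling in a domain
transfers symmetry from the numerator and the denominator to them. -/
theorem sym_of_mul {r q : Poly n l} (hr0 : r ≠ 0) (hr : Sym r) (h : Sym (r * q)) : Sym q :=
  fun σ => mul_left_cancel₀ hr0 (by
    have := h σ
    rwa [map_mul, hr σ] at this)

theorem Sym.mul {p q : Poly n l} (hp : Sym p) (hq : Sym q) : Sym (p * q) := fun σ => by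
  rw [map_mul, hp σ, hq σ]
theorem Sym.add {p q : Poly n l} (hp : Sym p) (hq : Sym q) : Sym (p + q) := fun σ => by
  rw [map_add, hp σ, hq σ]
theorem Sym.sub {p q : Poly n l} (hp : Sym p) (hq : Sym q) : Sym (p - q) := fun σ => by
  rw [map_sub, hp σ, hq σ]
theorem Sym.neg {p : Poly n l} (hp : Sym p) : Sym (-p) := fun σ => by
  rw [map_neg, hp σ]
theorem Sym.sum {ι : Type*} (s : Finset ι) {f : ι → Poly n l} (h : ∀ i ∈ s, Sym (f i)) :
    Sym (∑ i ∈ s, f i) := fun σ => by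
  rw [map_sum]; exact Finset.sum_congr rfl fun i hi => h i hi σ
theorem sym_X (i : Fin l) : Sym (X i : Poly n l) := fun σ => by simp
theorem sym_tv : Sym (tv : Poly n l) := fun σ => by simp
theorem sym_th {r : Poly n l} (hr : Sym r) : Sym (th zc r) := fun σ => by
  rw [ev_th, hr σ, th_comp_rename]
theorem Sym.ev {k : ℕ} {q : Poly n k} (hq : Sym q) {s : Poly n l} (hs : Sym s)
    {y : Fin k → Poly n l} (hy : ∀ i, Sym (y i)) : Sym (ev zc s y q) := fun σ => by
  rw [ev_ev, hs σ, hq.ev_comp]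
  congr 2
  funext i
  exact hy i σ

theorem X_sub_tv_ne_zero (i : Fin l) : (X i - tv : Poly n l) ≠ 0 := fun h => by
  have := congrArg (Cycles.ev (eval 0) (0 : ℂ) (fun _ => 1)) h
  simp at this

theorem X_add_tv_ne_zero (i : Fin l) : (X i + tv : Poly n l) ≠ 0 := fun h => by
  have := congrArg (Cycles.ev (eval 0) (0 : ℂ) (fun _ => 1)) h
  simp at this

/-- A polynomial in `τ` which vanishes for almost all values of `τ` is zero. -/
theorem ev_eq_zero_of_cofinite {q : Poly n l} (x : Fin l → ℂ) (w : Fin n → ℂ) (s : Finset ℂ)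
    (h : ∀ τ ∉ s, ev (eval w) τ x q = 0) (τ : ℂ) : ev (eval w) τ x q = 0 := by
  have key : ∀ τ, ev (eval w) τ x q =
      (ev (Polynomial.C.comp (eval w)) Polynomial.X (fun i => Polynomial.C (x i)) q).eval τ := by
    intro τ
    rw [← Polynomial.coe_evalRingHom, map_ev]
    congr 2
    · ext <;> simp
    · simp
    · funext i; simp
  have h0 : ev (Polynomial.C.comp (eval w)) Polynomial.X (fun i => Polynomial.C (x i)) q = 0 := by
    refine Polynomial.eq_zero_of_infinite_isRoot _
      (Set.Infinite.mono ?_ s.finite_toSet.infinite_compl)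
    intro τ hτ
    rw [Set.mem_ofPred_eq, Polynomial.IsRoot, ← key]
    exact h τ (by simpa using hτ)
  rw [key, h0, Polynomial.eval_zero]

/-- The alternative q = 0 is needed for n = 0, where the support condition holds for q = 0 although
no `degreeOf` is negative. -/
theorem degLT_iff {q : Poly n l} : DegLT q ↔ ∀ i, q = 0 ∨ degreeOf i q < n := by
  constructor
  · intro h i
    by_cases hq : q = 0
    · exact Or.inl hq
    · right
      obtain ⟨m, hm⟩ := Finset.nonempty_of_ne_empty (mt support_eq_empty.1 hq)
      rw [degreeOf_lt_iff (by have := h m hm i; omega)]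
      exact fun m hm => h m hm i
  · intro h m hm i
    rcases h i with h | h
    · simp [h] at hm
    · exact (monomial_le_degreeOf i hm).trans_lt h

theorem degreeOf_th (i : Fin l) (r : Poly n l) : degreeOf i (th zc r) ≤ n * degreeOf i r := by
  refine (degreeOf_prod_le _ _ _).trans ?_
  refine (Finset.sum_le_card_nsmul _ _ (degreeOf i r) fun j _ => ?_).trans (by simp)
  refine (degreeOf_sub_le _ _ _).trans (max_le (by simp) ((degreeOf_mul_le _ _ _).trans ?_))
  simp [zc]

end Good

end Cycles

end

noncomputable section
namespace Cycles
open MvPolynomial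

/-! ## Series with coefficients in `A_{n,l}` -/

section Series

variable {n l : ℕ}

theorem toK_injective (n : ℕ) : Function.Injective (toK n) :=
  IsFractionRing.injective (MvPolynomial (Fin n) ℂ) (K n)

theorem algebraMap_KX_injective (n l : ℕ) :
    Function.Injective (algebraMap (MvPolynomial (Fin l) (K n)) (KX n l)) :=
  IsFractionRing.injective _ _

instance (n : ℕ) : CharZero (K n) := charZero_of_injective_algebraMap (algebraMap ℂ (K n)).injective

theorem zProd_ne_zero (n : ℕ) : zProd n ≠ 0 :=
  Finset.prod_ne_zero_iff.2 fun j _ => X_ne_zero j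

theorem toK_zProd_ne_zero (n : ℕ) : toK n (zProd n) ≠ 0 := fun h =>
  zProd_ne_zero n (toK_injective n (by rw [h, map_zero]))

theorem zProd_isSymmetric (n : ℕ) : (zProd n).IsSymmetric := fun σ => by
  rw [zProd, map_prod]
  simp only [rename_X]
  exact Equiv.prod_comp σ (fun j => (X j : MvPolynomial (Fin n) ℂ))

theorem mem_R_iff {f : K n} : f ∈ R n ↔ ∃ p : MvPolynomial (Fin n) ℂ, p.IsSymmetric ∧ toK n p = f :=
  Iff.rfl

theorem R_le_RHat (n : ℕ) : R n ≤ RHat n := fun f hf => by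
  obtain ⟨p, hp, rfl⟩ := mem_R_iff.1 hf
  exact ⟨0, p, hp, by simp⟩

theorem inv_zProd_pow_mem (n N : ℕ) : (toK n (zProd n) ^ N)⁻¹ ∈ RHat n :=
  ⟨N, 1, fun σ => by simp, by
    rw [map_one, mul_inv_cancel₀ (pow_ne_zero _ (toK_zProd_ne_zero n))]⟩

/-- The coefficients of the series in `S`. -/
def coeffIn (S : Subalgebra ℂ (K n)) (l : ℕ) : Subring (Ser n l) where
  carrier := {f | ∀ j, ∃ s ∈ S, f.coeff j = algebraMap (K n) (KX n l) s}
  zero_mem' := fun j => ⟨0, S.zero_mem, by simp⟩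
  one_mem' := fun j => by
    by_cases hj : j = 0
    · exact ⟨1, S.one_mem, by simp [hj, HahnSeries.coeff_one]⟩
    · exact ⟨0, S.zero_mem, by simp [hj, HahnSeries.coeff_one]⟩
  add_mem' := fun {f g} hf hg j => by
    obtain ⟨s, hs, h⟩ := hf j
    obtain ⟨r, hr, h'⟩ := hg j
    exact ⟨s + r, S.add_mem hs hr, by simp [h, h']⟩
  neg_mem' := fun {f} hf j => by
    obtain ⟨s, hs, h⟩ := hf j
    exact ⟨-s, S.neg_mem hs, by simp [h]⟩
  mul_mem' := fun {f g} hf hg j => by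
    choose s hs h using hf
    choose r hr h' using hg
    refine ⟨∑ ij ∈ Finset.antidiagonal f.isPWO_support g.isPWO_support j, s ij.1 * r ij.2,
      S.sum_mem fun _ _ => S.mul_mem (hs _) (hr _), ?_⟩
    rw [HahnSeries.coeff_mul, map_sum]
    exact Finset.sum_congr rfl fun ij _ => by rw [h, h', map_mul]

theorem coeffIn_mono {S S' : Subalgebra ℂ (K n)} (h : S ≤ S') {f : Ser n l}
    (hf : f ∈ coeffIn S l) : f ∈ coeffIn S' l := fun j => by
  obtain ⟨s, hs, h'⟩ := hf j
  exact ⟨s, h hs, h'⟩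

theorem algebraMap_eq_C (s : K n) :
    algebraMap (K n) (Ser n l) s = HahnSeries.C (algebraMap (K n) (KX n l) s) := by
  rw [HahnSeries.algebraMap_apply', PowerSeries.algebraMap_apply, HahnSeries.ofPowerSeries_C]

theorem single_mem_coeffIn {S : Subalgebra ℂ (K n)} {s : K n} (hs : s ∈ S) (e : ℤ) :
    (HahnSeries.single e (algebraMap (K n) (KX n l) s) : Ser n l) ∈ coeffIn S l := fun j => by
  by_cases hj : j = e
  · exact ⟨s, hs, by simp [hj]⟩
  · exact ⟨0, S.zero_mem, by simp [HahnSeries.coeff_single_of_ne hj]⟩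

theorem algebraMap_mem_coeffIn {S : Subalgebra ℂ (K n)} {s : K n} (hs : s ∈ S) :
    algebraMap (K n) (Ser n l) s ∈ coeffIn S l := by
  rw [algebraMap_eq_C]
  exact single_mem_coeffIn hs 0

theorem tZero_mem (S : Subalgebra ℂ (K n)) : tZero n l ∈ coeffIn S l := by
  simpa [tZero] using single_mem_coeffIn (l := l) S.one_mem 1

theorem tInf_mem (S : Subalgebra ℂ (K n)) : tInf n l ∈ coeffIn S l := by
  simpa [tInf] using single_mem_coeffIn (l := l) S.one_mem (-1)

/-- The series all coefficients of which are elements of `M`. -/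
def HasCoeffs (M : Submodule ℂ (A n l)) : AddSubgroup (Ser n l) where
  carrier := {f | ∀ j, ∃ Q ∈ M, f.coeff j =
    algebraMap (MvPolynomial (Fin l) (K n)) (KX n l) (Q : MvPolynomial (Fin l) (K n))}
  zero_mem' := fun j => ⟨0, M.zero_mem, by simp⟩
  add_mem' := fun {f g} hf hg j => by
    obtain ⟨s, hs, h⟩ := hf j
    obtain ⟨r, hr, h'⟩ := hg j
    exact ⟨s + r, M.add_mem hs hr, by simp [h, h']⟩
  neg_mem' := fun {f} hf j => by
    obtain ⟨s, hs, h⟩ := hf j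
    exact ⟨-s, M.neg_mem hs, by simp [h]⟩

/-- `M` is stable under multiplication by elements of `S`. -/
def IsStable (S : Subalgebra ℂ (K n)) (M : Submodule ℂ (A n l)) : Prop :=
  ∀ s ∈ S, ∀ Q ∈ M, s • Q ∈ M

/-- A coefficient of the product is a finite convolution sum of elements s • Q with s in S and Q in
M. -/
theorem HasCoeffs.mul {S : Subalgebra ℂ (K n)} {M : Submodule ℂ (A n l)} (hM : IsStable S M)
    {u f : Ser n l} (hu : u ∈ coeffIn S l) (hf : f ∈ HasCoeffs M) : u * f ∈ HasCoeffs M := by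
  intro j
  choose s hs h using hu
  choose r hr h' using hf
  refine ⟨∑ ij ∈ Finset.antidiagonal u.isPWO_support f.isPWO_support j, s ij.1 • r ij.2,
    M.sum_mem fun _ _ => hM _ (hs _) _ (hr _), ?_⟩
  rw [HahnSeries.coeff_mul, Submodule.coe_sum, map_sum]
  refine Finset.sum_congr rfl fun ij _ => ?_
  rw [h, h', Submodule.coe_smul, smul_eq_C_mul, map_mul,
    IsScalarTower.algebraMap_apply (K n) (MvPolynomial (Fin l) (K n)) (KX n l)]
  rfl

theorem C_mem_hasCoeffs {M : Submodule ℂ (A n l)} {Q : A n l} (hQ : Q ∈ M) :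
    (HahnSeries.C (algebraMap (MvPolynomial (Fin l) (K n)) (KX n l)
      (Q : MvPolynomial (Fin l) (K n))) : Ser n l) ∈ HasCoeffs M := fun j => by
  by_cases hj : j = 0
  · exact ⟨Q, hQ, by simp [hj]⟩
  · exact ⟨0, M.zero_mem, by
      rw [HahnSeries.C_apply, HahnSeries.coeff_single_of_ne hj]; simp⟩

/-- The scalar c is the constant on the left of a formula, such as -4i; being non-zero, it can be
divided out within M. -/
theorem HasCoeffs.exists_isCoeff {M : Submodule ℂ (A n l)} {f : Ser n l}
    (hf : f ∈ HasCoeffs M) (j : ℕ) {c : ℂ} (hc : c ≠ 0) : ∃ Q ∈ M, IsCoeff f j c Q := by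
  obtain ⟨Q, hQ, h⟩ := hf j
  refine ⟨c⁻¹ • Q, M.smul_mem _ hQ, ?_⟩
  rw [IsCoeff, h]
  have h2 : ((c⁻¹ • Q : A n l) : MvPolynomial (Fin l) (K n)) = c⁻¹ • (Q : MvPolynomial _ _) := rfl
  rw [h2, smul_inv_smul₀ hc]

/-! ### Polynomials in `t` with good coefficients -/

/-- A polynomial as a polynomial in `t` with coefficients polynomials in the `X_i`. -/
def asPolyT : Poly n l →+* Polynomial (MvPolynomial (Fin l) (MvPolynomial (Fin n) ℂ)) :=
  ev (Polynomial.C.comp C) Polynomial.X (fun i => Polynomial.C (X i))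

theorem eval₂_asPolyT {B : Type*} [CommRing B] (φ : MvPolynomial (Fin n) ℂ →+* B) (t : B)
    (x : Fin l → B) (q : Poly n l) :
    (asPolyT q).eval₂ (eval₂Hom φ x) t = ev φ t x q := by
  rw [asPolyT, ← Polynomial.coe_eval₂RingHom, map_ev]
  congr 2
  · ext <;> simp
  · simp
  · funext i; simp

theorem map_asPolyT {k m : ℕ}
    (ψ : MvPolynomial (Fin l) (MvPolynomial (Fin n) ℂ) →+*
      MvPolynomial (Fin k) (MvPolynomial (Fin m) ℂ)) (q : Poly n l) :
    (asPolyT q).map ψ = ev ((Polynomial.C.comp ψ).comp C) Polynomial.X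
      (fun i => Polynomial.C (ψ (X i))) q := by
  rw [asPolyT, ← Polynomial.coe_mapRingHom, map_ev]
  congr 2
  · ext <;> simp
  · simp
  · funext i; simp

theorem coeff_asPolyT (q : Poly n l) (k : ℕ) (m : Fin l →₀ ℕ) :
    coeff m ((asPolyT q).coeff k) = (coeff m q).coeff k := by
  have hX : ∀ (s : Fin l →₀ ℕ), asPolyT (monomial s 1 : Poly n l)
      = Polynomial.C (monomial s 1) := by
    intro s
    rw [monomial_eq, map_mul, Finsupp.prod, map_prod]
    simp only [map_one, one_mul, map_pow, asPolyT, ev_X, monomial_eq, Finsupp.prod, map_prod]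
  induction q using MvPolynomial.induction_on' with
  | monomial s c =>
    have : (monomial s c : Poly n l) = C c * monomial s 1 := by simp [C_mul_monomial]
    rw [this, map_mul, hX, Polynomial.coeff_mul_C, coeff_C_mul, coeff_monomial]
    have h2 : (asPolyT (C c : Poly n l)).coeff k = C (c.coeff k) := by
      rw [asPolyT, ev_C, ← Polynomial.coeff_map]
      congr 1
    rw [h2, coeff_C_mul, coeff_monomial]
    split_ifs <;> simp
  | add p q hp hq => simp [hp, hq]

/-- `S` is the locus at which the weakly minimal (`κ` true) or minimal (`κ` false) cycles vanish,
up to permutations of the `X_i` and of the `z_j`. -/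
structure IsLocus (κ : Prop) (S : ∀ l, Set ((Fin l → ℂ) × (Fin n → ℂ))) : Prop where
  locus : ∀ l, ∀ y ∈ S l, (∀ j, y.2 j ≠ 0) → Locus κ y.1 y.2
  perm : ∀ l (x : Fin l → ℂ) (w : Fin n → ℂ), (∀ j, w j ≠ 0) → Locus κ x w →
    ∃ (σ : Equiv.Perm (Fin l)) (τ : Equiv.Perm (Fin n)),
      ((fun i => x (σ i)), (fun j => w (τ j))) ∈ S l

/-- The cycles over `S` which vanish on a locus. -/
abbrev Cyc (S : Subalgebra ℂ (K n)) (V : ∀ l, Set ((Fin l → ℂ) × (Fin n → ℂ))) (l : ℕ) :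
    Submodule ℂ (A n l) := withCoeffs S l ⊓ vanishingOn (V l)

variable {κ : Prop} {V : ∀ l, Set ((Fin l → ℂ) × (Fin n → ℂ))}

theorem eval₂Hom_eq_value (x : Fin l → ℂ) (w : Fin n → ℂ) :
    eval₂Hom (eval w) x = value x w := rfl

/-- The coefficient of `t^k`, as an element of `A_{n,l}`. -/
theorem Good.exists_cyc (hV : IsLocus κ V) {q : Poly n l} (hq : Good κ q) (k : ℕ) :
    ∃ Q ∈ Cyc (R n) V l,
      (Q : MvPolynomial (Fin l) (K n)) = map (toK n) ((asPolyT q).coeff k) := by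
  have hskew : ∀ σ : Equiv.Perm (Fin l), rename σ ((asPolyT q).coeff k)
      = ((Equiv.Perm.sign σ : ℤ) : MvPolynomial (Fin l) (MvPolynomial (Fin n) ℂ))
        * (asPolyT q).coeff k := by
    intro σ
    have h1 := hq.ev_perm (Polynomial.C.comp C) Polynomial.X
      (fun i => (Polynomial.C (X i : MvPolynomial (Fin l) (MvPolynomial (Fin n) ℂ)))) σ
    have h2 := map_asPolyT (rename σ :
      MvPolynomial (Fin l) (MvPolynomial (Fin n) ℂ) →ₐ[_] _).toRingHom q
    have h3 : (Polynomial.C.comp (rename σ :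
        MvPolynomial (Fin l) (MvPolynomial (Fin n) ℂ) →ₐ[_] _).toRingHom).comp C
        = (Polynomial.C.comp C : MvPolynomial (Fin n) ℂ →+*
          Polynomial (MvPolynomial (Fin l) (MvPolynomial (Fin n) ℂ))) := by
      ext <;> simp
    rw [h3] at h2
    have h4 : (fun i => Polynomial.C ((rename σ :
        MvPolynomial (Fin l) (MvPolynomial (Fin n) ℂ) →ₐ[MvPolynomial (Fin n) ℂ] _).toRingHom (X i)))
        = fun i => Polynomial.C (X (σ i)) := by
      funext i; simp
    rw [h4, h1] at h2
    have h5 := congrArg (fun p => Polynomial.coeff p k) h2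
    simp only [Polynomial.coeff_map, ← Polynomial.C_eq_intCast, Polynomial.coeff_C_mul] at h5
    exact h5
  have hsym : ∀ σ : Equiv.Perm (Fin n), map (rename σ : MvPolynomial (Fin n) ℂ →ₐ[ℂ] _).toRingHom
      ((asPolyT q).coeff k) = (asPolyT q).coeff k := by
    intro σ
    have h1 := hq.sym.ev_comp (Polynomial.C.comp C) Polynomial.X
      (fun i => (Polynomial.C (X i : MvPolynomial (Fin l) (MvPolynomial (Fin n) ℂ)))) σ
    have h2 := map_asPolyT (map (rename σ : MvPolynomial (Fin n) ℂ →ₐ[ℂ] _).toRingHom) q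
    have h3 : (Polynomial.C.comp (map (rename σ : MvPolynomial (Fin n) ℂ →ₐ[ℂ] _).toRingHom)).comp C
        = ((Polynomial.C.comp C : MvPolynomial (Fin n) ℂ →+*
          Polynomial (MvPolynomial (Fin l) (MvPolynomial (Fin n) ℂ)))).comp
          (rename σ : MvPolynomial (Fin n) ℂ →ₐ[ℂ] _).toRingHom := by
      ext <;> simp
    simp only [map_X] at h2
    rw [h3, h1] at h2
    rw [← Polynomial.coeff_map, h2]
    rfl
  refine ⟨⟨map (toK n) ((asPolyT q).coeff k), fun σ => ?_, fun m hm i => ?_⟩, ⟨fun m => ?_, ?_⟩, rfl⟩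
  · rw [← map_rename, hskew, map_mul, map_intCast, smul_eq_C_mul, map_intCast]
  · refine hq.deg m ?_ i
    rw [mem_support_iff] at hm ⊢
    intro h
    apply hm
    rw [coeff_map, coeff_asPolyT, h, Polynomial.coeff_zero, map_zero]
  · refine ⟨coeff m ((asPolyT q).coeff k), fun σ => ?_, (coeff_map _ _ _).symm⟩
    conv_rhs => rw [← hsym σ]
    rw [coeff_map]
    rfl
  · refine ⟨0, (asPolyT q).coeff k, by simp, fun y hy hy' => ?_⟩
    -- The vanishing on the locus holds for every value τ of t, so the specialized polynomial in t
    -- is zero, and with it each coefficient.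
    have h0 : (asPolyT q).map (value y.1 y.2) = 0 := by
      refine Polynomial.funext fun τ => ?_
      rw [Polynomial.eval_map, ← eval₂Hom_eq_value, eval₂_asPolyT,
        hq.van τ _ _ hy' (hV.locus l y hy hy'), Polynomial.eval_zero]
    rw [← Polynomial.coeff_map, h0, Polynomial.coeff_zero]

/-- The homomorphism from `ℂ[z_1, …, z_n]` to the series. -/
def zSer (n l : ℕ) : MvPolynomial (Fin n) ℂ →+* Ser n l := (algebraMap (K n) (Ser n l)).comp (toK n)

theorem eval₂Hom_xVar (p : MvPolynomial (Fin l) (MvPolynomial (Fin n) ℂ)) :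
    eval₂Hom (zSer n l) (xVar n l) p
      = HahnSeries.C (algebraMap (MvPolynomial (Fin l) (K n)) (KX n l) (map (toK n) p)) := by
  have : eval₂Hom (zSer n l) (xVar n l)
      = (HahnSeries.C.comp (algebraMap (MvPolynomial (Fin l) (K n)) (KX n l))).comp
        (map (toK n)) := by
    refine MvPolynomial.ringHom_ext (fun r => ?_) (fun i => ?_)
    · simp only [coe_eval₂Hom, eval₂_C, zSer, RingHom.comp_apply, algebraMap_eq_C, map_C]
      rw [IsScalarTower.algebraMap_apply (K n) (MvPolynomial (Fin l) (K n)) (KX n l)]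
      rfl
    · simp [xVar]
  exact DFunLike.congr_fun this p

/-- Expand in powers of t: each coefficient is a cycle over R_n, and the powers of the series t have
coefficients in S. Leaving S and M open covers both expansions, with S = R_n at t = 0 and S = R̂_n
at t = ∞. -/
theorem Good.hasCoeffs (hV : IsLocus κ V) {q : Poly n l} (hq : Good κ q)
    {S : Subalgebra ℂ (K n)} {M : Submodule ℂ (A n l)} (hM : IsStable S M)
    (hle : Cyc (R n) V l ≤ M) {t : Ser n l} (ht : t ∈ coeffIn S l) :
    ev (zSer n l) t (xVar n l) q ∈ HasCoeffs M := by
  rw [← eval₂_asPolyT, Polynomial.eval₂_eq_sum_range]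
  refine AddSubgroup.sum_mem _ fun k _ => ?_
  rw [mul_comm]
  refine HasCoeffs.mul hM (Subring.pow_mem _ ht k) ?_
  obtain ⟨Q, hQ, h⟩ := hq.exists_cyc hV k
  rw [eval₂Hom_xVar, ← h]
  exact C_mem_hasCoeffs (hle hQ)

/-! ### From cycles to good polynomials -/

theorem ev_map_C {B : Type*} [CommRing B] (φ : MvPolynomial (Fin n) ℂ →+* B) (t : B)
    (x : Fin l → B) (p : MvPolynomial (Fin l) (MvPolynomial (Fin n) ℂ)) :
    ev φ t x (map Polynomial.C p) = eval₂ φ x p := by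
  rw [ev, coe_eval₂Hom, eval₂_map]
  congr 1
  ext <;> simp

/-- The converse passage to `Good.exists_cyc`, for a polynomial free of t. The definition of cycles
asks for vanishing only at the last X_i and z_j; skew-symmetry in X and symmetry in z spread it to
all positions, as `Locus` requires. -/
theorem exists_good (hV : IsLocus κ V) {P : A n l} (hP : P ∈ Cyc (R n) V l) :
    ∃ p : MvPolynomial (Fin l) (MvPolynomial (Fin n) ℂ),
      map (toK n) p = (P : MvPolynomial (Fin l) (K n)) ∧ Good κ (map Polynomial.C p : Poly n l) := by
  have hinj : Function.Injective (map (toK n) : MvPolynomial (Fin l) (MvPolynomial (Fin n) ℂ) →+* _) :=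
    map_injective _ (toK_injective n)
  obtain ⟨p, hp⟩ : ∃ p : MvPolynomial (Fin l) (MvPolynomial (Fin n) ℂ),
      map (toK n) p = (P : MvPolynomial (Fin l) (K n)) := by
    refine mem_range_map_iff_coeffs_subset.2 fun c hc => ?_
    obtain ⟨m, _, rfl⟩ := mem_coeffs_iff.1 hc
    obtain ⟨s, _, hs⟩ := hP.1 m
    exact ⟨s, hs⟩
  refine ⟨p, hp, fun σ => ?_, fun m hm i => ?_, fun σ => ?_, fun τ x w hw hx => ?_⟩
  · rw [← map_rename]
    have : rename σ p = ((Equiv.Perm.sign σ : ℤ) : MvPolynomial _ _) * p := by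
      apply hinj
      rw [map_rename, hp, P.2.1 σ, map_mul, map_intCast, hp, smul_eq_C_mul, map_intCast]
    rw [this, map_mul, map_intCast]
  · refine P.2.2 m ?_ i
    rw [mem_support_iff] at hm ⊢
    rw [← hp, coeff_map]
    rw [coeff_map] at hm
    exact fun h => hm (by rw [toK_injective n (h.trans (map_zero _).symm), map_zero])
  · rw [ev_map_C]
    have h1 : map (rename σ : MvPolynomial (Fin n) ℂ →ₐ[ℂ] _).toRingHom p = p := by
      ext1 m
      obtain ⟨s, hs, hs'⟩ := hP.1 m
      rw [coeff_map]
      have : coeff m p = s := by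
        apply toK_injective n
        rw [← coeff_map, hp]
        exact hs'.symm
      rw [this]
      exact hs σ
    conv_rhs => rw [← h1]
    rw [← ev_self (map Polynomial.C _), ev_map_C, eval₂_map]
  · rw [ev_map_C]
    obtain ⟨N, r, hr, hr'⟩ := hP.2
    -- Permute the given point into the standard position; h0 is the vanishing there, still with a
    -- factor (z_1⋯z_n)^N, which is non-zero at the point.
    obtain ⟨σ, τ, hmem⟩ := hV.perm l x w hw hx
    have hr1 : r = C (zProd n ^ N) * p := by
      apply hinj
      rw [hr, map_mul, map_C, hp, map_pow (toK n)]
    have h0 := hr' _ hmem (fun j => hw _)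
    have hperm : p = ((Equiv.Perm.sign σ : ℤ) : MvPolynomial _ _) * rename σ p := by
      apply hinj
      rw [map_mul, map_intCast, map_rename, hp, P.2.1 σ, smul_eq_C_mul, map_intCast, ← mul_assoc,
        ← Int.cast_mul]
      have : ((Equiv.Perm.sign σ : ℤˣ) : ℤ) * ((Equiv.Perm.sign σ : ℤˣ) : ℤ) = 1 := by
        rw [← Units.val_mul, Int.units_mul_self, Units.val_one]
      rw [this]; simp
    have hsymp : map (rename τ : MvPolynomial (Fin n) ℂ →ₐ[ℂ] _).toRingHom p = p := by
      ext1 m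
      obtain ⟨s, hs, hs'⟩ := hP.1 m
      rw [coeff_map]
      have : coeff m p = s := by
        apply toK_injective n
        rw [← coeff_map, hp]
        exact hs'.symm
      rw [this]
      exact hs τ
    have hw0 : eval (fun j => w (τ j)) (zProd n) ≠ 0 := by
      simp only [zProd, map_prod, eval_X]
      exact Finset.prod_ne_zero_iff.2 fun j _ => hw _
    have h1 : value (fun i => x (σ i)) (fun j => w (τ j)) p = 0 := by
      rw [hr1, map_mul] at h0
      simpa [value, hw0] using h0
    have h2 : eval₂ (eval w) (fun i => x (σ i)) p = 0 := by
      rw [← hsymp, eval₂_map]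
      rw [value, coe_eval₂Hom] at h1
      convert h1 using 2
      ext <;> simp
    rw [hperm, eval₂_mul, eval₂_rename]
    have : (x ∘ σ) = fun i => x (σ i) := rfl
    rw [this, h2, mul_zero]

theorem coe_smul_A (s : K n) (Q : A n l) : ((s • Q : A n l) : MvPolynomial (Fin l) (K n))
    = C s * (Q : MvPolynomial _ _) := by rw [Submodule.coe_smul, smul_eq_C_mul]

theorem isStable_withCoeffs (S : Subalgebra ℂ (K n)) : IsStable S (withCoeffs S l) :=
  fun s hs Q hQ m => by
    rw [coe_smul_A, coeff_C_mul]
    exact S.mul_mem hs (hQ m)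

/-- Denominators multiply, so the exponents of z_1⋯z_n add up; this is harmless since vanishing is
tested only where all w_j are non-zero. -/
theorem isStable_vanishingOn (V : Set ((Fin l → ℂ) × (Fin n → ℂ))) :
    IsStable (RHat n) (vanishingOn V) := by
  rintro s ⟨N, p, -, hp⟩ Q ⟨M, r, hr, hr'⟩
  refine ⟨N + M, C p * r, ?_, fun y hy hy' => by rw [map_mul, hr' y hy hy', mul_zero]⟩
  rw [map_mul, map_C, hp, hr, coe_smul_A, pow_add, map_mul, map_mul]
  ring

theorem isStable_cyc {S : Subalgebra ℂ (K n)} (hS : S ≤ RHat n) :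
    IsStable S (Cyc S V l) := fun s hs Q hQ =>
  ⟨isStable_withCoeffs S s hs Q hQ.1, isStable_vanishingOn _ s (hS hs) Q hQ.2⟩

theorem cyc_mono : Cyc (R n) V l ≤ Cyc (RHat n) V l := fun _ hP =>
  ⟨fun m => R_le_RHat n (hP.1 m), hP.2⟩

/-- A cycle with Laurent polynomial coefficients is the quotient of one with polynomial coefficients
by a power of `z_1 ⋯ z_n`. -/
theorem exists_smul_mem {P : A n l} (hP : P ∈ Cyc (RHat n) V l) :
    ∃ N : ℕ, (toK n (zProd n) ^ N) • P ∈ Cyc (R n) V l := by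
  choose N p hp h using fun m => hP.1 m
  -- The largest exponent among the finitely many non-zero coefficients clears all of them.
  refine ⟨(P : MvPolynomial (Fin l) (K n)).support.sup N, fun m => ?_, ?_⟩
  · rw [coe_smul_A, coeff_C_mul]
    by_cases hm : m ∈ (P : MvPolynomial (Fin l) (K n)).support
    · obtain ⟨d, hd⟩ := Nat.exists_eq_add_of_le (Finset.le_sup (f := N) hm)
      rw [hd, pow_add, mul_right_comm, ← h, ← map_pow, ← map_mul]
      refine ⟨p m * zProd n ^ d, fun σ => ?_, rfl⟩
      rw [map_mul, hp m, map_pow, zProd_isSymmetric]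
    · rw [notMem_support_iff.1 hm, mul_zero]
      exact (R n).zero_mem
  · refine isStable_vanishingOn _ _ (R_le_RHat n ⟨zProd n ^ _, fun σ => ?_, map_pow _ _ _⟩) _ hP.2
    rw [map_pow, zProd_isSymmetric]

end Series

end Cycles

end

noncomputable section
namespace Cycles
open MvPolynomial

/-! ## The two loci -/

section Loci

variable {n : ℕ}

theorem exists_perm_pair {α : Type*} [DecidableEq α] {p q a b : α} (hpq : p ≠ q) (hab : a ≠ b) :
    ∃ σ : Equiv.Perm α, σ p = a ∧ σ q = b := by
  have h1 : (Equiv.swap p a) b ≠ p := by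
    intro h
    rw [Equiv.swap_apply_eq_iff, Equiv.swap_apply_left] at h
    exact hab h.symm
  refine ⟨Equiv.swap p a * Equiv.swap q (Equiv.swap p a b), ?_, ?_⟩
  · rw [Equiv.Perm.mul_apply, Equiv.swap_apply_of_ne_of_ne hpq h1.symm, Equiv.swap_apply_left]
  · rw [Equiv.Perm.mul_apply, Equiv.swap_apply_left, Equiv.swap_apply_self]

theorem exists_last_two {n : ℕ} {c d : Fin n} (h : c ≠ d) :
    ∃ c' d' : Fin n, (c' : ℕ) + 2 = n ∧ (d' : ℕ) + 1 = n ∧ c' ≠ d' := by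
  have : (c : ℕ) ≠ d := fun h' => h (Fin.ext h')
  have hc := c.2
  have hd := d.2
  refine ⟨⟨n - 2, by omega⟩, ⟨n - 1, by omega⟩, ?_, ?_, ?_⟩
  · change n - 2 + 2 = n; omega
  · change n - 1 + 1 = n; omega
  · intro h'
    have : n - 2 = n - 1 := congrArg Fin.val h'
    omega

theorem isLocus_weak : IsLocus True (weakLocus n) where
  locus := by
    rintro l y ⟨a, b, c, d, -, -, hc, hd, h1, h2, h3⟩ hw
    refine ⟨c, d, fun h => by rw [h] at hc; omega, neg_eq_iff_eq_neg.1 h3, ⟨a, ?_⟩, fun _ => ⟨b, ?_⟩⟩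
    · rw [← h1]
      refine mul_inv_cancel₀ fun h => hw c ?_
      rw [← h1, h, inv_zero]
    · rw [← h2, mul_neg, mul_inv_cancel₀]
      exact fun h => hw c (by rw [← h2, h, inv_zero, neg_zero])
  perm := by
    rintro l x w hw ⟨c, d, hcd, hw', ⟨a, ha⟩, hb⟩
    obtain ⟨b, hb⟩ := hb trivial
    have hab : a ≠ b := by
      rintro rfl
      rw [ha] at hb
      norm_num at hb
    obtain ⟨a', b', ha', hb', hne⟩ := exists_last_two hab
    obtain ⟨c', d', hc', hd', hne'⟩ := exists_last_two hcd
    obtain ⟨σ, rfl, rfl⟩ := exists_perm_pair hne hab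
    obtain ⟨τ, rfl, rfl⟩ := exists_perm_pair hne' hcd
    refine ⟨σ, τ, a', b', c', d', ha', hb', hc', hd', ?_, ?_, ?_⟩
    · exact inv_eq_of_mul_eq_one_right ha
    · change -(x (σ b'))⁻¹ = w (τ c')
      rw [inv_eq_of_mul_eq_one_right (b := -w (τ c')) (by rw [mul_neg, hb, neg_neg]), neg_neg]
    · change -w (τ d') = w (τ c')
      rw [hw', neg_neg]

theorem isLocus_min : IsLocus False (minLocus n) where
  locus := by
    rintro l y ⟨a, c, d, -, hc, hd, h1, h3⟩ hw
    refine ⟨c, d, fun h => by rw [h] at hc; omega, neg_eq_iff_eq_neg.1 h3, ⟨a, ?_⟩, False.elim⟩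
    rw [← h1]
    refine mul_inv_cancel₀ fun h => hw c ?_
    rw [← h1, h, inv_zero]
  perm := by
    rintro l x w hw ⟨c, d, hcd, hw', ⟨a, ha⟩, -⟩
    obtain ⟨c', d', hc', hd', hne'⟩ := exists_last_two hcd
    obtain ⟨τ, rfl, rfl⟩ := exists_perm_pair hne' hcd
    have hl : l - 1 + 1 = l := by have := a.2; omega
    have hlt : l - 1 < l := by omega
    refine ⟨Equiv.swap ⟨l - 1, hlt⟩ a, τ, ⟨l - 1, hlt⟩, c', d', hl, hc', hd', ?_, ?_⟩
    · change (x (Equiv.swap ⟨l - 1, hlt⟩ a ⟨l - 1, hlt⟩))⁻¹ = w (τ c')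
      rw [Equiv.swap_apply_left]
      exact inv_eq_of_mul_eq_one_right ha
    · change -w (τ d') = w (τ c')
      rw [hw', neg_neg]

end Loci

/-! ## Admissible values of `t` -/

section Admissible

variable {n l : ℕ}

/-- A value of `t` for which `1 / Θ(±t)` has coefficients in `S`. -/
structure Adm (S : Subalgebra ℂ (K n)) (t : Ser n l) : Prop where
  mem : t ∈ coeffIn S l
  ne_zero : t ≠ 0
  th_ne : th (zSer n l) t ≠ 0
  th_neg_ne : th (zSer n l) (-t) ≠ 0
  inv_mem : (th (zSer n l) t)⁻¹ ∈ coeffIn S l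
  inv_neg_mem : (th (zSer n l) (-t))⁻¹ ∈ coeffIn S l
  x_ne : ∀ i, xVar n l i - t ≠ 0
  x_ne_neg : ∀ i, xVar n l i + t ≠ 0

theorem Adm.neg {S : Subalgebra ℂ (K n)} {t : Ser n l} (h : Adm S t) : Adm S (-t) where
  mem := Subring.neg_mem _ h.mem
  ne_zero := neg_ne_zero.2 h.ne_zero
  th_ne := h.th_neg_ne
  th_neg_ne := by rw [neg_neg]; exact h.th_ne
  inv_mem := h.inv_neg_mem
  inv_neg_mem := by rw [neg_neg]; exact h.inv_mem
  x_ne := fun i => by rw [sub_neg_eq_add]; exact h.x_ne_neg i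
  x_ne_neg := fun i => by rw [← sub_eq_add_neg]; exact h.x_ne i

/-- Power series over `ℂ[z_1, …, z_n]` as Laurent series. -/
def powSer (n l : ℕ) : PowerSeries (MvPolynomial (Fin n) ℂ) →+* Ser n l :=
  (HahnSeries.ofPowerSeries ℤ (KX n l)).comp
    (PowerSeries.map ((algebraMap (K n) (KX n l)).comp (toK n)))

theorem powSer_C (p : MvPolynomial (Fin n) ℂ) :
    powSer n l (PowerSeries.C p) = zSer n l p := by
  rw [powSer, RingHom.comp_apply, PowerSeries.map_C, HahnSeries.ofPowerSeries_C]
  exact (algebraMap_eq_C _).symm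

theorem powSer_X : powSer n l PowerSeries.X = HahnSeries.single 1 1 := by
  rw [powSer, RingHom.comp_apply, PowerSeries.map_X, HahnSeries.ofPowerSeries_X]

/-- The inverse is taken in S[[T]], where the series is a unit because its constant term is one in
S, and then mapped to Laurent series. Uniqueness of inverses identifies the two. -/
theorem powSer_inv_mem {S : Subalgebra ℂ (K n)} (hS : R n ≤ S)
    {θ : PowerSeries (MvPolynomial (Fin n) ℂ)} (hθ : ∀ k, (PowerSeries.coeff k θ).IsSymmetric)
    (h0 : PowerSeries.constantCoeff θ ≠ 0)
    (hinv : (toK n (PowerSeries.constantCoeff θ))⁻¹ ∈ S) :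
    powSer n l θ ≠ 0 ∧ (powSer n l θ)⁻¹ ∈ coeffIn S l := by
  let θS : PowerSeries S :=
    PowerSeries.mk fun k => ⟨toK n (PowerSeries.coeff k θ), hS ⟨_, hθ k, rfl⟩⟩
  have hθS : PowerSeries.map (S.val : S →+* K n) θS = PowerSeries.map (toK n) θ := by
    ext k; simp [θS]
  have hunit : IsUnit θS := by
    rw [PowerSeries.isUnit_iff_constantCoeff]
    refine IsUnit.of_mul_eq_one ⟨_, hinv⟩ (Subtype.ext ?_)
    change toK n (PowerSeries.coeff 0 θ) * _ = 1
    rw [PowerSeries.coeff_zero_eq_constantCoeff_apply]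
    refine mul_inv_cancel₀ fun h => h0 (toK_injective n (by rw [h, map_zero]))
  obtain ⟨γ, hγ⟩ := hunit.exists_right_inv
  have h1 : powSer n l θ = (HahnSeries.ofPowerSeries ℤ (KX n l)).comp
      (PowerSeries.map ((algebraMap (K n) (KX n l)).comp (S.val : S →+* K n))) θS := by
    rw [powSer, PowerSeries.map_comp, PowerSeries.map_comp, RingHom.comp_apply, RingHom.comp_apply,
      RingHom.comp_apply, RingHom.comp_apply, hθS]
  have h2 := congrArg ((HahnSeries.ofPowerSeries ℤ (KX n l)).comp
      (PowerSeries.map ((algebraMap (K n) (KX n l)).comp (S.val : S →+* K n)))) hγ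
  rw [map_mul, ← h1, map_one] at h2
  refine ⟨left_ne_zero_of_mul_eq_one h2, ?_⟩
  rw [← eq_inv_of_mul_eq_one_right h2]
  intro j
  rw [RingHom.comp_apply, PowerSeries.coeff_coe]
  split_ifs
  · exact ⟨0, S.zero_mem, by simp⟩
  · exact ⟨((PowerSeries.coeff j.natAbs γ : S) : K n), Subtype.property _, by simp⟩

theorem coeff_isSymmetric_of_map {θ : PowerSeries (MvPolynomial (Fin n) ℂ)}
    (h : ∀ σ : Equiv.Perm (Fin n),
      PowerSeries.map (rename σ : MvPolynomial (Fin n) ℂ →ₐ[ℂ] _).toRingHom θ = θ) (k : ℕ) :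
    (PowerSeries.coeff k θ).IsSymmetric := fun σ => by
  conv_rhs => rw [← h σ]
  simp

theorem map_th_powerSeries (c : MvPolynomial (Fin n) ℂ) (hc : c.IsSymmetric)
    (σ : Equiv.Perm (Fin n)) :
    PowerSeries.map (rename σ : MvPolynomial (Fin n) ℂ →ₐ[ℂ] _).toRingHom
      (th PowerSeries.C (PowerSeries.C c * PowerSeries.X)) =
    th PowerSeries.C (PowerSeries.C c * PowerSeries.X) := by
  rw [map_th, ← th_comp_rename PowerSeries.C _ σ]
  congr 1
  · ext <;> simp
  · rw [map_mul, PowerSeries.map_C, PowerSeries.map_X]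
    congr 2
    exact hc σ

theorem th_single_one (c : MvPolynomial (Fin n) ℂ) :
    th (zSer n l) (zSer n l c * tZero n l)
      = powSer n l (th PowerSeries.C (PowerSeries.C c * PowerSeries.X)) := by
  rw [map_th, map_mul, powSer_C, powSer_X]
  congr 1
  exact RingHom.ext fun x => (powSer_C x).symm

/-- The constant term of Θ(ct) is 1, so no inverse of any z_j is created. It is applied with c = ±1.
-/
theorem th_tZero_inv_mem (c : MvPolynomial (Fin n) ℂ) (hc : c.IsSymmetric) :
    th (zSer n l) (zSer n l c * tZero n l) ≠ 0 ∧
      (th (zSer n l) (zSer n l c * tZero n l))⁻¹ ∈ coeffIn (R n) l := by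
  have h1 : PowerSeries.constantCoeff
      (th PowerSeries.C (PowerSeries.C c * PowerSeries.X)) = (1 : MvPolynomial (Fin n) ℂ) := by
    rw [map_th]; simp [th]
  rw [th_single_one]
  refine powSer_inv_mem le_rfl (coeff_isSymmetric_of_map (map_th_powerSeries c hc)) ?_ ?_
  · rw [h1]; exact one_ne_zero
  · rw [h1, map_one, inv_one]; exact (R n).one_mem

theorem tZero_mul_tInf : tZero n l * tInf n l = 1 := by
  rw [tZero, tInf, HahnSeries.single_mul_single]; simp

theorem th_tInf (c : MvPolynomial (Fin n) ℂ) :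
    th (zSer n l) (zSer n l c * tInf n l)
      = tInf n l ^ n * powSer n l (∏ j, (PowerSeries.X - PowerSeries.C (c * X j))) := by
  rw [map_prod, th]
  conv_rhs => rw [show tInf n l ^ n = ∏ _j : Fin n, tInf n l by simp, ← Finset.prod_mul_distrib]
  refine Finset.prod_congr rfl fun j _ => ?_
  rw [map_sub, powSer_C, powSer_X, map_mul, mul_sub]
  have := tZero_mul_tInf (n := n) (l := l)
  rw [tZero] at this
  rw [mul_comm (tInf n l) (HahnSeries.single 1 1), this]
  ring

/-- With t = T⁻¹ one has Θ(ct) = T^{-n} ∏(T - c z_j), whose second factor has constant term (-c)^n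
z_1⋯z_n. This is a unit of R̂_n but in general not of R_n, which is why expansions at infinity need
Laurent coefficients. -/
theorem th_tInf_inv_mem (c : MvPolynomial (Fin n) ℂ) (hc : c.IsSymmetric) (hc1 : c * c = 1) :
    th (zSer n l) (zSer n l c * tInf n l) ≠ 0 ∧
      (th (zSer n l) (zSer n l c * tInf n l))⁻¹ ∈ coeffIn (RHat n) l := by
  have h1 : PowerSeries.constantCoeff
      (∏ j, (PowerSeries.X - PowerSeries.C (c * X j : MvPolynomial (Fin n) ℂ)))
        = (-c) ^ n * zProd n := by
    rw [map_prod, zProd]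
    simp only [map_sub, PowerSeries.constantCoeff_X, PowerSeries.constantCoeff_C, zero_sub,
      ← neg_mul]
    rw [Finset.prod_mul_distrib]
    simp
  have hcn : (-c) ^ n * (-c) ^ n = 1 := by rw [← mul_pow, neg_mul_neg, hc1, one_pow]
  have hinf : tInf n l ≠ 0 := right_ne_zero_of_mul_eq_one tZero_mul_tInf
  have key : powSer n l (∏ j, (PowerSeries.X - PowerSeries.C (c * X j))) ≠ 0 ∧
      (powSer n l (∏ j, (PowerSeries.X - PowerSeries.C (c * X j))))⁻¹ ∈ coeffIn (RHat n) l := by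
    refine powSer_inv_mem (R_le_RHat n) (coeff_isSymmetric_of_map fun σ => ?_) ?_ ?_
    · rw [map_prod]
      rw [← Equiv.prod_comp σ (fun j => PowerSeries.X - PowerSeries.C (c * X j))]
      refine Finset.prod_congr rfl fun j _ => ?_
      rw [map_sub, PowerSeries.map_X, PowerSeries.map_C]
      congr 2
      simp [hc σ]
    · rw [h1]
      exact mul_ne_zero (left_ne_zero_of_mul_eq_one hcn) (zProd_ne_zero n)
    · rw [h1, map_mul, mul_inv]
      refine (RHat n).mul_mem ?_ (by simpa using inv_zProd_pow_mem n 1)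
      rw [inv_eq_of_mul_eq_one_right (b := toK n ((-c) ^ n)) (by rw [← map_mul, hcn, map_one])]
      refine R_le_RHat n ⟨_, fun σ => ?_, rfl⟩
      rw [map_pow, map_neg, hc σ]
  rw [th_tInf]
  refine ⟨mul_ne_zero (pow_ne_zero _ hinf) key.1, ?_⟩
  rw [mul_inv, ← inv_pow, inv_eq_of_mul_eq_one_left tZero_mul_tInf]
  exact Subring.mul_mem _ (Subring.pow_mem _ (tZero_mem _) _) key.2

theorem C_ne_single {a : KX n l} (ha : a ≠ 0) {e : ℤ} (he : e ≠ 0) (b : KX n l) :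
    (HahnSeries.C a : Ser n l) ≠ HahnSeries.single e b := fun h => by
  have := congrArg (fun f => HahnSeries.coeff f 0) h
  simp only [HahnSeries.C_apply, HahnSeries.coeff_single_same,
    HahnSeries.coeff_single_of_ne he.symm] at this
  exact ha this

theorem xKX_ne_zero (i : Fin l) : algebraMap (MvPolynomial (Fin l) (K n)) (KX n l) (X i) ≠ 0 :=
  fun h => X_ne_zero (R := K n) i (algebraMap_KX_injective n l (by rw [h, map_zero]))

theorem adm_tZero : Adm (R n) (tZero n l) where
  mem := tZero_mem _
  ne_zero := left_ne_zero_of_mul_eq_one tZero_mul_tInf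
  th_ne := by simpa using (th_tZero_inv_mem (l := l) (1 : MvPolynomial (Fin n) ℂ) fun σ => by simp).1
  th_neg_ne := by
    simpa using (th_tZero_inv_mem (l := l) (-1 : MvPolynomial (Fin n) ℂ) fun σ => by simp).1
  inv_mem := by
    simpa using (th_tZero_inv_mem (l := l) (1 : MvPolynomial (Fin n) ℂ) fun σ => by simp).2
  inv_neg_mem := by
    simpa using (th_tZero_inv_mem (l := l) (-1 : MvPolynomial (Fin n) ℂ) fun σ => by simp).2
  x_ne := fun i => sub_ne_zero.2 (C_ne_single (xKX_ne_zero i) one_ne_zero _)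
  x_ne_neg := fun i h => by
    rw [← sub_neg_eq_add, sub_eq_zero, tZero, ← HahnSeries.single_neg] at h
    exact C_ne_single (xKX_ne_zero i) one_ne_zero _ h

theorem adm_tInf : Adm (RHat n) (tInf n l) where
  mem := tInf_mem _
  ne_zero := right_ne_zero_of_mul_eq_one tZero_mul_tInf
  th_ne := by
    simpa using (th_tInf_inv_mem (l := l) (1 : MvPolynomial (Fin n) ℂ) (fun σ => by simp) (by simp)).1
  th_neg_ne := by
    simpa using (th_tInf_inv_mem (l := l) (-1 : MvPolynomial (Fin n) ℂ) (fun σ => by simp) (by simp)).1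
  inv_mem := by
    simpa using (th_tInf_inv_mem (l := l) (1 : MvPolynomial (Fin n) ℂ) (fun σ => by simp) (by simp)).2
  inv_neg_mem := by
    simpa using (th_tInf_inv_mem (l := l) (-1 : MvPolynomial (Fin n) ℂ) (fun σ => by simp) (by simp)).2
  x_ne := fun i => sub_ne_zero.2 (C_ne_single (xKX_ne_zero i) (by norm_num) _)
  x_ne_neg := fun i h => by
    rw [← sub_neg_eq_add, sub_eq_zero, tInf, ← HahnSeries.single_neg] at h
    exact C_ne_single (xKX_ne_zero i) (by norm_num) _ h

theorem xVar_add_ne_zero (i j : Fin l) : xVar n l i + xVar n l j ≠ 0 := fun h => by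
  rw [xVar, xVar, ← map_add, ← map_add] at h
  have h1 := algebraMap_KX_injective n l ((HahnSeries.C_injective (h.trans (map_zero _).symm)).trans
    (map_zero _).symm)
  have h2 := congrArg (eval fun _ => (1 : K n)) h1
  simp only [map_add, eval_X, map_zero] at h2
  norm_num at h2

end Admissible

end Cycles

end

noncomputable section
namespace Cycles
open MvPolynomial

/-! ## Wedge products -/

section Wedge

variable {n a b : ℕ}

/-- The wedge product of two polynomials. -/
def wedgePoly (g : Poly n a) (p : Poly n b) : Poly n (a + b) :=
  zc (C ((a.factorial : ℂ) * (b.factorial : ℂ))⁻¹) *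
    ∑ σ : Equiv.Perm (Fin (a + b)), ((Equiv.Perm.sign σ : ℤ) : Poly n (a + b)) *
      (ev zc tv (fun i => X (σ (Fin.castAdd b i))) g * ev zc tv (fun i => X (σ (Fin.natAdd a i))) p)

theorem ev_wedgePoly {B : Type*} [CommRing B] (φ : MvPolynomial (Fin n) ℂ →+* B) (t : B)
    (x : Fin (a + b) → B) (g : Poly n a) (p : Poly n b) :
    ev φ t x (wedgePoly g p) = φ (C ((a.factorial : ℂ) * (b.factorial : ℂ))⁻¹) *
      ∑ σ : Equiv.Perm (Fin (a + b)), ((Equiv.Perm.sign σ : ℤ) : B) *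
      (ev φ t (fun i => x (σ (Fin.castAdd b i))) g *
        ev φ t (fun i => x (σ (Fin.natAdd a i))) p) := by
  simp only [wedgePoly, map_mul, map_sum, ev_zc, map_intCast, ev_ev, ev_tv, ev_X]

/-- Pulls the scalar u out of a wedge product. The identity for f is required only at sub-tuples of
the permuted x, because the kernels have denominators which are known to be non-zero only there. -/
theorem wedge_eq {E : Type} [Field E] [Algebra (K n) E] (t : E)
    (x : Fin (a + b) → E) (u : E) (f : (Fin a → E) → E) (g : Poly n a)
    (hf : ∀ σ : Equiv.Perm (Fin (a + b)), f (fun k => x (σ (Fin.castAdd b k)))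
      = u * ev ((algebraMap (K n) E).comp (toK n)) t (fun k => x (σ (Fin.castAdd b k))) g)
    (h : (Fin b → E) → E) (p : Poly n b)
    (hh : ∀ y, h y = ev ((algebraMap (K n) E).comp (toK n)) t y p) :
    wedge f h x = u * ev ((algebraMap (K n) E).comp (toK n)) t x (wedgePoly g p) := by
  have hc : ((algebraMap (K n) E).comp (toK n)) (C ((a.factorial : ℂ) * (b.factorial : ℂ))⁻¹)
      = ((a.factorial : E) * (b.factorial : E))⁻¹ := by
    rw [← RingHom.comp_apply, map_inv₀, map_mul, map_natCast, map_natCast]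
  rw [wedge, ev_wedgePoly, hc, mul_left_comm u, Finset.mul_sum _ _ u]
  refine congrArg _ (Finset.sum_congr rfl fun σ _ => ?_)
  rw [hf, hh]
  ring

/-- Polynomials in `X_1, …, X_a` and `t` of degree less than `n` in each `X_i` which vanish if some
`X_i = ± z_c⁻¹ = ∓ z_d⁻¹`. -/
structure Kernel (g : Poly n a) : Prop where
  deg : DegLT g
  sym : Sym g
  van : ∀ (τ : ℂ) (x : Fin a → ℂ) (w : Fin n → ℂ) (c d : Fin n), c ≠ d → w d = -w c →
    ∀ i, (x i * w c) ^ 2 = 1 → ev (eval w) τ x g = 0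

theorem DegLT.add {l : ℕ} {p q : Poly n l} (hp : DegLT p) (hq : DegLT q) : DegLT (p + q) :=
  fun m hm i => by
    classical
    rcases Finset.mem_union.1 (support_add hm) with h | h
    · exact hp m h i
    · exact hq m h i

theorem DegLT.sum {l : ℕ} {ι : Type*} {s : Finset ι} {f : ι → Poly n l}
    (h : ∀ i ∈ s, DegLT (f i)) : DegLT (∑ i ∈ s, f i) := by
  classical
  induction s using Finset.induction_on with
  | empty => intro m hm; simp at hm
  | insert i s hi ih =>
    rw [Finset.sum_insert hi]
    exact (h i (by simp)).add (ih fun j hj => h j (by simp [hj]))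

theorem DegLT.C_mul {l : ℕ} {q : Poly n l} (hq : DegLT q)
    (c : Polynomial (MvPolynomial (Fin n) ℂ)) : DegLT (C c * q) := fun m hm i => by
  refine hq m ?_ i
  rw [mem_support_iff, coeff_C_mul] at hm
  exact mem_support_iff.2 (right_ne_zero_of_mul hm)

/-- The two factors involve disjoint sets of variables, so for each variable the exponent comes from
one factor alone and the bounds do not add. -/
theorem DegLT.rename_mul_rename {l : ℕ} {p : Poly n a} {q : Poly n b} (hp : DegLT p) (hq : DegLT q)
    {f : Fin a → Fin l} {g : Fin b → Fin l} (hf : Function.Injective f) (hg : Function.Injective g)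
    (hfg : ∀ i j, f i ≠ g j) (hcov : ∀ k, (∃ i, f i = k) ∨ ∃ j, g j = k) :
    DegLT (rename f p * rename g q) := by
  classical
  intro m hm k
  obtain ⟨m1, h1, m2, h2, rfl⟩ := Finset.mem_add.1 (support_mul _ _ hm)
  rw [support_rename_of_injective hf] at h1
  rw [support_rename_of_injective hg] at h2
  obtain ⟨k1, hk1, rfl⟩ := Finset.mem_image.1 h1
  obtain ⟨k2, hk2, rfl⟩ := Finset.mem_image.1 h2
  rw [Finsupp.add_apply]
  rcases hcov k with ⟨i, rfl⟩ | ⟨j, rfl⟩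
  · rw [Finsupp.mapDomain_apply hf, Finsupp.mapDomain_of_notMem_range, add_zero]
    · exact hp k1 hk1 i
    · rintro ⟨j, hj⟩; exact hfg i j hj.symm
  · rw [Finsupp.mapDomain_apply hg, Finsupp.mapDomain_of_notMem_range, zero_add]
    · exact hq k2 hk2 j
    · rintro ⟨i, hi⟩; exact hfg i j hi

/-- The wedge is examined term by term at a point of the locus. If a special X_a (or X_b, when κ
holds) is an argument of the kernel, the kernel vanishes; otherwise all special variables are
arguments of p, and p vanishes. This is why `Kernel` asks for vanishing at a single special argument
of either sign. -/
theorem good_wedgePoly {κ : Prop} {g : Poly n a} {p : Poly n b} (hg : Kernel g) (hp : Good κ p) :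
    Good κ (wedgePoly g p) where
  skew ρ := by
    rw [rename_eq_ev, ev_wedgePoly, wedgePoly, mul_left_comm]
    congr 1
    -- Reindexing by σ ↦ ρσ; the sign of ρ then occurs twice and cancels.
    rw [Finset.mul_sum, ← Equiv.sum_comp (Equiv.mulLeft ρ) (fun σ =>
      ((Equiv.Perm.sign ρ : ℤ) : Poly n (a + b)) * (((Equiv.Perm.sign σ : ℤ) : Poly n (a + b)) *
      (ev zc tv (fun i => X (σ (Fin.castAdd b i))) g *
        ev zc tv (fun i => X (σ (Fin.natAdd a i))) p)))]
    refine Finset.sum_congr rfl fun σ _ => ?_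
    rw [Equiv.coe_mulLeft, Equiv.Perm.sign_mul, Units.val_mul, Int.cast_mul]
    have h1 : ((Equiv.Perm.sign ρ : ℤ) : Poly n (a + b)) * ((Equiv.Perm.sign ρ : ℤ) : Poly n (a + b))
        = 1 := by
      rw [← Int.cast_mul, ← Units.val_mul, Int.units_mul_self, Units.val_one, Int.cast_one]
    simp only [Equiv.Perm.mul_apply]
    rw [show ∀ r s x : Poly n (a + b), r * (r * s * x) = r * r * (s * x) from
      fun _ _ _ => by ring, h1, one_mul]
  deg := by
    refine DegLT.C_mul (DegLT.sum fun σ _ => ?_) _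
    rw [← map_intCast (C : _ →+* Poly n (a + b))]
    refine DegLT.C_mul ?_ _
    rw [← rename_eq_ev (fun i => σ (Fin.castAdd b i)), ← rename_eq_ev (fun i => σ (Fin.natAdd a i))]
    refine hg.deg.rename_mul_rename hp.deg (σ.injective.comp (Fin.castAdd_injective _ _))
      (σ.injective.comp (Fin.natAdd_injective _ _)) (fun i j h => ?_) fun k => ?_
    · have := congrArg Fin.val (σ.injective h)
      simp only [Fin.val_castAdd, Fin.val_natAdd] at this
      omega
    · obtain ⟨k, rfl⟩ := σ.surjective k
      refine Fin.addCases (fun i => Or.inl ⟨i, rfl⟩) (fun j => Or.inr ⟨j, rfl⟩) k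
  sym ρ := by
    rw [ev_wedgePoly, wedgePoly]
    have h1 (c : ℂ) : (zc (l := a + b)).comp
        (rename ρ : MvPolynomial (Fin n) ℂ →ₐ[ℂ] _).toRingHom (C c) = zc (C c) := by simp
    rw [h1]
    refine congrArg _ (Finset.sum_congr rfl fun σ _ => ?_)
    rw [hg.sym.ev_comp, hp.sym.ev_comp]
  van τ x w hw hx := by
    rw [ev_wedgePoly]
    refine mul_eq_zero_of_right _ (Finset.sum_eq_zero fun σ _ => mul_eq_zero_of_right _ ?_)
    obtain ⟨c, d, hcd, hw', ⟨i, hi⟩, hj⟩ := hx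
    obtain ⟨i, rfl⟩ := σ.surjective i
    revert hi
    refine Fin.addCases (fun i hi => ?_) (fun i hi => ?_) i
    · refine mul_eq_zero_of_left (hg.van τ _ w c d hcd hw' i ?_) _
      rw [hi, one_pow]
    · by_cases hκ : κ
      · obtain ⟨j, hj⟩ := hj hκ
        obtain ⟨j, rfl⟩ := σ.surjective j
        revert hj
        refine Fin.addCases (fun j hj => ?_) (fun j hj => ?_) j
        · refine mul_eq_zero_of_left (hg.van τ _ w c d hcd hw' j ?_) _
          rw [hj]; norm_num
        · exact mul_eq_zero_of_right _ (hp.van τ _ w hw ⟨c, d, hcd, hw', ⟨i, hi⟩, fun _ => ⟨j, hj⟩⟩)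
      · exact mul_eq_zero_of_right _
          (hp.van τ _ w hw ⟨c, d, hcd, hw', ⟨i, hi⟩, fun h => absurd h hκ⟩)

end Wedge

/-! ## The kernels of the lowering operators -/

section Kernels

variable {n : ℕ}

theorem one_le_degreeOf {l : ℕ} (i : Fin l) (r : Poly n l) (hr : degreeOf i r = 0) :
    1 ≤ degreeOf i (X i + r) := by
  have h : Finsupp.single i 1 ∈ (X i + r : Poly n l).support := by
    rw [mem_support_iff, coeff_add, coeff_X]
    have : coeff (Finsupp.single i 1) r = 0 := by
      by_contra h
      have := monomial_le_degreeOf i (mem_support_iff.2 h)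
      rw [hr] at this
      simp at this
    rw [this]; simp
  simpa using monomial_le_degreeOf i h

/-- The numerators have degree at most n, and division by a factor of positive degree gains the one
degree needed for the bound n - 1. -/
theorem degree_lt_of_mul {l : ℕ} {r q : Poly n l} {i : Fin l} (hr : 1 ≤ degreeOf i r)
    (h : degreeOf i (r * q) ≤ n) : q = 0 ∨ degreeOf i q < n := by
  by_cases hq : q = 0
  · exact Or.inl hq
  · have hr0 : r ≠ 0 := by rintro rfl; simp at hr
    rw [degreeOf_mul_eq hr0 hq] at h
    right; omega

theorem degreeOf_tv {l : ℕ} (i : Fin l) : degreeOf i (tv : Poly n l) = 0 := degreeOf_C _ _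

theorem degreeOf_neg' {l : ℕ} (i : Fin l) (p : Poly n l) : degreeOf i (-p) = degreeOf i p := by
  rw [degreeOf, degreeOf, degrees_neg]

theorem degreeOf_X_le {l : ℕ} (i j : Fin l) : degreeOf i (X j : Poly n l) ≤ 1 := by
  rw [degreeOf_X]; split_ifs <;> simp

theorem one_le_degreeOf_X_sub_tv {l : ℕ} (i : Fin l) : 1 ≤ degreeOf i (X i - tv : Poly n l) := by
  rw [sub_eq_add_neg]
  exact one_le_degreeOf i _ (by rw [degreeOf_neg', degreeOf_tv])

theorem one_le_degreeOf_X_add_tv {l : ℕ} (i : Fin l) : 1 ≤ degreeOf i (X i + tv : Poly n l) :=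
  one_le_degreeOf i _ (degreeOf_tv i)

theorem degreeOf_th_X {l : ℕ} (i j : Fin l) : degreeOf i (th zc (X j) : Poly n l) ≤ n :=
  (degreeOf_th i _).trans ((Nat.mul_le_mul_left _ (degreeOf_X_le i j)).trans (by simp))

theorem degreeOf_th_neg_X {l : ℕ} (i j : Fin l) : degreeOf i (th zc (-X j) : Poly n l) ≤ n :=
  (degreeOf_th i _).trans ((Nat.mul_le_mul_left _
    ((degreeOf_neg' i _).trans_le (degreeOf_X_le i j))).trans (by simp))

theorem degreeOf_th_tv {l : ℕ} (i : Fin l) : degreeOf i (th zc tv : Poly n l) = 0 :=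
  Nat.le_zero.1 ((degreeOf_th i _).trans (by simp [degreeOf_tv]))

theorem degreeOf_th_neg_tv {l : ℕ} (i : Fin l) : degreeOf i (th zc (-tv) : Poly n l) = 0 :=
  Nat.le_zero.1 ((degreeOf_th i _).trans (by rw [degreeOf_neg', degreeOf_tv]; simp))

theorem degreeOf_th_of_ne {l : ℕ} {i j : Fin l} (h : i ≠ j) :
    degreeOf i (th zc (X j) : Poly n l) = 0 :=
  Nat.le_zero.1 ((degreeOf_th i _).trans (by rw [degreeOf_X_of_ne h]; simp))

theorem degreeOf_th_neg_of_ne {l : ℕ} {i j : Fin l} (h : i ≠ j) :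
    degreeOf i (th zc (-X j) : Poly n l) = 0 :=
  Nat.le_zero.1 ((degreeOf_th i _).trans (by rw [degreeOf_neg', degreeOf_X_of_ne h]; simp))

/-- The factors with index c and d are 1 - z_c X and 1 + z_c X; for X = ±1/z_c one of them kills
Θ(X) and the other Θ(-X). -/
theorem th_eval_eq_zero {w : Fin n → ℂ} {c d : Fin n} (hw : w d = -w c) {x : ℂ}
    (hx : (x * w c) ^ 2 = 1) : th (eval w) x = 0 ∧ th (eval w) (-x) = 0 := by
  rcases mul_self_eq_one_iff.1 ((sq _).symm.trans hx) with h | h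
  · exact ⟨th_eq_zero_of_mul_eq_one _ _ c (by simpa using h),
      th_eq_zero_of_mul_eq_one _ _ d (by simpa [hw] using h)⟩
  · exact ⟨th_eq_zero_of_mul_eq_one _ _ d (by simpa [hw, neg_eq_iff_eq_neg] using h),
      th_eq_zero_of_mul_eq_one _ _ c (by simpa [neg_eq_iff_eq_neg] using h)⟩

variable (n) in
/-- The polynomial `Θ(t, -X) / (X - t)`. -/
theorem exists_kernel_one : ∃ g : Poly n 1, (X 0 - tv) * g =
    th zc tv * th zc (-X 0) - th zc (-tv) * th zc (X 0) :=
  exists_mul_eq 0 tv _ (by simp [mul_comm])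

/-- Each property is inherited from the numerator Θ(t,-X). For the vanishing, the numerator is zero
at a special X for every t, and the divisor X - t is non-zero for all but one value of t;
polynomiality in t covers the last one. -/
theorem kernel_one {g : Poly n 1} (hg : (X 0 - tv) * g =
    th zc tv * th zc (-X 0) - th zc (-tv) * th zc (X 0)) : Kernel g where
  deg := degLT_iff.2 fun i => by
    obtain rfl : i = 0 := Subsingleton.elim _ _
    refine degree_lt_of_mul (one_le_degreeOf_X_sub_tv 0) ?_
    rw [hg]
    refine (degreeOf_sub_le _ _ _).trans (max_le ?_ ?_)
    · exact (degreeOf_mul_le _ _ _).trans (by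
        rw [degreeOf_th_tv, zero_add]; exact degreeOf_th_neg_X _ _)
    · exact (degreeOf_mul_le _ _ _).trans (by
        rw [degreeOf_th_neg_tv, zero_add]; exact degreeOf_th_X _ _)
  sym := by
    refine sym_of_mul (X_sub_tv_ne_zero 0) ((sym_X 0).sub sym_tv) ?_
    rw [hg]
    exact ((sym_th sym_tv).mul (sym_th (sym_X 0).neg)).sub
      ((sym_th sym_tv.neg).mul (sym_th (sym_X 0)))
  van := fun τ x w c d hcd hw i hi => by
    obtain rfl : i = 0 := Subsingleton.elim _ _
    refine ev_eq_zero_of_cofinite x w {x 0} (fun τ hτ => ?_) τ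
    have h := congrArg (ev (eval w) τ x) hg
    obtain ⟨h1, h2⟩ := th_eval_eq_zero hw hi
    simp only [map_mul, map_sub, ev_X, ev_tv, ev_th, map_neg, h1, h2, mul_zero, sub_zero] at h
    refine (mul_eq_zero.1 h).resolve_left (sub_ne_zero.2 fun h => hτ ?_)
    simp [h]

variable (n) in
/-- The polynomial `Θ(X, Y) / (X + Y)`. -/
theorem exists_theta_quotient : ∃ h : Poly n 2, (X 0 + X 1) * h =
    th zc (X 0) * th zc (X 1) - th zc (-X 0) * th zc (-X 1) := by
  obtain ⟨q, hq⟩ := exists_mul_eq (n := n) (0 : Fin 2) (-X 1)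
    (th zc (X 0) * th zc (X 1) - th zc (-X 0) * th zc (-X 1)) (by simp [mul_comm])
  exact ⟨q, by rw [← hq, sub_neg_eq_add]⟩

/-- The numerator of `F^{(2)}`. -/
def numSq (g : Poly n 1) (h : Poly n 2) : Poly n 2 :=
  (X 0 - X 1) * h * th zc tv
    + th zc (-X 1) * (ev zc tv (fun _ => X 0) g * (X 0 + tv))
    - th zc (-X 0) * (ev zc tv (fun _ => X 1) g * (X 1 + tv))

/-- The apparent poles of F^{(2)} at X = -t and Y = -t cancel. At X = -t, the quotient Θ(X,Y)/(X+Y)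
becomes -Θ(t,-Y)/(Y-t), so that the first and third terms of the numerator cancel while the second
contains X + t; similarly at Y = -t. -/
theorem exists_kernel_two {g : Poly n 1} (hg : (X 0 - tv) * g =
      th zc tv * th zc (-X 0) - th zc (-tv) * th zc (X 0))
    {h : Poly n 2} (hh : (X 0 + X 1) * h =
      th zc (X 0) * th zc (X 1) - th zc (-X 0) * th zc (-X 1)) :
    ∃ J : Poly n 2, (X 0 + tv) * ((X 1 + tv) * J) = numSq g h := by
  have e1 : ev zc tv (Function.update X 0 (-tv)) h = -ev zc tv (fun _ => (X 1 : Poly n 2)) g := by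
    have h1 := congrArg (ev zc tv (Function.update X 0 (-tv) : Fin 2 → Poly n 2)) hh
    have h2 := congrArg (ev zc tv (fun _ => (X 1 : Poly n 2))) hg
    simp at h1 h2
    refine mul_left_cancel₀ (X_sub_tv_ne_zero (1 : Fin 2)) ?_
    linear_combination h1 + h2
  have e2 : ev zc tv (Function.update X 1 (-tv)) h = -ev zc tv (fun _ => (X 0 : Poly n 2)) g := by
    have h1 := congrArg (ev zc tv (Function.update X 1 (-tv) : Fin 2 → Poly n 2)) hh
    have h2 := congrArg (ev zc tv (fun _ => (X 0 : Poly n 2))) hg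
    simp at h1 h2
    refine mul_left_cancel₀ (X_sub_tv_ne_zero (0 : Fin 2)) ?_
    linear_combination h1 + h2
  obtain ⟨j, hj⟩ := exists_mul_eq (0 : Fin 2) (-tv) (numSq g h) (by
    simp only [numSq, map_add, map_sub, map_mul, ev_X, ev_th, ev_tv, map_neg, ev_ev, e1]
    simp
    ring)
  rw [sub_neg_eq_add] at hj
  -- For the second division, (X + t) j vanishes at Y = -t because the numerator does, and X + t can
  -- be cancelled.
  obtain ⟨J, hJ⟩ := exists_mul_eq (1 : Fin 2) (-tv) j (by
    refine (mul_eq_zero.1 (?_ : (X 0 + tv) * _ = 0)).resolve_left (X_add_tv_ne_zero (0 : Fin 2))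
    have h1 := congrArg (ev zc tv (Function.update X 1 (-tv) : Fin 2 → Poly n 2)) hj
    simp only [numSq, map_add, map_sub, map_mul, ev_X, ev_th, ev_tv, map_neg, ev_ev, e2] at h1
    simp at h1
    linear_combination h1)
  rw [sub_neg_eq_add] at hJ
  exact ⟨J, by rw [hJ, hj]⟩

end Kernels

end Cycles

end

noncomputable section
namespace Cycles
open MvPolynomial

/-! ### Degree, symmetry and vanishing of the two-variable kernel -/

section KernelTwo

variable {n : ℕ}

/-- Θ(X,Y) vanishes at a special value of one argument, but X + Y may vanish too. The other argument
is therefore moved: the quotient is zero for almost all of its values, hence for all. -/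
theorem theta_quotient_van {h : Poly n 2} (hh : (X 0 + X 1) * h =
      th zc (X 0) * th zc (X 1) - th zc (-X 0) * th zc (-X 1))
    (τ : ℂ) (x : Fin 2 → ℂ) (w : Fin n → ℂ) {c d : Fin n} (hw : w d = -w c) (i : Fin 2)
    (hi : (x i * w c) ^ 2 = 1) : ev (eval w) τ x h = 0 := by
  obtain ⟨h1, h2⟩ := th_eval_eq_zero hw hi
  have hc : ∀ y : Fin 2 → ℂ, (y 0 + y 1) * ev (eval w) τ y h =
      th (eval w) (y 0) * th (eval w) (y 1) - th (eval w) (-y 0) * th (eval w) (-y 1) :=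
    fun y => by simpa using congrArg (ev (eval w) τ y) hh
  -- The variable t is frozen at τ and reused as the free second argument.
  have key : ∀ τ', ev (eval w) τ' x
      (ev zc (zc (C τ)) (fun k => if k = i then X i else tv) h) = 0 := by
    refine ev_eq_zero_of_cofinite x w {-x i} fun τ' hτ' => ?_
    rw [ev_ev, ev_zc, eval_C]
    have h3 := hc (fun k => ev (eval w) τ' x (if k = i then X i else tv))
    have hne : x i + τ' ≠ 0 := fun h => hτ' (by simp [eq_neg_of_add_eq_zero_right h])
    rcases (by omega : i = 0 ∨ i = 1) with rfl | rfl
    · simp only [if_true, ev_X, Fin.isValue, one_ne_zero, if_false, ev_tv, h1, h2, zero_mul,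
        sub_zero] at h3
      exact (mul_eq_zero.1 h3).resolve_left hne
    · simp only [if_true, ev_X, Fin.isValue, zero_ne_one, if_false, ev_tv, h1, h2, mul_zero,
        sub_zero] at h3
      exact (mul_eq_zero.1 h3).resolve_left (by rwa [add_comm])
  have e := key (x (1 - i))
  rw [ev_ev, ev_zc, eval_C] at e
  have hx : (fun k => ev (eval w) (x (1 - i)) x (if k = i then X i else tv)) = x := by
    funext k
    rcases (by omega : i = 0 ∨ i = 1) with rfl | rfl <;>
      rcases (by omega : k = 0 ∨ k = 1) with rfl | rfl <;> simp
  rwa [hx] at e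

/-- The numerator has degree at most n in each variable: in (X - Y)Θ(X,Y)/(X + Y), and in (X +
t)Θ(t,-X)/(X - t) as a polynomial in X, a linear factor replaces the one divided out. Division by (X
+ t)(Y + t) then gives degree less than n. Vanishing is checked where t differs from -X and -Y. -/
theorem kernel_two {g : Poly n 1} (hg : (X 0 - tv) * g =
      th zc tv * th zc (-X 0) - th zc (-tv) * th zc (X 0))
    {h : Poly n 2} (hh : (X 0 + X 1) * h =
      th zc (X 0) * th zc (X 1) - th zc (-X 0) * th zc (-X 1))
    {J : Poly n 2} (hJ : (X 0 + tv) * ((X 1 + tv) * J) = numSq g h) : Kernel J where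
  deg := by
    have h01 : ∀ i : Fin 2, i = 0 ∨ i = 1 := fun i => by omega
    have ev_g : ∀ j : Fin 2, (X j - tv) * ev zc tv (fun _ => X j) g
        = (th zc tv * th zc (-X j) - th zc (-tv) * th zc (X j) : Poly n 2) := fun j => by
      simpa using congrArg (ev zc tv (fun _ => (X j : Poly n 2))) hg
    have deg_g : ∀ j : Fin 2, degreeOf j (ev zc tv (fun _ => X j) g * (X j + tv) : Poly n 2) ≤ n := by
      intro j
      rcases degree_lt_of_mul (n := n) (one_le_degreeOf_X_sub_tv j)
        (q := ev zc tv (fun _ => (X j : Poly n 2)) g) (by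
          rw [ev_g]
          refine (degreeOf_sub_le _ _ _).trans (max_le ?_ ?_)
          · exact (degreeOf_mul_le _ _ _).trans (by
              rw [degreeOf_th_tv, zero_add]; exact degreeOf_th_neg_X _ _)
          · exact (degreeOf_mul_le _ _ _).trans (by
              rw [degreeOf_th_neg_tv, zero_add]; exact degreeOf_th_X _ _)) with h0 | h0
      · rw [h0, zero_mul]; simp
      · refine (degreeOf_mul_le _ _ _).trans ?_
        have : degreeOf j (X j + tv : Poly n 2) ≤ 1 :=
          (degreeOf_add_le _ _ _).trans (max_le (degreeOf_X_le _ _) (by rw [degreeOf_tv]; simp))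
        omega
    have deg_g' : ∀ i j : Fin 2, i ≠ j →
        degreeOf i (ev zc tv (fun _ => X j) g * (X j + tv) : Poly n 2) = 0 := by
      intro i j hij
      refine Nat.le_zero.1 ((degreeOf_mul_le _ _ _).trans ?_)
      have h1 : degreeOf i (X j + tv : Poly n 2) = 0 := Nat.le_zero.1
        ((degreeOf_add_le _ _ _).trans (by rw [degreeOf_X_of_ne hij, degreeOf_tv]; simp))
      have h2 : degreeOf i (ev zc tv (fun _ => X j) g : Poly n 2) = 0 := by
        by_cases h0 : (ev zc tv (fun _ => X j) g : Poly n 2) = 0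
        · rw [h0, degreeOf_zero]
        · have h3 := degreeOf_mul_eq (n := i) (X_sub_tv_ne_zero (n := n) j) h0
          rw [ev_g] at h3
          have h4 : degreeOf i
              (th zc tv * th zc (-X j) - th zc (-tv) * th zc (X j) : Poly n 2) ≤ 0 := by
            refine (degreeOf_sub_le _ _ _).trans (max_le ?_ ?_)
            · exact (degreeOf_mul_le _ _ _).trans (by
                rw [degreeOf_th_tv, degreeOf_th_neg_of_ne hij])
            · exact (degreeOf_mul_le _ _ _).trans (by
                rw [degreeOf_th_neg_tv, degreeOf_th_of_ne hij])
          omega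
      omega
    have deg_h : ∀ i : Fin 2, degreeOf i ((X 0 - X 1) * h) ≤ n := by
      intro i
      by_cases h0 : h = 0
      · rw [h0, mul_zero]; simp
      · have h1 : 1 ≤ degreeOf i (X 0 + X 1 : Poly n 2) := by
          rcases h01 i with rfl | rfl
          · exact one_le_degreeOf _ _ (degreeOf_X_of_ne (by decide))
          · rw [add_comm]; exact one_le_degreeOf _ _ (degreeOf_X_of_ne (by decide))
        have h2 : (X 0 + X 1 : Poly n 2) ≠ 0 := by
          intro h2; rw [h2, degreeOf_zero] at h1; omega
        have h3 := degreeOf_mul_eq (n := i) h2 h0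
        have h4 : degreeOf i ((X 0 + X 1) * h) ≤ n := by
          rw [hh]
          refine (degreeOf_sub_le _ _ _).trans (max_le ?_ ?_) <;>
            refine (degreeOf_mul_le _ _ _).trans ?_ <;>
            rcases h01 i with rfl | rfl
          · rw [degreeOf_th_of_ne (j := 1) (by decide)]; exact degreeOf_th_X _ _
          · rw [degreeOf_th_of_ne (j := 0) (by decide), zero_add]; exact degreeOf_th_X _ _
          · rw [degreeOf_th_neg_of_ne (j := 1) (by decide)]; exact degreeOf_th_neg_X _ _
          · rw [degreeOf_th_neg_of_ne (j := 0) (by decide), zero_add]; exact degreeOf_th_neg_X _ _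
        refine (degreeOf_mul_le _ _ _).trans ?_
        have h5 : degreeOf i (X 0 - X 1 : Poly n 2) ≤ 1 :=
          (degreeOf_sub_le _ _ _).trans (max_le (degreeOf_X_le _ _) (degreeOf_X_le _ _))
        omega
    have deg_num : ∀ i : Fin 2, degreeOf i (numSq g h) ≤ n := by
      intro i
      refine (degreeOf_sub_le _ _ _).trans (max_le ((degreeOf_add_le _ _ _).trans (max_le ?_ ?_)) ?_)
      · refine (degreeOf_mul_le _ _ _).trans ?_
        rw [degreeOf_th_tv]
        exact deg_h i
      · refine (degreeOf_mul_le _ _ _).trans ?_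
        rcases h01 i with rfl | rfl
        · rw [degreeOf_th_neg_of_ne (by decide), zero_add]; exact deg_g 0
        · rw [deg_g' 1 0 (by decide), add_zero]; exact degreeOf_th_neg_X _ _
      · refine (degreeOf_mul_le _ _ _).trans ?_
        rcases h01 i with rfl | rfl
        · rw [deg_g' 0 1 (by decide), add_zero]; exact degreeOf_th_neg_X _ _
        · rw [degreeOf_th_neg_of_ne (by decide), zero_add]; exact deg_g 1
    refine degLT_iff.2 fun i => ?_
    rcases h01 i with rfl | rfl
    · refine degree_lt_of_mul (r := (X 0 + tv) * (X 1 + tv)) ?_ (by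
        rw [mul_assoc, hJ]; exact deg_num 0)
      rw [degreeOf_mul_eq (X_add_tv_ne_zero 0) (X_add_tv_ne_zero 1)]
      exact (one_le_degreeOf_X_add_tv 0).trans (Nat.le_add_right _ _)
    · refine degree_lt_of_mul (r := (X 0 + tv) * (X 1 + tv)) ?_ (by
        rw [mul_assoc, hJ]; exact deg_num 1)
      rw [degreeOf_mul_eq (X_add_tv_ne_zero 0) (X_add_tv_ne_zero 1)]
      exact (one_le_degreeOf_X_add_tv 1).trans (Nat.le_add_left _ _)
  sym := by
    have hX : (X 0 + X 1 : Poly n 2) ≠ 0 := fun h => by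
      have := congrArg (ev (eval 0) (0 : ℂ) (fun _ => 1)) h
      simp only [map_add, ev_X, map_zero] at this
      norm_num at this
    have sh : Sym h := by
      refine sym_of_mul hX ((sym_X 0).add (sym_X 1)) ?_
      rw [hh]
      exact ((sym_th (sym_X 0)).mul (sym_th (sym_X 1))).sub
        ((sym_th (sym_X 0).neg).mul (sym_th (sym_X 1).neg))
    have sg := (kernel_one hg).sym
    refine sym_of_mul (X_add_tv_ne_zero 1) ((sym_X 1).add sym_tv)
      (sym_of_mul (X_add_tv_ne_zero 0) ((sym_X 0).add sym_tv) ?_)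
    rw [hJ]
    exact (((((sym_X 0).sub (sym_X 1)).mul sh).mul (sym_th sym_tv)).add
      ((sym_th (sym_X 1).neg).mul ((sg.ev sym_tv fun _ => sym_X 0).mul ((sym_X 0).add sym_tv)))).sub
      ((sym_th (sym_X 0).neg).mul ((sg.ev sym_tv fun _ => sym_X 1).mul ((sym_X 1).add sym_tv)))
  van := fun τ x w c d hcd hw i hi => by
    obtain ⟨h1, h2⟩ := th_eval_eq_zero hw hi
    refine ev_eq_zero_of_cofinite x w {-x 0, -x 1} (fun τ hτ => ?_) τ
    simp only [Finset.mem_insert, Finset.mem_singleton, not_or] at hτ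
    have e1 := congrArg (ev (eval w) τ x) hJ
    have eg : ev (eval w) τ (fun _ => x i) g = 0 :=
      (kernel_one hg).van τ (fun _ => x i) w c d hcd hw 0 hi
    have hnum : ev (eval w) τ x (numSq g h) = 0 := by
      have eh := theta_quotient_van hh τ x w hw i hi
      simp only [numSq, map_sub, map_add, map_mul, ev_X, ev_tv, ev_th, map_neg, ev_ev, eh]
      rcases (by omega : i = 0 ∨ i = 1) with rfl | rfl <;> rw [eg, h2] <;> ring
    rw [hnum] at e1
    simp only [map_mul, map_add, ev_X, ev_tv] at e1
    refine ((mul_eq_zero.1 ((mul_eq_zero.1 e1).resolve_left ?_))).resolve_left ?_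
    · exact fun h => hτ.1 (eq_neg_of_add_eq_zero_right h)
    · exact fun h => hτ.2 (eq_neg_of_add_eq_zero_right h)

end KernelTwo

/-! ## The lowering operators -/

section Lowering

variable {n l : ℕ} {κ : Prop} {V : ∀ l, Set ((Fin l → ℂ) × (Fin n → ℂ))}
  {S : Subalgebra ℂ (K n)}

theorem aeval_eq_ev_map_C {E : Type} [Field E] [Algebra (K n) E] (t : E) (y : Fin l → E)
    {p : MvPolynomial (Fin l) (MvPolynomial (Fin n) ℂ)} {P : MvPolynomial (Fin l) (K n)}
    (hp : map (toK n) p = P) :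
    aeval y P = ev ((algebraMap (K n) E).comp (toK n)) t y (map Polynomial.C p) := by
  rw [ev_map_C, ← hp, aeval_def, eval₂_map]

theorem const_mem (S : Subalgebra ℂ (K n)) (c : ℂ) :
    algebraMap (K n) (Ser n l) (algebraMap ℂ (K n) c) ∈ coeffIn S l :=
  algebraMap_mem_coeffIn (S.algebraMap_mem c)

theorem two_inv_mem (S : Subalgebra ℂ (K n)) : (2 : Ser n l)⁻¹ ∈ coeffIn S l := by
  have := const_mem (l := l) S (2⁻¹ : ℂ)
  rwa [map_inv₀, map_inv₀, map_ofNat, map_ofNat] at this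

theorem F_eq {E : Type} [Field E] [Algebra (K n) E] {g : Poly n 1} (hg : (X 0 - tv) * g =
      th zc tv * th zc (-X 0) - th zc (-tv) * th zc (X 0)) (t : E) (y : Fin 1 → E)
    (h : y 0 - t ≠ 0) :
    F n t (y 0) = (t * 2⁻¹ * (th ((algebraMap (K n) E).comp (toK n)) t)⁻¹) *
      ev ((algebraMap (K n) E).comp (toK n)) t y g := by
  have h1 := congrArg (ev ((algebraMap (K n) E).comp (toK n)) t y) hg
  simp only [map_mul, map_sub, ev_X, ev_tv, ev_th, map_neg] at h1
  rw [F, Theta2, Theta_eq_th, Theta_eq_th, Theta_eq_th, Theta_eq_th, neg_neg, ← h1]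
  field_simp

/-- Once every Θ(·,·) is written as its linear divisor times the quotient polynomial, the poles at X
+ Y = 0, X = t and Y = t disappear, and the common denominator left is (X + t)(Y + t)Θ(t). -/
theorem F2_eq {E : Type} [Field E] [Algebra (K n) E] {g : Poly n 1} (hg : (X 0 - tv) * g =
      th zc tv * th zc (-X 0) - th zc (-tv) * th zc (X 0))
    {h : Poly n 2} (hh : (X 0 + X 1) * h =
      th zc (X 0) * th zc (X 1) - th zc (-X 0) * th zc (-X 1))
    {J : Poly n 2} (hJ : (X 0 + tv) * ((X 1 + tv) * J) = numSq g h) (t : E) (y : Fin 2 → E)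
    (h0 : y 0 - t ≠ 0) (h1 : y 1 - t ≠ 0) (h0' : y 0 + t ≠ 0) (h1' : y 1 + t ≠ 0)
    (h01 : y 0 + y 1 ≠ 0) (hθ : th ((algebraMap (K n) E).comp (toK n)) t ≠ 0) :
    F2 n t (y 0) (y 1) = (t ^ 2 * (th ((algebraMap (K n) E).comp (toK n)) t)⁻¹) *
      ev ((algebraMap (K n) E).comp (toK n)) t y J := by
  have e1 := fun i => congrArg (ev ((algebraMap (K n) E).comp (toK n)) t (fun _ => y i)) hg
  have e2 := congrArg (ev ((algebraMap (K n) E).comp (toK n)) t y) hh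
  have e3 := congrArg (ev ((algebraMap (K n) E).comp (toK n)) t y) hJ
  simp only [numSq, map_mul, map_sub, map_add, ev_X, ev_tv, ev_th, map_neg, ev_ev] at e1 e2 e3
  simp only [F2, Theta2, Theta_eq_th, neg_neg]
  rw [← e1 0, ← e1 1, ← e2]
  generalize ev ((algebraMap (K n) E).comp (toK n)) t y J = J' at *
  generalize ev ((algebraMap (K n) E).comp (toK n)) t y h = h' at *
  generalize ev ((algebraMap (K n) E).comp (toK n)) t (fun _ => y 0) g = g0 at *
  generalize ev ((algebraMap (K n) E).comp (toK n)) t (fun _ => y 1) g = g1 at *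
  generalize th ((algebraMap (K n) E).comp (toK n)) t = θ at *
  generalize th ((algebraMap (K n) E).comp (toK n)) (-y 0) = θ0 at *
  generalize th ((algebraMap (K n) E).comp (toK n)) (-y 1) = θ1 at *
  field_simp
  linear_combination -t ^ 2 * e3

theorem formXm_eq {E : Type} [Field E] [Algebra (K n) E] {g : Poly n 1} (hg : (X 0 - tv) * g =
      th zc tv * th zc (-X 0) - th zc (-tv) * th zc (X 0)) {P : MvPolynomial (Fin l) (K n)}
    {p : MvPolynomial (Fin l) (MvPolynomial (Fin n) ℂ)} (hp : map (toK n) p = P) (t : E)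
    (x : Fin (1 + l) → E) (hx : ∀ i, x i - t ≠ 0) :
    formXm P t x = (t * 2⁻¹ * (th ((algebraMap (K n) E).comp (toK n)) t)⁻¹) *
      ev ((algebraMap (K n) E).comp (toK n)) t x (wedgePoly g (map Polynomial.C p)) :=
  wedge_eq t x _ (fun y : Fin 1 → E => F n t (y 0)) g
    (fun σ => F_eq hg t (fun k => x (σ (Fin.castAdd l k))) (hx _)) (fun y => aeval y P) _
    (fun y => aeval_eq_ev_map_C t y hp)

theorem formXmSq_eq {E : Type} [Field E] [Algebra (K n) E] {g : Poly n 1} (hg : (X 0 - tv) * g =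
      th zc tv * th zc (-X 0) - th zc (-tv) * th zc (X 0))
    {h : Poly n 2} (hh : (X 0 + X 1) * h =
      th zc (X 0) * th zc (X 1) - th zc (-X 0) * th zc (-X 1))
    {J : Poly n 2} (hJ : (X 0 + tv) * ((X 1 + tv) * J) = numSq g h)
    {P : MvPolynomial (Fin l) (K n)}
    {p : MvPolynomial (Fin l) (MvPolynomial (Fin n) ℂ)} (hp : map (toK n) p = P) (t : E)
    (x : Fin (2 + l) → E) (hx : ∀ i, x i - t ≠ 0) (hx' : ∀ i, x i + t ≠ 0)
    (hxx : ∀ i j, x i + x j ≠ 0) (hθ : th ((algebraMap (K n) E).comp (toK n)) t ≠ 0) :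
    formXmSq P t x = (t ^ 2 * (th ((algebraMap (K n) E).comp (toK n)) t)⁻¹) *
      ev ((algebraMap (K n) E).comp (toK n)) t x (wedgePoly J (map Polynomial.C p)) :=
  wedge_eq t x _ (fun y : Fin 2 → E => F2 n t (y 0) (y 1)) J
    (fun σ => F2_eq hg hh hJ t (fun k => x (σ (Fin.castAdd l k))) (hx _) (hx _) (hx' _) (hx' _)
      (hxx _ _) hθ) (fun y => aeval y P) _ (fun y => aeval_eq_ev_map_C t y hp)

theorem formXm_hasCoeffs (hV : IsLocus κ V) {M : Submodule ℂ (A n (1 + l))}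
    (hM : IsStable S M) (hle : Cyc (R n) V (1 + l) ≤ M) {t : Ser n (1 + l)} (ht : Adm S t)
    {P : A n l} (hP : P ∈ Cyc (R n) V l) :
    formXm P.1 t (xVar n (1 + l)) ∈ HasCoeffs M := by
  obtain ⟨p, hp, hgood⟩ := exists_good hV hP
  obtain ⟨g, hg⟩ := exists_kernel_one n
  rw [formXm_eq hg hp t _ ht.x_ne]
  exact HasCoeffs.mul hM
    (Subring.mul_mem _ (Subring.mul_mem _ ht.mem (two_inv_mem S)) ht.inv_mem)
    ((good_wedgePoly (kernel_one hg) hgood).hasCoeffs hV hM hle ht.mem)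

theorem formXmSq_hasCoeffs (hV : IsLocus κ V) {M : Submodule ℂ (A n (2 + l))}
    (hM : IsStable S M) (hle : Cyc (R n) V (2 + l) ≤ M) {t : Ser n (2 + l)} (ht : Adm S t)
    {P : A n l} (hP : P ∈ Cyc (R n) V l) :
    formXmSq P.1 t (xVar n (2 + l)) ∈ HasCoeffs M := by
  obtain ⟨p, hp, hgood⟩ := exists_good hV hP
  obtain ⟨g, hg⟩ := exists_kernel_one n
  obtain ⟨h, hh⟩ := exists_theta_quotient n
  obtain ⟨J, hJ⟩ := exists_kernel_two hg hh
  rw [formXmSq_eq hg hh hJ hp t _ ht.x_ne ht.x_ne_neg xVar_add_ne_zero ht.th_ne]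
  exact HasCoeffs.mul hM
    (Subring.mul_mem _ (Subring.pow_mem _ ht.mem 2) ht.inv_mem)
    ((good_wedgePoly (kernel_two hg hh hJ) hgood).hasCoeffs hV hM hle ht.mem)

end Lowering

end Cycles

end

noncomputable section
namespace Cycles
open MvPolynomial

/-! ### Substituting polynomials in t for some of the variables -/

section Substitution

variable {n l : ℕ} {κ : Prop}

theorem degreeOf_ev_le {k : ℕ} (y : Fin k → Poly n l) (q : Poly n k) (i : Fin l) (D : ℕ)
    (h : ∀ m ∈ q.support, ∑ j, m j * degreeOf i (y j) ≤ D) : degreeOf i (ev zc tv y q) ≤ D := by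
  rw [← aeval_eq_ev, aeval_def, eval₂_eq']
  refine (degreeOf_sum_le i _ _).trans (Finset.sup_le fun m hm => ?_)
  refine (degreeOf_mul_le _ _ _).trans ?_
  rw [show algebraMap (Polynomial (MvPolynomial (Fin n) ℂ)) (Poly n l) = C from rfl, degreeOf_C,
    zero_add]
  refine (degreeOf_prod_le _ _ _).trans (le_trans (Finset.sum_le_sum fun j _ => ?_) (h m hm))
  exact degreeOf_pow_le _ _ _

/-- Each X_i occurs in at most one of the substituted polynomials, and there at most linearly, so
its degree is bounded by a single exponent. -/
theorem DegLT.ev {k : ℕ} {q : Poly n k} (hq : DegLT q) (y : Fin k → Poly n l)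
    (h : ∀ i, ∃ j, degreeOf i (y j) ≤ 1 ∧ ∀ j', j' ≠ j → degreeOf i (y j') = 0) :
    DegLT (ev zc tv y q) := by
  refine degLT_iff.2 fun i => ?_
  by_cases hq0 : q = 0
  · exact Or.inl (by rw [hq0, map_zero])
  · obtain ⟨j, hj, hj'⟩ := h i
    obtain ⟨m, hm⟩ := Finset.nonempty_of_ne_empty (mt support_eq_empty.1 hq0)
    have hn := hq m hm j
    have := degreeOf_ev_le y q i (n - 1) fun m hm => by
      rw [Finset.sum_eq_single j (fun j' _ h => by rw [hj' j' h, mul_zero]) (by simp)]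
      have h1 := Nat.mul_le_mul_left (m j) hj
      have h2 := hq m hm j
      omega
    right; omega

/-- The substitution of polynomials in `t` for some of the variables `X_i`. -/
theorem Good.subst {k : ℕ} {q : Poly n k} (hq : Good κ q) (e : Fin l → Fin k)
    (he : Function.Injective e) (y : Fin k → Poly n l) (hy : ∀ i, y (e i) = X i)
    (hy' : ∀ j, (∃ i, e i = j) ∨ ∃ c, y j = C c ∧ Sym (y j)) : Good κ (ev zc tv y q) where
  skew := skew_of_swap fun i j hij => by
    rw [rename_eq_ev, ev_ev, ev_tv]
    have h1 : (fun k => Cycles.ev zc tv (fun i' => X (Equiv.swap i j i')) (y k))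
        = fun k => y (Equiv.swap (e i) (e j) k) := by
      funext k
      rcases hy' k with ⟨i', rfl⟩ | ⟨c, hc, -⟩
      · rw [hy, ev_X, ← hy, he.map_swap]
      -- An index at which a constant is substituted is not in the image of e, since X_{i'} has
      -- degree 1 in itself; the transposition therefore fixes it. The second alternative is void.
      · have hk : ∀ i', k ≠ e i' ∨ degreeOf i' (y k) = 1 ∧ False := fun i' => by
          left
          rintro rfl
          rw [hy] at hc
          have := congrArg (degreeOf i') hc
          rw [degreeOf_X, if_pos rfl, degreeOf_C] at this
          omega
        rw [Equiv.swap_apply_of_ne_of_ne ((hk i).resolve_right (by simp))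
          ((hk j).resolve_right (by simp)), hc, ← rename_eq_ev, rename_C]
    rw [h1, hq.ev_perm, Equiv.Perm.sign_swap (he.ne hij)]
    simp
  deg := hq.deg.ev y fun i => ⟨e i, by rw [hy]; exact degreeOf_X_le _ _, fun j hj => by
    rcases hy' j with ⟨i', rfl⟩ | ⟨c, hc, -⟩
    · rw [hy, degreeOf_X_of_ne]
      rintro rfl; exact hj rfl
    · rw [hc, degreeOf_C]⟩
  sym := hq.sym.ev sym_tv fun j => by
    rcases hy' j with ⟨i', rfl⟩ | ⟨c, -, h⟩
    · rw [hy]; exact sym_X _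
    · exact h
  van τ x w hw hx := by
    rw [ev_ev, ev_tv]
    refine hq.van τ _ w hw ?_
    obtain ⟨c, d, hcd, hw', ⟨a, ha⟩, hb⟩ := hx
    refine ⟨c, d, hcd, hw', ⟨e a, by simpa only [hy, ev_X] using ha⟩, fun hκ => ?_⟩
    obtain ⟨b, hb⟩ := hb hκ
    exact ⟨e b, by simpa only [hy, ev_X] using hb⟩

theorem Good.C_mul {q : Poly n l} (hq : Good κ q) {c : Polynomial (MvPolynomial (Fin n) ℂ)}
    (hc : Sym (C c : Poly n l)) : Good κ (C c * q) where
  skew σ := by rw [map_mul, hq.skew, rename_C, mul_left_comm]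
  deg := hq.deg.C_mul c
  sym := hc.mul hq.sym
  van τ x w hw hx := by rw [map_mul, hq.van τ x w hw hx, mul_zero]

end Substitution

/-! ## The Cartan operators -/

section Cartan

variable {n l : ℕ} {κ : Prop} {V : ∀ l, Set ((Fin l → ℂ) × (Fin n → ℂ))}
  {S : Subalgebra ℂ (K n)}

/-- At X_p = t both terms of the numerator become Θ(t) P|_{X_p = t}. -/
theorem exists_bracket (q : Poly n l) (p : Fin l) : ∃ b : Poly n l, (X p - tv) * b =
    th zc (X p) * ev zc tv (Function.update X p tv) q - th zc tv * q :=
  exists_mul_eq p tv _ (by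
    rw [map_sub, map_mul, map_mul, ev_th, ev_th, ev_X, ev_tv, ev_ev, ev_tv, Function.update_self]
    have : (fun i => ev zc tv (Function.update X p tv : Fin l → Poly n l)
        ((Function.update X p tv : Fin l → Poly n l) i)) = Function.update X p tv := by
      funext i
      by_cases hi : i = p
      · subst hi; simp
      · simp [hi]
    rw [this, sub_self])

/-- Only the sum over p is skew-symmetric: a permutation σ carries b_p to ± b_{σ(p)}. In X_p, the
factor Θ(X_p) contributes degree n and P|_{X_p = t} none, and dividing by X_p - t lowers the bound.
On the locus P vanishes; if X_p is a special variable then Θ(X_p) = 0, and otherwise P|_{X_p = t} is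
still evaluated on the locus. -/
theorem good_bracket_sum {q : Poly n l} (hq : Good κ q) {b : Fin l → Poly n l}
    (hb : ∀ p, (X p - tv) * b p =
      th zc (X p) * ev zc tv (Function.update X p tv) q - th zc tv * q) :
    Good κ (∑ p, b p) where
  skew σ := by
    rw [map_sum, Finset.mul_sum, ← Equiv.sum_comp σ (fun p => _ * b p)]
    refine Finset.sum_congr rfl fun p _ => ?_
    refine mul_left_cancel₀ (X_sub_tv_ne_zero (σ p)) ?_
    -- Applying the permutation to the defining equation of b_p and comparing with that of b_{σ(p)};
    -- the divisor X_{σ(p)} - t is then cancelled.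
    have h1 := congrArg (ev zc tv (fun i => (X (σ i) : Poly n l))) (hb p)
    rw [map_mul, map_sub, map_sub, map_mul, map_mul, ev_X, ev_tv, ev_th, ev_th, ev_X, ev_tv,
      hq.ev_perm, ev_self, ev_ev, ev_tv] at h1
    have h2 : (fun i => ev zc tv (fun i => (X (σ i) : Poly n l))
        ((Function.update X p tv : Fin l → Poly n l) i))
        = fun i => (Function.update X (σ p) tv : Fin l → Poly n l) (σ i) := by
      funext i
      by_cases hi : i = p
      · subst hi; simp
      · simp [hi]
    rw [h2, hq.ev_perm] at h1
    rw [rename_eq_ev, h1, mul_left_comm (X (σ p) - tv), hb]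
    ring
  deg := DegLT.sum fun p _ => degLT_iff.2 fun i => by
    by_cases hq0 : q = 0
    · left
      refine (mul_eq_zero.1 ((hb p).trans ?_)).resolve_left (X_sub_tv_ne_zero p)
      rw [hq0]; simp
    have hqi := (degLT_iff.1 hq.deg i).resolve_left hq0
    by_cases hi : i = p
    · subst hi
      refine degree_lt_of_mul (one_le_degreeOf_X_sub_tv i) ?_
      rw [hb]
      refine (degreeOf_sub_le _ _ _).trans (max_le ?_ ?_)
      · refine (degreeOf_mul_le _ _ _).trans ?_
        have h1 := degreeOf_ev_le (Function.update X i tv) q i 0 fun m _ => by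
          refine (Finset.sum_eq_zero fun j _ => ?_).le
          by_cases hj : j = i
          · subst hj; simp [degreeOf_tv]
          · rw [Function.update_of_ne hj, degreeOf_X_of_ne (Ne.symm hj), mul_zero]
        have h2 := degreeOf_th_X (n := n) i i
        omega
      · refine (degreeOf_mul_le _ _ _).trans ?_
        rw [degreeOf_th_tv]; omega
    · by_cases h0 : b p = 0
      · exact Or.inl h0
      · right
        have h1 := degreeOf_mul_eq (n := i) (X_sub_tv_ne_zero p) h0
        have h2 : degreeOf i ((X p - tv) * b p) < n := by
          rw [hb]
          refine (degreeOf_sub_le _ _ _).trans_lt (max_lt ?_ ?_)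
          · refine (degreeOf_mul_le _ _ _).trans_lt ?_
            rw [degreeOf_th_of_ne hi, zero_add]
            have h3 := hq.deg.ev (Function.update X p tv : Fin l → Poly n l) fun i => ⟨i, by
              by_cases hi : i = p
              · subst hi; simp [degreeOf_tv]
              · rw [Function.update_of_ne hi]; exact degreeOf_X_le _ _, fun j hj => by
              by_cases hj' : j = p
              · subst hj'; simp [degreeOf_tv]
              · rw [Function.update_of_ne hj', degreeOf_X_of_ne (Ne.symm hj)]⟩
            rcases degLT_iff.1 h3 i with h4 | h4
            · rw [h4, degreeOf_zero]; omega
            · exact h4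
          · refine (degreeOf_mul_le _ _ _).trans_lt ?_
            rw [degreeOf_th_tv]; omega
        omega
  sym := Sym.sum _ fun p _ => by
    refine sym_of_mul (X_sub_tv_ne_zero p) ((sym_X p).sub sym_tv) ?_
    rw [hb]
    refine ((sym_th (sym_X p)).mul (hq.sym.ev sym_tv fun i => ?_)).sub
      ((sym_th sym_tv).mul hq.sym)
    by_cases hi : i = p
    · subst hi; rw [Function.update_self]; exact sym_tv
    · rw [Function.update_of_ne hi]; exact sym_X i
  van τ x w hw hx := by
    rw [map_sum]
    refine Finset.sum_eq_zero fun p _ => ev_eq_zero_of_cofinite x w {x p} (fun τ hτ => ?_) τ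
    have h1 := congrArg (ev (eval w) τ x) (hb p)
    have h2 : (fun i => ev (eval w) τ x ((Function.update X p tv : Fin l → Poly n l) i))
        = Function.update x p τ := by
      funext i
      by_cases hi : i = p
      · subst hi; simp
      · simp [hi]
    simp only [map_mul, map_sub, ev_X, ev_tv, ev_th, ev_ev, hq.van τ x w hw hx, mul_zero,
      sub_zero, h2] at h1
    refine (mul_eq_zero.1 (h1.trans ?_)).resolve_left
      (sub_ne_zero.2 fun h => hτ (by simp [h]))
    obtain ⟨c, d, hcd, hw', ⟨a, ha⟩, hb'⟩ := hx
    by_cases hpa : p = a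
    · subst hpa
      rw [(th_eval_eq_zero hw' (by rw [ha, one_pow])).1, zero_mul]
    · by_cases hκ : κ
      · obtain ⟨b', hb'⟩ := hb' hκ
        by_cases hpb : p = b'
        · subst hpb
          rw [(th_eval_eq_zero hw' (by rw [hb']; norm_num)).1, zero_mul]
        · rw [hq.van τ _ w hw ⟨c, d, hcd, hw', ⟨a, by rwa [Function.update_of_ne (Ne.symm hpa)]⟩,
            fun _ => ⟨b', by rwa [Function.update_of_ne (Ne.symm hpb)]⟩⟩, mul_zero]
      · rw [hq.van τ _ w hw ⟨c, d, hcd, hw', ⟨a, by rwa [Function.update_of_ne (Ne.symm hpa)]⟩,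
            fun h => absurd h hκ⟩, mul_zero]

/-- The polynomial `∑_j z_j t ∏_{i ≠ j} (1 - z_i t)`. -/
def powerSumNum (n : ℕ) : Polynomial (MvPolynomial (Fin n) ℂ) :=
  ∑ j, Polynomial.C (X j) * Polynomial.X *
    ∏ i ∈ Finset.univ.erase j, (1 - Polynomial.C (X i) * Polynomial.X)

theorem eval₂_powerSumNum {B : Type*} [CommRing B] (φ : MvPolynomial (Fin n) ℂ →+* B) (t : B) :
    (powerSumNum n).eval₂ φ t =
      ∑ j, φ (X j) * t * ∏ i ∈ Finset.univ.erase j, (1 - φ (X i) * t) := by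
  rw [← Polynomial.coe_eval₂RingHom]
  simp only [powerSumNum, map_sum, map_mul, map_prod, map_sub, map_one, Polynomial.coe_eval₂RingHom,
    Polynomial.eval₂_C, Polynomial.eval₂_X]

theorem eval₂_powerSumNum_comp_rename {B : Type*} [CommRing B] (φ : MvPolynomial (Fin n) ℂ →+* B)
    (t : B) (σ : Equiv.Perm (Fin n)) :
    (powerSumNum n).eval₂ (φ.comp (rename σ : MvPolynomial (Fin n) ℂ →ₐ[ℂ] _).toRingHom) t
      = (powerSumNum n).eval₂ φ t := by
  rw [eval₂_powerSumNum, eval₂_powerSumNum, ← Equiv.sum_comp σ (fun j => φ (X j) * t * _)]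
  refine Finset.sum_congr rfl fun j _ => ?_
  congr 1
  · simp
  · rw [← Finset.map_univ_equiv σ, ← Equiv.coe_toEmbedding, ← Finset.map_erase, Finset.prod_map]
    simp

theorem sym_powerSumNum : Sym (C (powerSumNum n) : Poly n l) := fun σ => by
  rw [ev_C, eval₂_powerSumNum_comp_rename, ← ev_C (x := X), ev_self]

theorem ev_powerSumNum {E : Type} [Field E] (φ : MvPolynomial (Fin n) ℂ →+* E) (t : E)
    (hθ : th φ t ≠ 0) :
    ∑ j, φ (X j) * t / (1 - φ (X j) * t) = (th φ t)⁻¹ * (powerSumNum n).eval₂ φ t := by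
  rw [eq_inv_mul_iff_mul_eq₀ hθ, eval₂_powerSumNum, Finset.mul_sum]
  refine Finset.sum_congr rfl fun j _ => ?_
  have h1 := Finset.mul_prod_erase Finset.univ (fun j => 1 - φ (X j) * t) (Finset.mem_univ j)
  have h2 : 1 - φ (X j) * t ≠ 0 := Finset.prod_ne_zero_iff.1 hθ j (Finset.mem_univ j)
  rw [th, ← h1]
  field_simp

theorem formAPos_eq {E : Type} [Field E] [Algebra (K n) E]
    {P : MvPolynomial (Fin l) (K n)} {p : MvPolynomial (Fin l) (MvPolynomial (Fin n) ℂ)}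
    (hp : map (toK n) p = P) {b : Fin l → Poly n l}
    (hb : ∀ i, (X i - tv) * b i = th zc (X i) * ev zc tv (Function.update X i tv)
      (map Polynomial.C p) - th zc tv * map Polynomial.C p) (t : E) (x : Fin l → E)
    (hx : ∀ i, x i - t ≠ 0) (hx' : ∀ i, x i + t ≠ 0)
    (hθ : th ((algebraMap (K n) E).comp (toK n)) t ≠ 0)
    (hθ' : th ((algebraMap (K n) E).comp (toK n)) (-t) ≠ 0) :
    formAPos P t x =
      (th ((algebraMap (K n) E).comp (toK n)) t)⁻¹ *
        ev ((algebraMap (K n) E).comp (toK n)) t x (C (powerSumNum n) * map Polynomial.C p)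
      + t * (th ((algebraMap (K n) E).comp (toK n)) t)⁻¹ *
        ev ((algebraMap (K n) E).comp (toK n)) t x (∑ i, b i)
      + (-t) * (th ((algebraMap (K n) E).comp (toK n)) (-t))⁻¹ *
        ev ((algebraMap (K n) E).comp (toK n)) (-t) x (∑ i, b i) := by
  have hbr : ∀ (t : E), (∀ i, x i - t ≠ 0) → th ((algebraMap (K n) E).comp (toK n)) t ≠ 0 →
      ∀ i, formAPos.br P x t i = t * (th ((algebraMap (K n) E).comp (toK n)) t)⁻¹ *
        ev ((algebraMap (K n) E).comp (toK n)) t x (b i) := by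
    intro t hx hθ i
    have h1 := congrArg (ev ((algebraMap (K n) E).comp (toK n)) t x) (hb i)
    have h2 : (fun j => ev ((algebraMap (K n) E).comp (toK n)) t x
        ((Function.update X i tv : Fin l → Poly n l) j)) = Function.update x i t := by
      funext j
      by_cases hj : j = i
      · subst hj; simp
      · simp [hj]
    simp only [map_mul, map_sub, ev_X, ev_tv, ev_th, ev_ev, h2] at h1
    rw [formAPos.br, aeval_eq_ev_map_C t _ hp, aeval_eq_ev_map_C t _ hp, Theta_eq_th, Theta_eq_th]
    have := hx i
    field_simp
    linear_combination -t * h1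
  rw [formAPos, Finset.sum_add_distrib, Finset.sum_congr rfl fun i _ => hbr t hx hθ i,
    Finset.sum_congr rfl fun i _ => hbr (-t) (fun i => by rw [sub_neg_eq_add]; exact hx' i) hθ' i,
    map_sum, map_sum, ← Finset.mul_sum, ← Finset.mul_sum, map_mul, ev_C,
    aeval_eq_ev_map_C t _ hp, ← mul_assoc, ← ev_powerSumNum _ _ hθ, add_assoc]
  rfl

/-- As rational functions the two Cartan formulas differ only by sign and a constant: each bracket
changes by -P, there are 2l of them, and 1/(1 - z_j t) = 1 + z_j t/(1 - z_j t). Thus a_- needs no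
separate analysis. -/
theorem formANeg_eq {E : Type} [Field E] [Algebra (K n) E]
    (P : MvPolynomial (Fin l) (K n)) (t : E) (x : Fin l → E) (ht : t ≠ 0)
    (hx : ∀ i, x i - t ≠ 0) (hx' : ∀ i, x i + t ≠ 0)
    (hθ : th ((algebraMap (K n) E).comp (toK n)) t ≠ 0) :
    formANeg P t x = -formAPos P t x + (2 * l - n) * aeval x P := by
  have h1 : ∀ t : E, t ≠ 0 → (∀ i, x i - t ≠ 0) → ∀ i, formANeg.br P x t i
      = formAPos.br P x t i - aeval x P := by
    intro t ht hx i
    have := hx i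
    rw [formANeg.br, formAPos.br]
    generalize Theta n (x i) / Theta n t * aeval (Function.update x i t) P = c
    field_simp
    ring
  have h2 : ∑ j : Fin n, 1 / (1 - algebraMap (K n) E (z j) * t)
      = n + ∑ j : Fin n, algebraMap (K n) E (z j) * t / (1 - algebraMap (K n) E (z j) * t) := by
    rw [← sub_eq_iff_eq_add, ← Finset.sum_sub_distrib]
    rw [Finset.sum_congr rfl (g := fun _ => (1 : E))]
    · simp
    · intro j _
      have : 1 - algebraMap (K n) E (z j) * t ≠ 0 :=
        Finset.prod_ne_zero_iff.1 hθ j (Finset.mem_univ j)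
      field_simp
  rw [formANeg, formAPos, h2, Finset.sum_congr rfl fun i _ => congrArg₂ (· + ·) (h1 t ht hx i)
    (h1 (-t) (neg_ne_zero.2 ht) (fun i => by rw [sub_neg_eq_add]; exact hx' i) i)]
  simp only [Finset.sum_add_distrib, Finset.sum_sub_distrib, Finset.sum_const, Finset.card_univ,
    Fintype.card_fin, nsmul_eq_mul]
  ring

theorem formAPos_hasCoeffs (hV : IsLocus κ V) {M : Submodule ℂ (A n l)}
    (hM : IsStable S M) (hle : Cyc (R n) V l ≤ M) {t : Ser n l} (ht : Adm S t)
    {P : A n l} (hP : P ∈ Cyc (R n) V l) : formAPos P.1 t (xVar n l) ∈ HasCoeffs M := by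
  obtain ⟨p, hp, hgood⟩ := exists_good hV hP
  choose b hb using exists_bracket (map Polynomial.C p : Poly n l)
  rw [formAPos_eq hp hb t _ ht.x_ne ht.x_ne_neg ht.th_ne ht.th_neg_ne]
  refine AddSubgroup.add_mem _ (AddSubgroup.add_mem _ ?_ ?_) ?_
  · exact HasCoeffs.mul hM ht.inv_mem ((hgood.C_mul sym_powerSumNum).hasCoeffs hV hM hle ht.mem)
  · exact HasCoeffs.mul hM (Subring.mul_mem _ ht.mem ht.inv_mem)
      ((good_bracket_sum hgood hb).hasCoeffs hV hM hle ht.mem)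
  · exact HasCoeffs.mul hM (Subring.mul_mem _ ht.neg.mem ht.neg.inv_mem)
      ((good_bracket_sum hgood hb).hasCoeffs hV hM hle ht.neg.mem)

theorem formANeg_hasCoeffs (hV : IsLocus κ V) {M : Submodule ℂ (A n l)}
    (hM : IsStable S M) (hle : Cyc (R n) V l ≤ M) {t : Ser n l} (ht : Adm S t)
    {P : A n l} (hP : P ∈ Cyc (R n) V l) : formANeg P.1 t (xVar n l) ∈ HasCoeffs M := by
  obtain ⟨p, hp, hgood⟩ := exists_good hV hP
  rw [formANeg_eq _ t _ ht.ne_zero ht.x_ne ht.x_ne_neg ht.th_ne]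
  refine AddSubgroup.add_mem _ (AddSubgroup.neg_mem _ (formAPos_hasCoeffs hV hM hle ht hP)) ?_
  rw [aeval_eq_ev_map_C t _ hp]
  refine HasCoeffs.mul hM ?_ (hgood.hasCoeffs hV hM hle ht.mem)
  have := const_mem (l := l) S (2 * l - n)
  rwa [map_sub, map_sub, map_mul, map_mul, map_natCast, map_natCast, map_natCast, map_natCast,
    map_ofNat, map_ofNat] at this

end Cartan

/-! ### The raising current -/

section Raising

variable {n l : ℕ} {κ : Prop} {V : ∀ l, Set ((Fin l → ℂ) × (Fin n → ℂ))}
  {S : Subalgebra ℂ (K n)}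

theorem Good.snoc {q : Poly n (l + 1)} (hq : Good κ q) :
    Good κ (Cycles.ev zc tv (Fin.snoc X tv : Fin (l + 1) → Poly n l) q) :=
  hq.subst Fin.castSucc (Fin.castSucc_injective _) _ (fun i => by simp) fun j =>
    Fin.lastCases (Or.inr ⟨Polynomial.X, by simp [tv], by rw [Fin.snoc_last]; exact sym_tv⟩)
      (fun i => Or.inl ⟨i, rfl⟩) j

theorem formXp_hasCoeffs (hV : IsLocus κ V) {M : Submodule ℂ (A n l)}
    (hM : IsStable S M) (hle : Cyc (R n) V l ≤ M) {t : Ser n l} (ht : Adm S t)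
    {P : A n (l + 1)} (hP : P ∈ Cyc (R n) V (l + 1)) :
    formXp P.1 t (xVar n l) ∈ HasCoeffs M := by
  obtain ⟨p, hp, hgood⟩ := exists_good hV hP
  have h1 : formXp P.1 t (xVar n l) = (th (zSer n l) t)⁻¹ *
      ev (zSer n l) t (xVar n l) (ev zc tv (Fin.snoc X tv : Fin (l + 1) → Poly n l)
        (map Polynomial.C p)) := by
    rw [formXp, aeval_eq_ev_map_C t _ hp, one_div, ev_ev, ev_tv]
    have : (Fin.snoc (xVar n l) t : Fin (l + 1) → Ser n l) =
        fun i => ev (zSer n l) t (xVar n l) ((Fin.snoc X tv : Fin (l + 1) → Poly n l) i) := by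
      funext i
      refine Fin.lastCases ?_ (fun i => ?_) i <;> simp
    rw [this]
    rfl
  rw [h1]
  exact HasCoeffs.mul hM ht.inv_mem (hgood.snoc.hasCoeffs hV hM hle ht.mem)

end Raising

end Cycles

end

noncomputable section
namespace Cycles
open MvPolynomial

/-! ## Removing poles at `z_a = ± z_b` -/

section Poles

variable {n : ℕ}

/-- The substitution of `r` for `z_a`. -/
def subZ (a : Fin n) (r : MvPolynomial (Fin n) ℂ) :
    MvPolynomial (Fin n) ℂ →ₐ[ℂ] MvPolynomial (Fin n) ℂ := aeval (Function.update X a r)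

@[simp] theorem subZ_self (a : Fin n) (r : MvPolynomial (Fin n) ℂ) : subZ a r (X a) = r := by
  simp [subZ]

theorem subZ_of_ne {a b : Fin n} (h : b ≠ a) (r : MvPolynomial (Fin n) ℂ) :
    subZ a r (X b) = X b := by simp [subZ, h]

/-- `f` times `g` is a polynomial. -/
def Clears (f : K n) (g : MvPolynomial (Fin n) ℂ) : Prop := ∃ m, toK n m = toK n g * f

/-- A substitute for coprimality: comparing the two cleared forms of f at z_a = r shows that m
vanishes there, because g' does not, so that the factor z_a - r can be cancelled from the
denominator. -/
theorem Clears.of_mul {f : K n} {a : Fin n} {r g g' : MvPolynomial (Fin n) ℂ}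
    (hr : X a - r ≠ 0) (h : Clears f ((X a - r) * g)) (h' : Clears f g')
    (hg' : subZ a r g' ≠ 0) (hra : subZ a r r = r) : Clears f g := by
  obtain ⟨m, hm⟩ := h
  obtain ⟨m', hm'⟩ := h'
  have h1 : g' * m = (X a - r) * g * m' := by
    apply toK_injective n
    simp only [map_mul] at hm ⊢
    rw [hm, hm']
    ring
  have h2 : subZ a r m = 0 := by
    have := congrArg (subZ a r) h1
    simp only [map_mul, map_sub, subZ_self, hra, sub_self, zero_mul] at this
    exact (mul_eq_zero.1 this).resolve_left hg'
  obtain ⟨k, rfl⟩ := X_sub_dvd a r m h2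
  refine ⟨k, ?_⟩
  have h3 : toK n (X a - r) ≠ 0 := fun h => hr (toK_injective n (by rw [h, map_zero]))
  refine mul_left_cancel₀ h3 ?_
  rw [← map_mul, hm, map_mul]
  ring

/-- The product `∏_{b ≠ a} (z_a² - z_b²)`. -/
def vdm (a : Fin n) : MvPolynomial (Fin n) ℂ := ∏ b ∈ Finset.univ.erase a, (X a ^ 2 - X b ^ 2)

/-- The product `∏_{c ≠ a, b} (z_a² - z_c²)`. -/
def vdm' (a b : Fin n) : MvPolynomial (Fin n) ℂ :=
  ∏ c ∈ (Finset.univ.erase a).erase b, (X a ^ 2 - X c ^ 2)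

theorem vdm_eq {a b : Fin n} (h : a ≠ b) : vdm a = (X a ^ 2 - X b ^ 2) * vdm' a b :=
  (Finset.mul_prod_erase _ _ (by simp [h.symm])).symm

theorem sq_sub_sq_ne_zero {a b : Fin n} (h : a ≠ b) :
    (X a ^ 2 - X b ^ 2 : MvPolynomial (Fin n) ℂ) ≠ 0 := fun h0 => by
  have := congrArg (eval (Function.update (fun _ => (0 : ℂ)) a 1)) h0
  simp [h.symm] at this

theorem vdm_ne_zero (a : Fin n) : vdm a ≠ 0 :=
  Finset.prod_ne_zero_iff.2 fun b hb => sq_sub_sq_ne_zero (by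
    rw [Finset.mem_erase] at hb; exact hb.1.symm)

theorem toK_ne_zero {p : MvPolynomial (Fin n) ℂ} (h : p ≠ 0) : toK n p ≠ 0 := fun h' =>
  h (toK_injective n (by rw [h', map_zero]))

theorem subZ_vdm'_left (a b : Fin n) {r : MvPolynomial (Fin n) ℂ} (hr : r ^ 2 = X b ^ 2) :
    subZ a r (vdm' a b) = vdm' b a := by
  rw [vdm', vdm', map_prod, Finset.erase_right_comm]
  refine Finset.prod_congr rfl fun c hc => ?_
  simp only [Finset.mem_erase] at hc
  rw [map_sub, map_pow, map_pow, subZ_self, subZ_of_ne hc.1, hr]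

theorem subZ_vdm'_right {a b : Fin n} (hab : a ≠ b) (r : MvPolynomial (Fin n) ℂ) :
    subZ a r (vdm' b a) = vdm' b a := by
  rw [vdm', map_prod]
  refine Finset.prod_congr rfl fun c hc => ?_
  simp only [Finset.mem_erase] at hc
  rw [map_sub, map_pow, map_pow, subZ_of_ne hab.symm, subZ_of_ne hc.1]

theorem vdm'_ne_zero (a b : Fin n) : vdm' a b ≠ 0 :=
  Finset.prod_ne_zero_iff.2 fun c hc => sq_sub_sq_ne_zero (by
    simp only [Finset.mem_erase] at hc; exact hc.2.1.symm)

/-- For c different from a and b, the denominator of the c-th term has no zero along z_a = ±z_b;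
only the terms a and b can have a pole there. -/
theorem subZ_vdm_ne_zero {a b c : Fin n} (hca : c ≠ a) (hcb : c ≠ b)
    {r : MvPolynomial (Fin n) ℂ} (hr : r ^ 2 = X b ^ 2) : subZ a r (vdm c) ≠ 0 := by
  rw [vdm, map_prod]
  refine Finset.prod_ne_zero_iff.2 fun e he => ?_
  simp only [Finset.mem_erase] at he
  rw [map_sub, map_pow, map_pow, subZ_of_ne hca]
  by_cases hea : e = a
  · rw [hea, subZ_self, hr]; exact sq_sub_sq_ne_zero hcb
  · rw [subZ_of_ne hea]; exact sq_sub_sq_ne_zero he.1.symm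

/-- A sum `∑_a α_a / ∏_{b ≠ a} (z_a² - z_b²)` is a polynomial if `α_a` and `α_b` agree at
`z_a = z_b` and at `z_a = -z_b`. -/
theorem exists_toK_eq (α : Fin n → MvPolynomial (Fin n) ℂ)
    (h1 : ∀ a b, a ≠ b → subZ a (X b) (α a) = subZ a (X b) (α b))
    (h2 : ∀ a b, a ≠ b → subZ a (-X b) (α a) = subZ a (-X b) (α b)) :
    ∃ m, toK n m = ∑ a, toK n (α a) / toK n (vdm a) := by
  set f := ∑ a, toK n (α a) / toK n (vdm a) with hf
  -- For each pair, a denominator of f which is not divisible by z_a - z_b or z_a + z_b.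
  have hreg : ∀ a b : Fin n, a ≠ b → Clears f
      ((∏ c ∈ (Finset.univ.erase a).erase b, vdm c) * (vdm' a b * vdm' b a)) := by
    intro a b hab
    have hdvd : ∀ r : MvPolynomial (Fin n) ℂ, r ^ 2 = X b ^ 2 → subZ a r (α a) = subZ a r (α b) →
        X a - r ∣ α a * vdm' b a - α b * vdm' a b := by
      intro r hr h
      refine X_sub_dvd a r _ ?_
      change subZ a r _ = 0
      rw [map_sub, map_mul, map_mul, subZ_vdm'_left a b hr, subZ_vdm'_right hab, h, sub_self]
    obtain ⟨m1, hm1⟩ := hdvd (X b) rfl (h1 a b hab)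
    obtain ⟨m2, hm2⟩ := hdvd (-X b) (neg_sq _) (h2 a b hab)
    have h3 : subZ a (-X b) m1 = 0 := by
      have h := congrArg (subZ a (-X b)) hm1
      rw [hm2] at h
      simp only [map_mul, map_sub, map_neg, subZ_self, subZ_of_ne hab.symm, sub_self, zero_mul] at h
      refine (mul_eq_zero.1 h.symm).resolve_left fun h0 => ?_
      have := congrArg (eval fun _ => (1 : ℂ)) h0
      simp only [map_sub, map_neg, eval_X, map_zero] at this
      norm_num at this
    obtain ⟨m, hm⟩ := X_sub_dvd a (-X b) m1 h3
    -- This is the numerator of the a-th and b-th terms together, over (z_a² - z_b²) `vdm' a b`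
    -- `vdm' b a`. It vanishes at z_a = z_b and at z_a = -z_b, so the factor z_a² - z_b² cancels.
    have hBr : α a * vdm' b a - α b * vdm' a b = (X a ^ 2 - X b ^ 2) * m := by
      rw [hm1, hm]; ring
    have key : ∀ c, c ≠ a → c ≠ b → Clears (toK n (α c) / toK n (vdm c))
        ((∏ c ∈ (Finset.univ.erase a).erase b, vdm c) * (vdm' a b * vdm' b a)) := by
      intro c hca hcb
      rw [← Finset.mul_prod_erase _ _ (show c ∈ (Finset.univ.erase a).erase b by simp [hca, hcb])]
      refine ⟨α c * ((∏ c ∈ ((Finset.univ.erase a).erase b).erase c, vdm c) *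
        (vdm' a b * vdm' b a)), ?_⟩
      have := toK_ne_zero (vdm_ne_zero c)
      simp only [map_mul]
      field_simp
    choose! m' hm' using key
    refine ⟨(∏ c ∈ (Finset.univ.erase a).erase b, vdm c) * m +
      ∑ c ∈ (Finset.univ.erase a).erase b, m' c, ?_⟩
    rw [hf, ← Finset.add_sum_erase _ _ (Finset.mem_univ a),
      ← Finset.add_sum_erase _ _ (show b ∈ Finset.univ.erase a by simp [hab.symm]), ← add_assoc,
      mul_add, map_add, map_sum, Finset.mul_sum]
    congr 1
    · rw [vdm_eq hab, vdm_eq hab.symm]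
      have e1 := toK_ne_zero (sq_sub_sq_ne_zero hab)
      have e2 := toK_ne_zero (sq_sub_sq_ne_zero hab.symm)
      have e3 := toK_ne_zero (vdm'_ne_zero a b)
      have e4 := toK_ne_zero (vdm'_ne_zero b a)
      have e5 := congrArg (toK n) hBr
      simp only [map_mul, map_sub, map_pow] at e1 e2 e5 ⊢
      have e6 : toK n (X b) ^ 2 - toK n (X a) ^ 2 = -(toK n (X a) ^ 2 - toK n (X b) ^ 2) := by ring
      rw [e6]
      generalize toK n (X a) ^ 2 - toK n (X b) ^ 2 = v at *
      field_simp
      linear_combination -(toK n (∏ c ∈ (Finset.univ.erase a).erase b, vdm c)) * e5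
    · refine Finset.sum_congr rfl fun c hc => ?_
      simp only [Finset.mem_erase] at hc
      exact hm' c hc.2.1 hc.1
  have hne : ∀ a b : Fin n, a ≠ b → ∀ r : MvPolynomial (Fin n) ℂ, r ^ 2 = X b ^ 2 →
      subZ a r ((∏ c ∈ (Finset.univ.erase a).erase b, vdm c) * (vdm' a b * vdm' b a)) ≠ 0 := by
    intro a b hab r hr
    rw [map_mul, map_mul, map_prod, subZ_vdm'_left a b hr, subZ_vdm'_right hab]
    refine mul_ne_zero (Finset.prod_ne_zero_iff.2 fun c hc => ?_)
      (mul_ne_zero (vdm'_ne_zero b a) (vdm'_ne_zero b a))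
    simp only [Finset.mem_erase] at hc
    exact subZ_vdm_ne_zero hc.2.1 hc.1 hr
  -- Starting from the full common denominator, the factors z_a² - z_b² are removed one at a time.
  -- Each pair occurs in both orders, which is harmless since `hreg` controls the pole regardless of
  -- its multiplicity.
  have hone : ∀ s : Finset (Σ _ : Fin n, Fin n), (∀ i ∈ s, i.1 ≠ i.2) →
      Clears f (∏ i ∈ s, (X i.1 ^ 2 - X i.2 ^ 2)) → Clears f 1 := by
    intro s
    induction s using Finset.induction_on with
    | empty => exact fun _ h => by simpa using h
    | insert i s hi ih =>
      intro hs h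
      refine ih (fun j hj => hs j (by simp [hj])) ?_
      have hi' : i.1 ≠ i.2 := hs i (by simp)
      have e : (X i.1 ^ 2 - X i.2 ^ 2 : MvPolynomial (Fin n) ℂ)
          = (X i.1 - X i.2) * (X i.1 - -X i.2) := by ring
      have e0 := sq_sub_sq_ne_zero hi'
      rw [Finset.prod_insert hi, e, mul_assoc] at h
      rw [e] at e0
      refine Clears.of_mul (right_ne_zero_of_mul e0) (Clears.of_mul (left_ne_zero_of_mul e0) h
        (hreg _ _ hi') (hne _ _ hi' _ rfl) (subZ_of_ne hi'.symm _)) (hreg _ _ hi')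
        (hne _ _ hi' _ (neg_sq _)) ?_
      rw [map_neg, subZ_of_ne hi'.symm]
  obtain ⟨m, hm⟩ := hone (Finset.univ.sigma fun a => Finset.univ.erase a) (fun i hi => by
    simp only [Finset.mem_sigma, Finset.mem_univ, Finset.mem_erase, true_and, and_true] at hi
    exact Ne.symm hi) (by
    rw [Finset.prod_sigma]
    change Clears f (∏ a, vdm a)
    refine ⟨∑ a, α a * ∏ b ∈ Finset.univ.erase a, vdm b, ?_⟩
    rw [hf, map_sum, Finset.mul_sum]
    refine Finset.sum_congr rfl fun a _ => ?_
    rw [← Finset.mul_prod_erase _ _ (Finset.mem_univ a), map_mul, map_mul]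
    have := toK_ne_zero (vdm_ne_zero a)
    field_simp)
  exact ⟨m, by rw [hm, map_one, one_mul]⟩

end Poles

end Cycles

end

noncomputable section
namespace Cycles
open MvPolynomial

/-! ## The difference equation `N(-t) Θ(t) - N(t) Θ(-t) = s(t)` -/

section Difference

variable {n : ℕ}

/-- The product z_1⋯z_n p vanishes at every point, and z_1⋯z_n is not a zero divisor. Vanishing on
the locus is known only where all w_j are non-zero. -/
theorem eq_zero_of_eval_eq_zero (p : MvPolynomial (Fin n) ℂ)
    (h : ∀ w : Fin n → ℂ, (∀ j, w j ≠ 0) → eval w p = 0) : p = 0 := by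
  refine (mul_eq_zero.1 (?_ : zProd n * p = 0)).resolve_left (zProd_ne_zero n)
  refine MvPolynomial.funext fun w => ?_
  rw [map_mul, map_zero]
  by_cases hw : ∀ j, w j ≠ 0
  · rw [h w hw, mul_zero]
  · push Not at hw
    obtain ⟨j, hj⟩ := hw
    rw [zProd, map_prod, Finset.prod_eq_zero (Finset.mem_univ j) (by simp [hj]), zero_mul]

theorem z_ne_zero (a : Fin n) : z a ≠ 0 := toK_ne_zero (X_ne_zero a)

theorem z_injective : Function.Injective (z : Fin n → K n) := fun _ _ h =>
  X_injective (toK_injective n h)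

theorem z_add_ne_zero (a b : Fin n) : z a + z b ≠ 0 := by
  have h : (X a + X b : MvPolynomial (Fin n) ℂ) ≠ 0 := fun h => by
    have := congrArg (eval fun _ => (1 : ℂ)) h
    norm_num at this
  have := toK_ne_zero h
  rwa [map_add] at this

theorem th_inv_z (a : Fin n) : th (toK n) (z a)⁻¹ = 0 :=
  th_eq_zero_of_mul_eq_one _ _ a (inv_mul_cancel₀ (z_ne_zero a))

theorem th_neg_inv_z_ne_zero (a : Fin n) : th (toK n) (-(z a)⁻¹) ≠ 0 := by
  refine Finset.prod_ne_zero_iff.2 fun b _ h => z_add_ne_zero a b ?_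
  have hz := z_ne_zero a
  change 1 - z b * -(z a)⁻¹ = 0 at h
  field_simp at h
  linear_combination h

theorem map_th_polynomial {S : Type*} [CommRing S] (f : MvPolynomial (Fin n) ℂ →+* S)
    (r : Polynomial (MvPolynomial (Fin n) ℂ)) :
    (th Polynomial.C r).map f = th (Polynomial.C.comp f) (r.map f) := by
  rw [← Polynomial.coe_mapRingHom, map_th]
  congr 1
  ext <;> simp

theorem eval_th_C (r : K n) (s : Polynomial (K n)) :
    (th (Polynomial.C.comp (toK n)) s).eval r = th (toK n) (s.eval r) := by
  rw [← Polynomial.coe_evalRingHom, map_th]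
  congr 1
  ext <;> simp

/-- The operator `N(t) ↦ N(-t) Θ(t) - N(t) Θ(-t)`. -/
def diffOp (N : Polynomial (MvPolynomial (Fin n) ℂ)) : Polynomial (MvPolynomial (Fin n) ℂ) :=
  N.comp (-Polynomial.X) * th Polynomial.C Polynomial.X - N * th Polynomial.C (-Polynomial.X)

theorem eval_map_diffOp (N : Polynomial (MvPolynomial (Fin n) ℂ)) (r : K n) :
    ((diffOp N).map (toK n)).eval r =
      (N.map (toK n)).eval (-r) * th (toK n) r - (N.map (toK n)).eval r * th (toK n) (-r) := by
  simp only [diffOp, Polynomial.map_sub, Polynomial.map_mul, map_th_polynomial, Polynomial.map_comp,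
    Polynomial.eval_sub, Polynomial.eval_mul, Polynomial.eval_comp, eval_th_C, Polynomial.map_neg,
    Polynomial.map_X, Polynomial.eval_neg, Polynomial.eval_X]

theorem eq_zero_of_inv_z {N : Polynomial (K n)} (hd : N.degree < n)
    (h : ∀ a, N.eval (z a)⁻¹ = 0) : N = 0 := by
  refine Polynomial.eq_zero_of_degree_lt_of_eval_index_eq_zero (s := Finset.univ)
    (v := fun a : Fin n => (z a)⁻¹) ?_ (by simpa using hd) fun a _ => h a
  exact fun a _ b _ hab => z_injective (inv_injective hab)

/-- At t = 1/z_a the term with Θ(t) drops out and Θ(-1/z_a) ≠ 0, so N vanishes at n distinct points.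
-/
theorem diffOp_injective {N : Polynomial (MvPolynomial (Fin n) ℂ)} (hd : ∀ k, n ≤ k → N.coeff k = 0)
    (h : diffOp N = 0) : N = 0 := by
  refine Polynomial.map_injective (toK n) (toK_injective n) ?_
  rw [Polynomial.map_zero]
  refine eq_zero_of_inv_z ?_ fun a => ?_
  · rw [Polynomial.degree_lt_iff_coeff_zero]
    intro k hk
    rw [Polynomial.coeff_map, hd k hk, map_zero]
  · have := eval_map_diffOp N (z a)⁻¹
    rw [h, th_inv_z] at this
    simp only [Polynomial.map_zero, Polynomial.eval_zero, mul_zero, zero_sub] at this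
    exact (mul_eq_zero.1 (neg_eq_zero.1 this.symm)).resolve_right (th_neg_inv_z_ne_zero a)

theorem degree_th_le {k : Polynomial (K n)} (hk : k.degree ≤ 1) :
    (th (Polynomial.C.comp (toK n)) k).degree ≤ n := by
  refine (Polynomial.degree_prod_le _ _).trans ?_
  refine (Finset.sum_le_card_nsmul _ _ (1 : WithBot ℕ) fun j _ => ?_).trans (by simp)
  refine (Polynomial.degree_sub_le _ _).trans (max_le (Polynomial.degree_one_le.trans (by simp)) ?_)
  refine (Polynomial.degree_mul_le _ _).trans ?_
  refine (add_le_add Polynomial.degree_C_le hk).trans (by simp)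

theorem degree_prod_erase {E : Type*} [CommRing E] (y : Fin n → E) (a : Fin n) :
    (∏ b ∈ Finset.univ.erase a, (1 - Polynomial.C (y b) * Polynomial.X) :
      Polynomial E).degree < n := by
  refine (Polynomial.degree_prod_le _ _).trans_lt ?_
  refine (Finset.sum_le_card_nsmul _ _ (1 : WithBot ℕ) fun j _ => ?_).trans_lt ?_
  · refine (Polynomial.degree_sub_le _ _).trans
      (max_le (Polynomial.degree_one_le.trans (by simp)) ?_)
    refine (Polynomial.degree_mul_le _ _).trans ?_
    refine (add_le_add Polynomial.degree_C_le Polynomial.degree_X_le).trans (by simp)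
  · have := a.pos
    simp only [Finset.mem_univ, Finset.card_erase_of_mem, Finset.card_univ, Fintype.card_fin,
      nsmul_eq_mul, mul_one]
    exact_mod_cast (by omega : n - 1 < n)

/-- `z_a^{2n-2} s(z_a⁻¹)`. -/
def revAt (s : Polynomial (MvPolynomial (Fin n) ℂ)) (a : Fin n) : MvPolynomial (Fin n) ℂ :=
  ∑ k ∈ Finset.range (2 * n - 1), s.coeff k * X a ^ (2 * n - 2 - k)

theorem map_revAt {s : Polynomial (MvPolynomial (Fin n) ℂ)} (hdeg : ∀ k, 2 * n ≤ k + 1 → s.coeff k = 0)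
    {B : Type*} [Field B] (φ : MvPolynomial (Fin n) ℂ →+* B) (a : Fin n) (h : φ (X a) ≠ 0) :
    φ (revAt s a) = φ (X a) ^ (2 * n - 2) * s.eval₂ φ (φ (X a))⁻¹ := by
  rw [Polynomial.eval₂_eq_sum_range' (n := 2 * n - 1), revAt, map_sum, Finset.mul_sum]
  · refine Finset.sum_congr rfl fun k hk => ?_
    rw [Finset.mem_range] at hk
    have e : 2 * n - 2 = (2 * n - 2 - k) + k := by omega
    rw [map_mul, map_pow, e, pow_add, Nat.add_sub_cancel]
    rw [inv_pow]
    field_simp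
  · have := a.pos
    refine (Polynomial.natDegree_le_iff_coeff_eq_zero.2 fun k (hk : 2 * n - 2 < k) =>
      hdeg k (by omega)).trans_lt (by omega)

/-- The product `∏_{c ≠ a} (1 - z_c t)`. -/
def basisPoly (a : Fin n) : Polynomial (MvPolynomial (Fin n) ℂ) :=
  ∏ c ∈ Finset.univ.erase a, (1 - Polynomial.C (X c) * Polynomial.X)

theorem subZ_coeff_basisPoly {a b : Fin n} (hab : a ≠ b) (k : ℕ) :
    subZ a (X b) ((basisPoly a).coeff k) = subZ a (X b) ((basisPoly b).coeff k) := by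
  have h : (basisPoly a).map (subZ a (X b) : MvPolynomial (Fin n) ℂ →+* MvPolynomial (Fin n) ℂ) =
      (basisPoly b).map (subZ a (X b) : MvPolynomial (Fin n) ℂ →+* MvPolynomial (Fin n) ℂ) := by
    rw [basisPoly, basisPoly, ← Finset.mul_prod_erase (Finset.univ.erase a) _
        (show b ∈ Finset.univ.erase a by simp [hab.symm]),
      ← Finset.mul_prod_erase (Finset.univ.erase b) _
        (show a ∈ Finset.univ.erase b by simp [hab]),
      Finset.erase_right_comm, Polynomial.map_mul, Polynomial.map_mul]
    refine congrArg (· * _) ?_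
    simp only [Polynomial.map_sub, Polynomial.map_mul, Polynomial.map_one, Polynomial.map_C,
      Polynomial.map_X, RingHom.coe_coe, subZ_self, subZ_of_ne hab.symm]
  have := congrArg (fun p => Polynomial.coeff p k) h
  simpa only [Polynomial.coeff_map, RingHom.coe_coe] using this

/-- The equation forces N(1/z_a) = -s(1/z_a)/Θ(-1/z_a), and Lagrange interpolation gives N over K_n.
Its coefficients are sums over a with denominators ∏_{b≠a}(z_a² - z_b²), to which `exists_toK_eq`
applies: at z_a = z_b the terms a and b have equal numerators, with no symmetry assumption on s, and
at z_a = -z_b both numerators vanish by hvan. -/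
theorem exists_diffOp_eq (s : Polynomial (MvPolynomial (Fin n) ℂ))
    (hdeg : ∀ k, 2 * n ≤ k + 1 → s.coeff k = 0) (hodd : s.comp (-Polynomial.X) = -s)
    (hvan : ∀ a b, a ≠ b → ∀ w : Fin n → ℂ, (∀ j, w j ≠ 0) → w b = -w a →
      s.eval₂ (eval w) (w a)⁻¹ = 0) :
    ∃ N : Polynomial (MvPolynomial (Fin n) ℂ), (∀ k, n ≤ k → N.coeff k = 0) ∧ diffOp N = s := by
  have hrev : ∀ a b : Fin n, a ≠ b → ∀ w : Fin n → ℂ, (∀ j, w j ≠ 0) → w b = - w a →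
      eval w (revAt s a) = 0 := by
    intro a b hab w hw h
    rw [map_revAt hdeg _ _ (by simpa using hw a)]
    simp [hvan a b hab w hw h]
  -- The pointwise vanishing of s becomes a polynomial identity after the substitution z_a = -z_b.
  have hsub : ∀ a b : Fin n, a ≠ b →
      subZ a (-X b) (revAt s a) = 0 ∧ subZ a (-X b) (revAt s b) = 0 := by
    intro a b hab
    have e : ∀ (w : Fin n → ℂ) p, eval w (subZ a (-X b) p) =
        eval (Function.update w a (-w b)) p := by
      intro w p
      have : ((aeval w).comp (subZ a (-X b)) : MvPolynomial (Fin n) ℂ →ₐ[ℂ] ℂ) =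
          aeval (Function.update w a (-w b)) := by
        ext j
        by_cases hj : j = a
        · subst hj; simp
        · simp [hj, subZ_of_ne hj]
      exact DFunLike.congr_fun this p
    have hw' : ∀ w : Fin n → ℂ, (∀ j, w j ≠ 0) → ∀ j, Function.update w a (-w b) j ≠ 0 := by
      intro w hw j
      by_cases hj : j = a
      · subst hj; simp [hw]
      · simp [hj, hw]
    constructor
    · refine eq_zero_of_eval_eq_zero _ fun w hw => ?_
      rw [e]
      exact hrev a b hab _ (hw' w hw) (by simp [hab.symm])
    · refine eq_zero_of_eval_eq_zero _ fun w hw => ?_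
      rw [e]
      exact hrev b a hab.symm _ (hw' w hw) (by simp [hab.symm])
  -- The sign is that of N(1/z_a), and the 2 is the factor 1 - z_a(-1/z_a) of Θ(-1/z_a).
  obtain ⟨h, hh⟩ : ∃ h : ℂ, h * 2 = -1 := ⟨-2⁻¹, by norm_num⟩
  have hex : ∀ k, ∃ m, toK n m = ∑ a, toK n (C h * (revAt s a *
      (basisPoly a).coeff k)) /
        toK n (vdm a) := by
    intro k
    refine exists_toK_eq (fun a => C h * (revAt s a *
      (basisPoly a).coeff k)) (fun a b hab => ?_) (fun a b hab => ?_)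
    · have h2 : subZ a (X b) (revAt s a) = subZ a (X b) (revAt s b) := by
        simp only [revAt, map_sum, map_mul, map_pow, subZ_self, subZ_of_ne hab.symm]
      simp only [map_mul, h2, subZ_coeff_basisPoly hab]
    · simp only [map_mul, (hsub a b hab).1, (hsub a b hab).2, zero_mul]
  choose m hm using hex
  set N : Polynomial (MvPolynomial (Fin n) ℂ) :=
    ∑ k ∈ Finset.range n, Polynomial.monomial k (m k) with hN
  have hNc : ∀ k, n ≤ k → N.coeff k = 0 := by
    intro k hk
    rw [hN, Polynomial.finsetSum_coeff]
    refine Finset.sum_eq_zero fun j hj => ?_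
    rw [Polynomial.coeff_monomial, if_neg (by rw [Finset.mem_range] at hj; omega)]
  have hNk : ∀ k, k < n → N.coeff k = m k := by
    intro k hk
    rw [hN, Polynomial.finsetSum_coeff, Finset.sum_eq_single k]
    · simp
    · intro j _ hj; rw [Polynomial.coeff_monomial, if_neg hj]
    · intro h; simp [hk] at h
  clear_value N
  have hNm : N.map (toK n) = ∑ a, Polynomial.C (toK n (C h * revAt s a) / toK n (vdm a)) *
      ∏ c ∈ Finset.univ.erase a, (1 - Polynomial.C (z c) * Polynomial.X) := by
    have hp : ∀ a : Fin n, (∏ c ∈ Finset.univ.erase a, (1 - Polynomial.C (z c) * Polynomial.X)) =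
        (basisPoly a).map (toK n) := by
      intro a
      simp only [basisPoly, Polynomial.map_prod, Polynomial.map_sub, Polynomial.map_one,
        Polynomial.map_mul, Polynomial.map_C, Polynomial.map_X, z]
    ext k
    rw [Polynomial.coeff_map, Polynomial.finsetSum_coeff]
    by_cases hk : k < n
    · rw [hNk k hk, hm]
      refine Finset.sum_congr rfl fun a _ => ?_
      rw [Polynomial.coeff_C_mul, hp, Polynomial.coeff_map, ← mul_assoc, map_mul]
      ring
    · rw [hNc k (by omega), map_zero]
      symm
      refine Finset.sum_eq_zero fun a _ => ?_
      rw [Polynomial.coeff_C_mul, Polynomial.coeff_eq_zero_of_degree_lt, mul_zero]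
      exact (degree_prod_erase z a).trans_le (by exact_mod_cast (by omega : n ≤ k))
  -- Only the a-th term survives at 1/z_a. The power z_a^{2n-2} in `revAt` turns ∏(1 - z_b/z_a)(1 +
  -- z_b/z_a) into ∏(z_a² - z_b²).
  have hNe : ∀ a, (N.map (toK n)).eval (z a)⁻¹ * th (toK n) (-(z a)⁻¹) =
      -(s.map (toK n)).eval (z a)⁻¹ := by
    intro a
    have hz := z_ne_zero a
    rw [hNm, Polynomial.eval_finsetSum, Finset.sum_eq_single a]
    · have h1 : toK n (revAt s a) = _ := map_revAt hdeg (toK n) a hz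
      rw [Polynomial.eval_map, map_mul, h1]
      have h2 : toK n (vdm a) = z a ^ (2 * n - 2) * (∏ b ∈ Finset.univ.erase a, (1 - z b * (z a)⁻¹)) *
          (∏ b ∈ Finset.univ.erase a, (1 - z b * -(z a)⁻¹)) := by
        rw [vdm, map_prod, show 2 * n - 2 = (Finset.univ.erase a).card + (Finset.univ.erase a).card by
            rw [Finset.card_erase_of_mem (Finset.mem_univ a), Finset.card_univ, Fintype.card_fin]
            omega, pow_add, ← Finset.prod_const, ← Finset.prod_mul_distrib, ← Finset.prod_mul_distrib,
          ← Finset.prod_mul_distrib]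
        refine Finset.prod_congr rfl fun b _ => ?_
        rw [map_sub, map_pow, map_pow]
        change z a ^ 2 - z b ^ 2 = _
        field_simp
        ring
      have h3 : th (toK n) (-(z a)⁻¹) = 2 * ∏ b ∈ Finset.univ.erase a, (1 - z b * -(z a)⁻¹) := by
        rw [th, ← Finset.mul_prod_erase _ _ (Finset.mem_univ a)]
        congr 1
        change 1 - z a * -(z a)⁻¹ = 2
        field_simp
        norm_num
      have h4 : toK n (vdm a) ≠ 0 := toK_ne_zero (vdm_ne_zero a)
      have h5 : toK n (C h) = -2⁻¹ := by
        have : toK n (C h) * 2 = -1 := by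
          rw [show (2 : K n) = toK n (C 2) from (map_ofNat ((toK n).comp C) 2).symm,
            ← map_mul, ← C_mul, hh, C_neg, C_1, map_neg, map_one]
        field_simp
        linear_combination this
      rw [h2] at h4
      simp only [Polynomial.eval_mul, Polynomial.eval_C, Polynomial.eval_prod, Polynomial.eval_sub,
        Polynomial.eval_one, Polynomial.eval_X]
      rw [h2, h3, h5]
      have h6 := left_ne_zero_of_mul h4
      have h7 := right_ne_zero_of_mul h4
      have h8 := left_ne_zero_of_mul h6
      have h9 := right_ne_zero_of_mul h6
      change _ * (z a ^ _ * Polynomial.eval₂ (toK n) (z a)⁻¹ s) / _ * _ * _ = _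
      generalize Polynomial.eval₂ (toK n) (z a)⁻¹ s = e at *
      generalize (∏ b ∈ Finset.univ.erase a, (1 - z b * -(z a)⁻¹)) = e1 at *
      generalize (∏ b ∈ Finset.univ.erase a, (1 - z b * (z a)⁻¹)) = e2 at *
      generalize z a ^ (2 * n - 2) = e3 at *
      field_simp
    · intro b _ hb
      have : ∏ c ∈ Finset.univ.erase b,
          Polynomial.eval (z a)⁻¹ (1 - Polynomial.C (z c) * Polynomial.X) = 0 := by
        refine Finset.prod_eq_zero (i := a) (by simp [hb.symm]) ?_
        simp [hz]
      rw [Polynomial.eval_mul, Polynomial.eval_prod, this, mul_zero]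
    · simp
  refine ⟨N, hNc, ?_⟩
  refine Polynomial.map_injective (toK n) (toK_injective n) ?_
  rw [← sub_eq_zero]
  -- The defect D is odd and vanishes at all 1/z_a, hence at the 2n distinct points ±1/z_a, whereas
  -- its degree is at most 2n - 1.
  set D := (diffOp N).map (toK n) - s.map (toK n) with hD
  have hs' : ∀ r, (s.map (toK n)).eval (-r) = -(s.map (toK n)).eval r := by
    intro r
    have := congrArg (fun p => (Polynomial.map (toK n) p).eval r) hodd
    simpa [Polynomial.map_comp] using this
  have hD1 : ∀ a, D.eval (z a)⁻¹ = 0 := fun a => by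
    rw [hD, Polynomial.eval_sub, eval_map_diffOp, th_inv_z, hNe]
    ring
  have hD2 : ∀ r, D.eval (-r) = -D.eval r := fun r => by
    rw [hD, Polynomial.eval_sub, Polynomial.eval_sub, eval_map_diffOp, eval_map_diffOp, hs', neg_neg]
    ring
  refine Polynomial.eq_zero_of_degree_lt_of_eval_index_eq_zero (s := Finset.univ)
    (v := Sum.elim (fun a : Fin n => (z a)⁻¹) (fun a : Fin n => -(z a)⁻¹)) ?_ ?_ ?_
  · rw [Finset.coe_univ, Set.injOn_univ]
    refine Function.Injective.sumElim (fun a b h => z_injective (inv_injective h))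
      (fun a b h => z_injective (inv_injective (neg_injective h))) fun a b h => z_add_ne_zero a b ?_
    have := z_ne_zero a
    have := z_ne_zero b
    field_simp at h
    linear_combination h
  -- For n = 0 the truncated bound 2n - 1 would be too weak, but then N and s are both zero.
  · rcases n.eq_zero_or_pos with hn | hn
    · have : D = 0 := by
        have h1 : N = 0 := Polynomial.ext fun k => by rw [hNc k (by omega), Polynomial.coeff_zero]
        have h2 : s = 0 := Polynomial.ext fun k => by rw [hdeg k (by omega), Polynomial.coeff_zero]
        rw [hD, h1, h2]
        simp [diffOp]
      rw [this, Polynomial.degree_zero]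
      exact WithBot.bot_lt_coe _
    have hNd : (N.map (toK n)).natDegree ≤ n - 1 :=
      Polynomial.natDegree_le_iff_coeff_eq_zero.2 fun k hk => by
        rw [Polynomial.coeff_map, hNc k (by omega), map_zero]
    have hsd : (s.map (toK n)).natDegree ≤ 2 * n - 1 :=
      Polynomial.natDegree_le_iff_coeff_eq_zero.2 fun k hk => by
        rw [Polynomial.coeff_map, hdeg k (by omega), map_zero]
    have hth : ∀ k : Polynomial (K n), k.degree ≤ 1 →
        (th (Polynomial.C.comp (toK n)) k).natDegree ≤ n := fun k hk =>
      Polynomial.natDegree_le_of_degree_le (degree_th_le hk)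
    have hNd' : ((N.map (toK n)).comp (-Polynomial.X)).natDegree ≤ n - 1 := by
      rw [Polynomial.natDegree_comp]; simpa using hNd
    have : D.natDegree ≤ 2 * n - 1 := by
      rw [hD, diffOp, Polynomial.map_sub, Polynomial.map_mul, Polynomial.map_mul,
        Polynomial.map_comp, map_th_polynomial, map_th_polynomial, Polynomial.map_neg,
        Polynomial.map_X]
      refine Polynomial.natDegree_sub_le_of_le (Polynomial.natDegree_sub_le_of_le ?_ ?_) hsd |>.trans
        (le_of_eq (by rw [max_self]; exact max_self _))
      · refine Polynomial.natDegree_mul_le.trans ?_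
        have := hth Polynomial.X Polynomial.degree_X_le
        omega
      · refine Polynomial.natDegree_mul_le.trans ?_
        have := hth (-Polynomial.X) (by rw [Polynomial.degree_neg]; exact Polynomial.degree_X_le)
        omega
    refine (Polynomial.degree_le_of_natDegree_le this).trans_lt ?_
    simp only [Finset.card_univ, Fintype.card_sum, Fintype.card_fin]
    exact_mod_cast (by omega : 2 * n - 1 < n + n)
  · rintro (a | a) _
    · exact hD1 a
    · rw [Sum.elim_inr, hD2, hD1, neg_zero]

end Difference

end Cycles

end

noncomputable section
namespace Cycles
open MvPolynomial

/-! ### The difference equation with parameters X_i, and its solution on the locus -/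

section PolyDifference

variable {n l : ℕ}

/-- The operator `N(t) ↦ N(-t) Θ(t) - N(t) Θ(-t)` on polynomials in the `X_i` as well. -/
def polyDiff (N : Poly n l) : Poly n l := ev zc (-tv) X N * th zc tv - N * th zc (-tv)

/-- The degree of `N` in `t` is less than `n`. -/
def TDegLT (N : Poly n l) : Prop := ∀ m k, n ≤ k → (coeff m N).coeff k = 0

theorem ev_zc_eq_map (f : Polynomial (MvPolynomial (Fin n) ℂ) →+* Polynomial (MvPolynomial (Fin n) ℂ))
    (N : Poly n l) :
    ev ((C.comp f).comp Polynomial.C) (C (f Polynomial.X)) X N = map f N := by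
  have : ev ((C.comp f).comp Polynomial.C) (C (f Polynomial.X)) X =
      (map f : Poly n l →+* Poly n l) :=
    ringHom_ext' (by rw [ev_comp_zc]; ext <;> simp [zc]) (by simp [tv]) (by simp)
  exact DFunLike.congr_fun this N

theorem coeff_ev_neg (N : Poly n l) (m : Fin l →₀ ℕ) :
    coeff m (ev zc (-tv) X N) = (coeff m N).comp (-Polynomial.X) := by
  have h := ev_zc_eq_map (Polynomial.compRingHom (-Polynomial.X)) N
  have e : (C.comp (Polynomial.compRingHom (-Polynomial.X))).comp Polynomial.C =
      (zc : MvPolynomial (Fin n) ℂ →+* Poly n l) := by ext <;> simp [zc]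
  have e' : (C (Polynomial.compRingHom (-Polynomial.X) Polynomial.X) : Poly n l) = -tv := by
    simp [tv]
  rw [e, e'] at h
  rw [h, coeff_map]
  rfl

theorem coeff_ev_rename (σ : Equiv.Perm (Fin n)) (N : Poly n l) (m : Fin l →₀ ℕ) :
    coeff m (ev ((zc (l := l)).comp (rename σ : MvPolynomial (Fin n) ℂ →ₐ[ℂ] _).toRingHom) tv X N) =
      (coeff m N).map (rename σ : MvPolynomial (Fin n) ℂ →ₐ[ℂ] _).toRingHom := by
  have h := ev_zc_eq_map
    (Polynomial.mapRingHom (rename σ : MvPolynomial (Fin n) ℂ →ₐ[ℂ] _).toRingHom) N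
  have e : (C.comp (Polynomial.mapRingHom
      (rename σ : MvPolynomial (Fin n) ℂ →ₐ[ℂ] _).toRingHom)).comp Polynomial.C =
      (zc (l := l)).comp (rename σ : MvPolynomial (Fin n) ℂ →ₐ[ℂ] _).toRingHom := by
    ext <;> simp [zc]
  have e' : (C (Polynomial.mapRingHom (rename σ : MvPolynomial (Fin n) ℂ →ₐ[ℂ] _).toRingHom
      Polynomial.X) : Poly n l) = tv := by simp [tv]
  rw [e, e'] at h
  rw [h, coeff_map]
  rfl

theorem th_zc_eq (r : Polynomial (MvPolynomial (Fin n) ℂ)) :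
    th (zc : MvPolynomial (Fin n) ℂ →+* Poly n l) (C r) = C (th Polynomial.C r) := by
  have h := map_th (C : Polynomial (MvPolynomial (Fin n) ℂ) →+* Poly n l) Polynomial.C r
  rw [h]
  rfl

theorem coeff_polyDiff (N : Poly n l) (m : Fin l →₀ ℕ) :
    coeff m (polyDiff N) = diffOp (coeff m N) := by
  have e : (-tv : Poly n l) = C (-Polynomial.X) := by rw [tv, C_neg]
  rw [polyDiff, coeff_sub, e, th_zc_eq, tv, th_zc_eq, mul_comm, coeff_C_mul,
    mul_comm N, coeff_C_mul, ← e, coeff_ev_neg, diffOp]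
  ring

theorem ev_polyDiff {B : Type*} [CommRing B] (φ : MvPolynomial (Fin n) ℂ →+* B) (t : B)
    (x : Fin l → B) (N : Poly n l) : ev φ t x (polyDiff N) =
      ev φ (-t) x N * th φ t - ev φ t x N * th φ (-t) := by
  rw [polyDiff, map_sub, map_mul, map_mul, ev_th, ev_th, ev_ev]
  simp

/-- Uniqueness in each coefficient of the X_i. Since the operator commutes with permutations of the
X_i and of the z_j, the solution inherits the symmetries of the right hand side. -/
theorem polyDiff_injective {N N' : Poly n l} (h : TDegLT N) (h' : TDegLT N')
    (hN : polyDiff N = polyDiff N') : N = N' := by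
  rw [← sub_eq_zero]
  ext1 m
  rw [coeff_zero]
  refine diffOp_injective (fun k hk => by
    rw [coeff_sub, Polynomial.coeff_sub, h m k hk, h' m k hk, sub_zero]) ?_
  rw [← coeff_polyDiff]
  have : polyDiff (N - N') = polyDiff N - polyDiff N' := by
    simp only [polyDiff, map_sub]
    ring
  rw [this, hN, sub_self, coeff_zero]

/-- The equation is solved for each monomial in the X_i separately. The last clause keeps the
support of N within that of s, and with it the degree bounds in the X_i. -/
theorem exists_polyDiff_eq (s : Poly n l)
    (hdeg : ∀ m k, 2 * n ≤ k + 1 → (coeff m s).coeff k = 0) (hodd : ev zc (-tv) X s = -s)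
    (hvan : ∀ a b, a ≠ b → ∀ w : Fin n → ℂ, (∀ j, w j ≠ 0) → w b = -w a → ∀ x,
      ev (eval w) (w a)⁻¹ x s = 0) :
    ∃ N : Poly n l, TDegLT N ∧ polyDiff N = s ∧ ∀ m, coeff m s = 0 → coeff m N = 0 := by
  have h : ∀ m, ∃ N : Polynomial (MvPolynomial (Fin n) ℂ),
      (∀ k, n ≤ k → N.coeff k = 0) ∧ diffOp N = coeff m s := by
    intro m
    refine exists_diffOp_eq _ (hdeg m) ?_ fun a b hab w hw hwab => ?_
    · rw [← coeff_ev_neg, hodd, coeff_neg]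
    · have h0 : map (Polynomial.eval₂RingHom (eval w) (w a)⁻¹) s = 0 := by
        refine MvPolynomial.funext fun x => ?_
        rw [eval_map, map_zero, ← hvan a b hab w hw hwab x]
        rfl
      have := congrArg (coeff m) h0
      rwa [coeff_map, coeff_zero] at this
  choose N hN hN' using h
  have hN0 : ∀ m, coeff m s = 0 → N m = 0 := fun m hm => diffOp_injective (hN m) (by rw [hN', hm])
  have hc : ∀ m, coeff m (∑ m ∈ s.support, monomial m (N m)) = N m := by
    intro m
    rw [coeff_sum]
    simp only [coeff_monomial, Finset.sum_ite_eq', mem_support_iff]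
    split_ifs with h
    · rfl
    · rw [hN0 m (not_not.1 h)]
  refine ⟨∑ m ∈ s.support, monomial m (N m), fun m => ?_, ?_, fun m hm => ?_⟩
  · rw [hc]; exact hN m
  · ext1 m; rw [coeff_polyDiff, hc, hN']
  · rw [hc, hN0 m hm]

/-- The substitution `X_{l+1} = -t`, `X_{l+2} = t`. -/
def sqSub (q : Poly n (l + 2)) : Poly n l :=
  ev zc tv (Fin.snoc (Fin.snoc X (-tv) : Fin (l + 1) → Poly n l) tv : Fin (l + 2) → Poly n l) q

theorem ev_sqSub {B : Type*} [CommRing B] (φ : MvPolynomial (Fin n) ℂ →+* B) (t : B)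
    (x : Fin l → B) (q : Poly n (l + 2)) : ev φ t x (sqSub q) =
      ev φ t (Fin.snoc (Fin.snoc x (-t) : Fin (l + 1) → B) t : Fin (l + 2) → B) q := by
  rw [sqSub, ev_ev, ev_tv]
  congr 2
  funext i
  refine Fin.lastCases ?_ (fun i => ?_) i
  · simp
  · refine Fin.lastCases ?_ (fun i => ?_) i <;> simp

variable {κ : Prop}

theorem Good.sqSub {q : Poly n (l + 2)} (hq : Good κ q) : Good κ (sqSub q) := by
  refine hq.subst (fun i => i.castSucc.castSucc)
    ((Fin.castSucc_injective _).comp (Fin.castSucc_injective _)) _ (fun i => by simp) fun j => ?_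
  refine Fin.lastCases (Or.inr ⟨Polynomial.X, by simp [tv], by rw [Fin.snoc_last]; exact sym_tv⟩)
    (fun j => ?_) j
  refine Fin.lastCases (Or.inr ⟨-Polynomial.X, by simp [tv], ?_⟩) (fun j => Or.inl ⟨j, rfl⟩) j
  rw [Fin.snoc_castSucc, Fin.snoc_last]
  exact sym_tv.neg

/-- Changing t to -t exchanges the last two arguments. The polynomial must be free of t itself,
hence the form `map Polynomial.C p`. -/
theorem Good.sqSub_odd {p : MvPolynomial (Fin (l + 2)) (MvPolynomial (Fin n) ℂ)}
    (hq : Good κ (map Polynomial.C p : Poly n (l + 2))) :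
    ev zc (-tv) X (Cycles.sqSub (map Polynomial.C p)) = -Cycles.sqSub (map Polynomial.C p) := by
  set q : Poly n (l + 2) := map Polynomial.C p with hqp
  have h := hq.ev_perm zc tv
    (Fin.snoc (Fin.snoc X (-tv) : Fin (l + 1) → Poly n l) tv : Fin (l + 2) → Poly n l)
    (Equiv.swap (Fin.last _) (Fin.last l).castSucc)
  rw [Equiv.Perm.sign_swap (Fin.castSucc_lt_last _).ne'] at h
  rw [ev_sqSub, Cycles.sqSub]
  rw [← one_mul (-_), ← neg_mul_comm]
  convert h using 1
  · rw [hqp, ev_map_C, ev_map_C]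
    congr 1
    funext i
    refine Fin.lastCases ?_ (fun i => ?_) i
    · simp
    · refine Fin.lastCases ?_ (fun i => ?_) i
      · simp
      · rw [Equiv.swap_apply_of_ne_of_ne (Fin.castSucc_lt_last _).ne (by
          intro h; exact (Fin.castSucc_lt_last i).ne (Fin.castSucc_injective _ h))]
        simp
  · simp

theorem natDegree_mul_neg_X_pow_le {A : Type*} [CommRing A] (a b : A) (i j : ℕ) :
    (Polynomial.C a * (Polynomial.C b * (-Polynomial.X) ^ i * Polynomial.X ^ j)).natDegree ≤
      i + j := by
  have : Polynomial.C a * (Polynomial.C b * (-Polynomial.X) ^ i * Polynomial.X ^ j) =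
      Polynomial.C (a * b * (-1) ^ i) * Polynomial.X ^ (i + j) := by
    rw [neg_pow (Polynomial.X : Polynomial A)]
    simp only [map_mul, map_pow, map_neg, map_one]
    ring
  rw [this]
  exact Polynomial.natDegree_C_mul_X_pow_le _ _

/-- Two arguments of degree at most n - 1 each give degree at most 2n - 2 in t. For n = 0 the degree
condition leaves only p = 0. -/
theorem coeff_sqSub {p : MvPolynomial (Fin (l + 2)) (MvPolynomial (Fin n) ℂ)}
    (hq : DegLT (map Polynomial.C p : Poly n (l + 2))) (m : Fin l →₀ ℕ) (k : ℕ) (hk : 2 * n ≤ k + 1) :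
    (coeff m (sqSub (map Polynomial.C p))).coeff k = 0 := by
  rw [← coeff_asPolyT]
  have hdeg : (asPolyT (sqSub (map Polynomial.C p) : Poly n l)).natDegree ≤ 2 * n - 2 := by
    have h0 := ev_map_C (asPolyT.comp zc) (asPolyT tv) (fun i => asPolyT
      ((Fin.snoc (Fin.snoc X (-tv) : Fin (l + 1) → Poly n l) tv : Fin (l + 2) → Poly n l) i)) p
    rw [sqSub, map_ev, h0, eval₂_eq']
    refine Polynomial.natDegree_sum_le_of_forall_le _ _ fun d hd => ?_
    have hd' : ∀ i, d i < n := hq d (by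
      rwa [support_map_of_injective _ Polynomial.C_injective])
    rw [Fin.prod_univ_castSucc, Fin.prod_univ_castSucc]
    simp only [Fin.snoc_castSucc, Fin.snoc_last]
    have h1 : asPolyT (tv : Poly n l) = Polynomial.X := by simp [asPolyT]
    have h2 : ∏ i : Fin l, asPolyT (X i : Poly n l) ^ d i.castSucc.castSucc =
        Polynomial.C (∏ i : Fin l, X i ^ d i.castSucc.castSucc) := by
      simp [asPolyT, map_prod]
    have h3 : ((asPolyT (n := n) (l := l)).comp zc) (coeff d p) = Polynomial.C (C (coeff d p)) := by
      simp [asPolyT]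
    rw [h2, h3, map_neg, h1]
    have e1 := hd' (Fin.last l).castSucc
    have e2 := hd' (Fin.last (l + 1))
    refine (natDegree_mul_neg_X_pow_le _ _ _ _).trans ?_
    omega
  rcases n.eq_zero_or_pos with rfl | hn
  · have hp : p = 0 := support_eq_empty.1 (Finset.eq_empty_of_forall_notMem fun d hd =>
      absurd (hq d (by rwa [support_map_of_injective _ Polynomial.C_injective]) 0) (by omega))
    simp [hp, sqSub]
  · rw [Polynomial.coeff_eq_zero_of_natDegree_lt (by omega), coeff_zero]

theorem TDegLT.rename {N : Poly n l} (h : TDegLT N) (σ : Equiv.Perm (Fin l)) :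
    TDegLT (rename σ N) := fun m k hk => by
  have : m = Finsupp.mapDomain σ (Finsupp.mapDomain σ.symm m) := by
    rw [← Finsupp.mapDomain_comp]; simp
  rw [this, coeff_rename_mapDomain _ σ.injective]
  exact h _ _ hk

theorem TDegLT.neg {N : Poly n l} (h : TDegLT N) : TDegLT (-N) := fun m k hk => by
  rw [coeff_neg, Polynomial.coeff_neg, h m k hk, neg_zero]

theorem TDegLT.ev_rename {N : Poly n l} (h : TDegLT N) (σ : Equiv.Perm (Fin n)) :
    TDegLT (ev ((zc (l := l)).comp (MvPolynomial.rename σ :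
      MvPolynomial (Fin n) ℂ →ₐ[ℂ] _).toRingHom) tv X N) := fun m k hk => by
  rw [coeff_ev_rename, Polynomial.coeff_map, h m k hk, map_zero]

theorem polyDiff_rename (N : Poly n l) (σ : Equiv.Perm (Fin l)) :
    polyDiff (rename σ N) = rename σ (polyDiff N) := by
  rw [rename_eq_ev σ (polyDiff N), ev_polyDiff, polyDiff, ev_rename, rename_eq_ev]

theorem polyDiff_neg (N : Poly n l) : polyDiff (-N) = -polyDiff N := by
  simp only [polyDiff, map_neg]
  ring

theorem polyDiff_ev_rename (N : Poly n l) (σ : Equiv.Perm (Fin n)) :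
    polyDiff (ev ((zc (l := l)).comp (rename σ : MvPolynomial (Fin n) ℂ →ₐ[ℂ] _).toRingHom) tv X N) =
      ev ((zc (l := l)).comp (rename σ : MvPolynomial (Fin n) ℂ →ₐ[ℂ] _).toRingHom) tv X
        (polyDiff N) := by
  rw [ev_polyDiff, th_comp_rename, th_comp_rename, polyDiff, map_ev, ← RingHom.comp_assoc,
    ev_comp_zc]
  simp

/-- The solution of the difference equation vanishes where it has too many zeros. -/
theorem TDegLT.ev_eq_zero {N : Poly n l} (h : TDegLT N) (w : Fin n → ℂ)
    (hinj : Function.Injective w) (x : Fin l → ℂ) (h0 : ∀ j, ev (eval w) (w j)⁻¹ x N = 0) (τ : ℂ) :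
    ev (eval w) τ x N = 0 := by
  set f : Polynomial ℂ := (asPolyT N).map (eval₂Hom (eval w) x) with hf
  have key : ∀ τ, ev (eval w) τ x N = f.eval τ := fun τ => by
    rw [hf, Polynomial.eval_map, eval₂_asPolyT]
  have : f = 0 := by
    refine Polynomial.eq_zero_of_degree_lt_of_eval_index_eq_zero (s := Finset.univ)
      (v := fun a : Fin n => (w a)⁻¹) (fun a _ b _ hab => hinj (inv_injective hab)) ?_
      fun a _ => by rw [← key, h0]
    rw [Finset.card_univ, Fintype.card_fin, Polynomial.degree_lt_iff_coeff_zero]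
    intro k hk
    rw [hf, Polynomial.coeff_map]
    have : (asPolyT N).coeff k = 0 := by
      ext1 m
      rw [coeff_asPolyT, h m k hk, coeff_zero]
    rw [this, map_zero]
  rw [key, this, Polynomial.eval_zero]

theorem th_eval_ne_zero {w : Fin n → ℂ} (r : ℂ) (h : ∀ j, w j * r ≠ 1) :
    th (eval w) r ≠ 0 := by
  refine Finset.prod_ne_zero_iff.2 fun j _ h' => h j ?_
  rw [eval_X] at h'
  exact (sub_eq_zero.1 h').symm

/-- The analogue of `ev_eq_zero_of_cofinite` for one z_f: it allows a point to be moved off the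
hyperplane z_c + z_d = 0 in order to divide by Θ(-1/z_c). -/
theorem ev_eq_zero_of_cofinite_update {N : Poly n l} (w : Fin n → ℂ) (f : Fin n) (t : ℂ)
    (x : Fin l → ℂ) (s : Finset ℂ)
    (h : ∀ ζ ∉ s, ev (eval (Function.update w f ζ)) t x N = 0) : ev (eval w) t x N = 0 := by
  set φ : MvPolynomial (Fin n) ℂ →+* Polynomial ℂ :=
    eval₂Hom Polynomial.C (Function.update (fun j => Polynomial.C (w j)) f Polynomial.X) with hφ
  have key : ∀ ζ, ev (eval (Function.update w f ζ)) t x N =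
      (ev φ (Polynomial.C t) (fun i => Polynomial.C (x i)) N).eval ζ := by
    intro ζ
    rw [← Polynomial.coe_evalRingHom, map_ev]
    congr 2
    · refine MvPolynomial.ringHom_ext (fun r => by simp [hφ]) fun j => ?_
      by_cases hj : j = f
      · subst hj; simp [hφ]
      · simp [hφ, hj]
    · simp
    · funext i; simp
  have h0 : ev φ (Polynomial.C t) (fun i => Polynomial.C (x i)) N = 0 := by
    refine Polynomial.eq_zero_of_infinite_isRoot _
      (Set.Infinite.mono ?_ s.finite_toSet.infinite_compl)
    intro ζ hζ
    rw [Set.mem_ofPred_eq, Polynomial.IsRoot, ← key]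
    exact h ζ (by simpa using hζ)
  have := key (w f)
  rwa [Function.update_eq_self, h0, Polynomial.eval_zero] at this

/-- The vanishing of the solution at a generic point of the locus. -/
theorem Good.van_of_generic {p : MvPolynomial (Fin (l + 2)) (MvPolynomial (Fin n) ℂ)}
    (hq : Good κ (map Polynomial.C p : Poly n (l + 2))) {N : Poly n l} (hN : TDegLT N)
    (hd : polyDiff N = Cycles.sqSub (map Polynomial.C p)) {x : Fin l → ℂ} {w : Fin n → ℂ}
    (hw : ∀ j, w j ≠ 0) {c d : Fin n} (hcd : c ≠ d) (hwcd : w d = -w c) {a : Fin l}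
    (ha : x a * w c = 1) (hκ : κ → ∃ b, x b * w c = -1)
    (hgen : ∀ j k, j ≠ k → w j = w k ∨ w j = - w k → (j = c ∨ j = d) ∧ (k = c ∨ k = d)) (τ : ℂ) :
    ev (eval w) τ x N = 0 := by
  have hinj : Function.Injective w := by
    intro j k hjk
    by_contra hne
    obtain ⟨hj, hk⟩ := hgen j k hne (Or.inl hjk)
    have h0 : w c ≠ -w c := fun h => hw c (self_eq_neg.1 h)
    rcases hj with rfl | rfl <;> rcases hk with rfl | rfl
    · exact hne rfl
    · exact h0 (hjk.trans hwcd)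
    · exact h0 (hjk.symm.trans hwcd)
    · exact hne rfl
  have hid : ∀ (w : Fin n → ℂ) (r : ℂ), ev (eval w) (-r) x N * th (eval w) r -
      ev (eval w) r x N * th (eval w) (-r) =
        ev (eval w) r (Fin.snoc (Fin.snoc x (-r) : Fin (l + 1) → ℂ) r : Fin (l + 2) → ℂ)
          (map Polynomial.C p) := by
    intro w r
    rw [← ev_polyDiff, hd, ev_sqSub]
  -- The points 1/w_c and 1/w_d are delicate since Θ(-1/w_e) = 0 there. Moving w_f to a generic ζ
  -- makes this factor non-zero, while s(1/w_e) = 0 persists by skew-symmetry alone: X_a coincides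
  -- with one of the arguments ∓1/w_e.
  have hpair : ∀ e f : Fin n, e ≠ f → x a = (w e)⁻¹ ∨ x a = -(w e)⁻¹ →
      (∀ k, k ≠ e → w k = -w e → k = f) → ev (eval w) (w e)⁻¹ x N = 0 := by
    intro e f hef hxa hu
    refine ev_eq_zero_of_cofinite_update w f _ x {-w e} fun ζ hζ => ?_
    rw [Finset.mem_singleton] at hζ
    set w' := Function.update w f ζ with hw'
    have hwe : w' e = w e := by simp [hw', hef]
    have h1 := hid w' (w e)⁻¹
    have hs : ev (eval w') (w e)⁻¹ (Fin.snoc (Fin.snoc x (-(w e)⁻¹) : Fin (l + 1) → ℂ) (w e)⁻¹ :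
        Fin (l + 2) → ℂ) (map Polynomial.C p) = 0 := by
      rcases hxa with h | h
      · exact hq.ev_eq_zero _ _ _ (i := a.castSucc.castSucc) (j := Fin.last _)
          (Fin.castSucc_lt_last _).ne (by simpa using h)
      · exact hq.ev_eq_zero _ _ _ (i := a.castSucc.castSucc) (j := (Fin.last l).castSucc)
          ((Fin.castSucc_injective _).ne (Fin.castSucc_lt_last _).ne) (by simpa using h)
    rw [hs, th_eq_zero_of_mul_eq_one _ _ e (by simp [hwe, hw]), mul_zero, zero_sub] at h1
    refine (mul_eq_zero.1 (neg_eq_zero.1 h1)).resolve_right (th_eval_ne_zero _ fun k hk => ?_)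
    have hk' : w' k = -w e := by
      have := hw e
      field_simp at hk
      linear_combination -hk
    by_cases hkf : k = f
    · subst hkf
      exact hζ (by rw [← hk', hw', Function.update_self])
    · rw [hw', Function.update_of_ne hkf] at hk'
      refine hkf (hu k ?_ hk')
      rintro rfl
      exact hw k (self_eq_neg.1 hk')
  refine hN.ev_eq_zero w hinj x (fun j => ?_) τ
  by_cases hjc : j = c
  · subst hjc
    refine hpair j d hcd (Or.inl (eq_inv_of_mul_eq_one_left ha)) fun k hk h => ?_
    rcases (hgen k j hk (Or.inr h)).1 with h | h
    · exact absurd h hk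
    · exact h
  · by_cases hjd : j = d
    · subst hjd
      refine hpair j c hcd.symm (Or.inr ?_) fun k hk h => ?_
      · rw [hwcd, inv_neg, neg_neg]; exact eq_inv_of_mul_eq_one_left ha
      · rcases (hgen k j hk (Or.inr h)).1 with h | h
        · exact h
        · exact absurd h hk
    -- At the other points the special variables are still among the first l arguments, so s
    -- vanishes because P does on the locus, and Θ(-1/w_j) ≠ 0 by genericity.
    · have h1 := hid w (w j)⁻¹
      have hs : ev (eval w) (w j)⁻¹ (Fin.snoc (Fin.snoc x (-(w j)⁻¹) : Fin (l + 1) → ℂ) (w j)⁻¹ :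
          Fin (l + 2) → ℂ) (map Polynomial.C p) = 0 := by
        refine hq.van _ _ _ hw ⟨c, d, hcd, hwcd, ⟨a.castSucc.castSucc, by simpa using ha⟩, fun k => ?_⟩
        obtain ⟨b, hb⟩ := hκ k
        exact ⟨b.castSucc.castSucc, by simpa using hb⟩
      rw [hs, th_eq_zero_of_mul_eq_one _ _ j (by simp [hw]), mul_zero, zero_sub] at h1
      refine (mul_eq_zero.1 (neg_eq_zero.1 h1)).resolve_right (th_eval_ne_zero _ fun k hk => ?_)
      have hk' : w k = -w j := by
        have := hw j
        field_simp at hk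
        linear_combination -hk
      have hkj : k ≠ j := by
        rintro rfl
        exact hw k (self_eq_neg.1 hk')
      rcases (hgen k j hkj (Or.inr hk')).2 with h | h
      · exact hjc h
      · exact hjd h

/-- Vanishing of P on the locus makes the equation solvable: the arguments -1/z_a and 1/z_a form a
special pair when z_b = -z_a, which suffices for either value of κ. Skewness and symmetry come from
uniqueness, degrees from the support, and vanishing from the generic case by density in the
remaining z_j. -/
theorem Good.exists_polyDiff {p : MvPolynomial (Fin (l + 2)) (MvPolynomial (Fin n) ℂ)}
    (hq : Good κ (map Polynomial.C p : Poly n (l + 2))) :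
    ∃ N : Poly n l, Good κ N ∧ TDegLT N ∧ polyDiff N = Cycles.sqSub (map Polynomial.C p) := by
  obtain ⟨N, hN, hd, hs⟩ := exists_polyDiff_eq _ (coeff_sqSub hq.deg) hq.sqSub_odd
    fun a b hab w hw hwab x => by
    rw [ev_sqSub]
    refine hq.van _ _ _ hw ⟨a, b, hab, hwab, ⟨Fin.last _, by simp [hw]⟩,
      fun _ => ⟨(Fin.last l).castSucc, by simp [hw]⟩⟩
  refine ⟨N, ⟨?_, ?_, ?_, ?_⟩, hN, hd⟩
  · refine skew_of_swap fun i j hij => polyDiff_injective (hN.rename _) hN.neg ?_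
    rw [polyDiff_rename, polyDiff_neg, hd, hq.sqSub.skew, Equiv.Perm.sign_swap hij]
    simp
  · exact fun m hm => hq.sqSub.deg m (by
      rw [mem_support_iff] at hm ⊢
      exact fun h => hm (hs m h))
  · refine fun σ => polyDiff_injective (hN.ev_rename σ) hN ?_
    rw [polyDiff_ev_rename, hd, hq.sqSub.sym σ]
  · rintro τ x w hw ⟨c, d, hcd, hwcd, ⟨a, ha⟩, hκ⟩
    -- The pair z_c = w_c, z_d = -w_c is fixed and the other z_j stay free; r is then a polynomial
    -- to be shown zero.
    set φ : MvPolynomial (Fin n) ℂ →+* MvPolynomial (Fin n) ℂ :=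
      eval₂Hom C (Function.update (Function.update X c (C (w c))) d (C (-w c))) with hφ
    set r := ev φ (C τ) (fun i => C (x i)) N with hr
    have key : ∀ v, eval v r =
        ev (eval (Function.update (Function.update v c (w c)) d (-w c))) τ x N := by
      intro v
      rw [hr, map_ev]
      congr 2
      · refine MvPolynomial.ringHom_ext (fun r => by simp [hφ]) fun j => ?_
        by_cases hj : j = d
        · subst hj; simp [hφ]
        · by_cases hj' : j = c
          · subst hj'; simp [hφ, hj]
          · simp [hφ, hj, hj']
      · simp
      · funext i; simp
    -- Where B is non-zero, the free coordinates are non-zero, with squares distinct from each other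
    -- and from w_c², so that `Good.van_of_generic` applies and r B = 0.
    set B : MvPolynomial (Fin n) ℂ := (∏ j, X j) * (∏ j, (X j ^ 2 - C (w c ^ 2))) *
      ∏ j, ∏ k ∈ Finset.univ.erase j, (X j ^ 2 - X k ^ 2) with hB
    have hB0 : B ≠ 0 := by
      refine mul_ne_zero (mul_ne_zero (zProd_ne_zero n) ?_) ?_
      · refine Finset.prod_ne_zero_iff.2 fun j _ h => ?_
        have := congrArg (eval fun _ => (0 : ℂ)) h
        simp [hw] at this
      · exact Finset.prod_ne_zero_iff.2 fun j _ => vdm_ne_zero j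
    have hrB : r * B = 0 := by
      refine MvPolynomial.funext fun v => ?_
      rw [map_mul, map_zero, mul_eq_zero, or_iff_not_imp_right]
      intro hBv
      rw [key]
      rw [hB, map_mul, map_mul, map_prod, map_prod, map_prod] at hBv
      have hv1 : ∀ j, v j ≠ 0 := fun j => by
        have := Finset.prod_ne_zero_iff.1 (left_ne_zero_of_mul (left_ne_zero_of_mul hBv)) j
          (Finset.mem_univ j)
        simpa using this
      have hv2 : ∀ j, v j ^ 2 ≠ w c ^ 2 := fun j => by
        have := Finset.prod_ne_zero_iff.1 (right_ne_zero_of_mul (left_ne_zero_of_mul hBv)) j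
          (Finset.mem_univ j)
        rw [map_sub, map_pow, eval_X, eval_C] at this
        exact sub_ne_zero.1 this
      have hv3 : ∀ j k, j ≠ k → v j ^ 2 ≠ v k ^ 2 := fun j k hjk => by
        have := Finset.prod_ne_zero_iff.1 (right_ne_zero_of_mul hBv) j (Finset.mem_univ j)
        rw [map_prod] at this
        have := Finset.prod_ne_zero_iff.1 this k (by simp [hjk.symm])
        rw [map_sub, map_pow, map_pow, eval_X, eval_X] at this
        exact sub_ne_zero.1 this
      set v' := Function.update (Function.update v c (w c)) d (-w c) with hv'
      have hvd : v' d = -w c := by simp [hv']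
      have hvc : v' c = w c := by simp [hv', hcd]
      have hvo : ∀ j, j ≠ c → j ≠ d → v' j = v j := fun j hc hd => by simp [hv', hc, hd]
      have hsq : ∀ j, j = c ∨ j = d → v' j ^ 2 = w c ^ 2 := by
        rintro j (rfl | rfl)
        · rw [hvc]
        · rw [hvd, neg_sq]
      refine hq.van_of_generic hN hd (c := c) (d := d) (a := a) ?_ hcd (by rw [hvd, hvc])
        (by rw [hvc, ha]) (by rw [hvc]; exact hκ) ?_ τ
      · intro j
        by_cases hjc : j = c
        · rw [hjc, hvc]; exact hw c
        · by_cases hjd : j = d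
          · rw [hjd, hvd]; exact neg_ne_zero.2 (hw c)
          · rw [hvo j hjc hjd]; exact hv1 j
      · intro j k hjk h
        have h2 : v' j ^ 2 = v' k ^ 2 := sq_eq_sq_iff_eq_or_eq_neg.2 h
        by_cases hj : j = c ∨ j = d
        · refine ⟨hj, ?_⟩
          by_contra hk
          rw [hsq j hj, hvo k (fun h => hk (Or.inl h)) (fun h => hk (Or.inr h))] at h2
          exact hv2 k h2.symm
        · exfalso
          rw [hvo j (fun h => hj (Or.inl h)) (fun h => hj (Or.inr h))] at h2
          by_cases hk : k = c ∨ k = d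
          · rw [hsq k hk] at h2
            exact hv2 j h2
          · rw [hvo k (fun h => hk (Or.inl h)) (fun h => hk (Or.inr h))] at h2
            exact hv3 j k hjk h2
    have h0 : r = 0 := (mul_eq_zero.1 hrB).resolve_right hB0
    have h1 := key w
    rw [h0, map_zero, Function.update_eq_self, ← hwcd, Function.update_eq_self] at h1
    exact h1.symm

end PolyDifference

end Cycles

end

noncomputable section
namespace Cycles
open MvPolynomial

/-! ### The sum of residues as N(t)/Θ(t) -/

section Residue

variable {n l : ℕ}

/-- The residue at a simple pole: d is a unit power series, so the coefficient of ε⁻¹ in a/(ε d) is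
a(0)/d(0). -/
theorem residue_eq {E : Type} [Field E] (f : LaurentSeries E → LaurentSeries E) (c : E)
    (a d : PowerSeries E) (hd : PowerSeries.constantCoeff d ≠ 0)
    (hf : f (HahnSeries.C c + HahnSeries.single 1 1) =
      HahnSeries.ofPowerSeries ℤ E a / HahnSeries.ofPowerSeries ℤ E (PowerSeries.X * d)) :
    residue f c = PowerSeries.constantCoeff a / PowerSeries.constantCoeff d := by
  have hd0 : d ≠ 0 := fun h => hd (by rw [h, map_zero])
  have hinj := HahnSeries.ofPowerSeries_injective (Γ := ℤ) (R := E)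
  have hd1 : HahnSeries.ofPowerSeries ℤ E d ≠ 0 := fun h => hd0 (hinj (by rw [h, map_zero]))
  have h1 : HahnSeries.ofPowerSeries ℤ E a / HahnSeries.ofPowerSeries ℤ E (PowerSeries.X * d) =
      HahnSeries.single (-1) 1 * HahnSeries.ofPowerSeries ℤ E (a * d⁻¹) := by
    rw [map_mul, HahnSeries.ofPowerSeries_X, map_mul]
    have h2 : HahnSeries.ofPowerSeries ℤ E d * HahnSeries.ofPowerSeries ℤ E d⁻¹ = 1 := by
      rw [← map_mul, PowerSeries.mul_inv_cancel d hd, map_one]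
    have h3 : (HahnSeries.single (-1) 1 * HahnSeries.single 1 1 : LaurentSeries E) = 1 := by
      rw [HahnSeries.single_mul_single]; simp
    have h4 : (HahnSeries.single 1 1 : LaurentSeries E) ≠ 0 := by simp
    rw [div_eq_iff (mul_ne_zero h4 hd1)]
    linear_combination (-HahnSeries.ofPowerSeries ℤ E a) *
      (HahnSeries.ofPowerSeries ℤ E d * HahnSeries.ofPowerSeries ℤ E d⁻¹) * h3 -
      HahnSeries.ofPowerSeries ℤ E a * h2
  have h5 := HahnSeries.ofPowerSeries_apply_coeff (Γ := ℤ) (a * d⁻¹) 0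
  rw [Nat.cast_zero] at h5
  rw [residue, hf, h1, mul_comm, HahnSeries.coeff_mul_single, sub_self, h5,
    PowerSeries.coeff_zero_eq_constantCoeff_apply, map_mul, PowerSeries.constantCoeff_inv, mul_one,
    div_eq_mul_inv]

theorem z_algebraMap_ne_zero {E : Type} [Field E] [Algebra (K n) E] (a : Fin n) :
    algebraMap (K n) E (z a) ≠ 0 := by
  rw [Ne, map_eq_zero]; exact z_ne_zero a

/-- Lagrange interpolation at the points `z_a⁻¹`. -/
theorem eval_eq_sum_inv_z {E : Type} [Field E] [Algebra (K n) E] {f : Polynomial E}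
    (hf : f.degree < n) (t : E) (ht : th ((algebraMap (K n) E).comp (toK n)) t ≠ 0) :
    (th ((algebraMap (K n) E).comp (toK n)) t)⁻¹ * f.eval t =
      ∑ a : Fin n, f.eval (algebraMap (K n) E (z a)⁻¹) /
        (algebraMap (K n) E (z a) * (∏ b ∈ Finset.univ.erase a,
          (1 - algebraMap (K n) E (z b) * algebraMap (K n) E (z a)⁻¹)) *
            (algebraMap (K n) E (z a)⁻¹ - t)) := by
  set y : Fin n → E := fun a => algebraMap (K n) E (z a) with hy
  have hyi : ∀ a, algebraMap (K n) E (z a)⁻¹ = (y a)⁻¹ := fun a => map_inv₀ _ _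
  have hinj : Function.Injective y := fun a b h => z_injective ((algebraMap (K n) E).injective h)
  have hy0 : ∀ a, y a ≠ 0 := z_algebraMap_ne_zero
  simp only [hyi]
  change (∏ j, (1 - y j * t))⁻¹ * _ = ∑ a, f.eval (y a)⁻¹ /
    (y a * (∏ b ∈ Finset.univ.erase a, (1 - y b * (y a)⁻¹)) * ((y a)⁻¹ - t))
  change (∏ j, (1 - y j * t)) ≠ 0 at ht
  have hne : ∀ a b : Fin n, b ≠ a → 1 - y b * (y a)⁻¹ ≠ 0 := fun a b hab h => hab (hinj (by
    have := hy0 a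
    field_simp at h
    linear_combination -h))
  set g : Polynomial E := ∑ a, Polynomial.C (f.eval (y a)⁻¹ /
    ∏ b ∈ Finset.univ.erase a, (1 - y b * (y a)⁻¹)) *
      ∏ b ∈ Finset.univ.erase a, (1 - Polynomial.C (y b) * Polynomial.X) with hg
  have hfg : f = g := by
    rw [← sub_eq_zero]
    refine Polynomial.eq_zero_of_degree_lt_of_eval_index_eq_zero (s := Finset.univ)
      (v := fun a : Fin n => (y a)⁻¹) (fun a _ b _ h => hinj (inv_injective h)) ?_ fun a _ => ?_
    · rw [Finset.card_univ, Fintype.card_fin]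
      refine (Polynomial.degree_sub_le _ _).trans_lt (max_lt hf ?_)
      rw [hg, ← Polynomial.mem_degreeLT]
      refine Submodule.sum_mem _ fun a _ => ?_
      rw [← Polynomial.smul_eq_C_mul]
      exact Submodule.smul_mem _ _ (Polynomial.mem_degreeLT.2 (degree_prod_erase y a))
    · rw [Polynomial.eval_sub, hg, Polynomial.eval_finsetSum, Finset.sum_eq_single a]
      · rw [Polynomial.eval_mul, Polynomial.eval_C, Polynomial.eval_prod]
        simp only [Polynomial.eval_sub, Polynomial.eval_one, Polynomial.eval_mul, Polynomial.eval_C,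
          Polynomial.eval_X]
        rw [div_mul_cancel₀, sub_self]
        exact Finset.prod_ne_zero_iff.2 fun b hb => hne a b (Finset.ne_of_mem_erase hb)
      · intro b _ hb
        have : ∏ c ∈ Finset.univ.erase b,
            Polynomial.eval (y a)⁻¹ (1 - Polynomial.C (y c) * Polynomial.X) = 0 := by
          refine Finset.prod_eq_zero (i := a) (by simp [hb.symm]) ?_
          simp [hy0]
        rw [Polynomial.eval_mul, Polynomial.eval_prod, this, mul_zero]
      · simp
  have : f.eval t = ∑ a, (f.eval (y a)⁻¹ / ∏ b ∈ Finset.univ.erase a, (1 - y b * (y a)⁻¹)) *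
      ∏ b ∈ Finset.univ.erase a, (1 - y b * t) := by
    conv_lhs => rw [hfg, hg]
    simp [Polynomial.eval_finsetSum, Polynomial.eval_prod]
  rw [this, Finset.mul_sum]
  refine Finset.sum_congr rfl fun a _ => ?_
  have h1 := Finset.mul_prod_erase Finset.univ (fun j => 1 - y j * t) (Finset.mem_univ a)
  have h2 : y a * (∏ b ∈ Finset.univ.erase a, (1 - y b * (y a)⁻¹)) * ((y a)⁻¹ - t) =
      (∏ b ∈ Finset.univ.erase a, (1 - y b * (y a)⁻¹)) * (1 - y a * t) := by
    have := hy0 a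
    field_simp
  rw [h2]
  rw [← h1] at ht ⊢
  have h3 := left_ne_zero_of_mul ht
  have h4 := right_ne_zero_of_mul ht
  have h5 : ∏ b ∈ Finset.univ.erase a, (1 - y b * (y a)⁻¹) ≠ 0 :=
    Finset.prod_ne_zero_iff.2 fun b hb => hne a b (Finset.ne_of_mem_erase hb)
  generalize (∏ b ∈ Finset.univ.erase a, (1 - y b * (y a)⁻¹)) = e1 at *
  generalize (∏ b ∈ Finset.univ.erase a, (1 - y b * t)) = e2 at *
  field_simp

/-- At u = 1/z_a the difference equation reads s(u) = -N(u)Θ(-u), so the factor Θ(-u) of the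
denominator cancels in the residue. What remains is the partial fraction expansion of N(t)/Θ(t),
where deg N < n leaves no polynomial part. -/
theorem formXpSq_eq {E : Type} [Field E] [Algebra (K n) E] {P : MvPolynomial (Fin (l + 2)) (K n)}
    {p : MvPolynomial (Fin (l + 2)) (MvPolynomial (Fin n) ℂ)} (hp : map (toK n) p = P)
    {N : Poly n l} (hN : TDegLT N) (hd : polyDiff N = sqSub (map Polynomial.C p)) (t : E)
    (x : Fin l → E) (ht : th ((algebraMap (K n) E).comp (toK n)) t ≠ 0) :
    formXpSq P t x = (th ((algebraMap (K n) E).comp (toK n)) t)⁻¹ *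
      ev ((algebraMap (K n) E).comp (toK n)) t x N := by
  set φ := (algebraMap (K n) E).comp (toK n) with hφ
  set f : Polynomial E := (asPolyT N).map (eval₂Hom φ x) with hf
  have key : ∀ τ, ev φ τ x N = f.eval τ := fun τ => by
    rw [hf, Polynomial.eval_map, eval₂_asPolyT]
  have hfd : f.degree < n := by
    rw [Polynomial.degree_lt_iff_coeff_zero]
    intro k hk
    rw [hf, Polynomial.coeff_map]
    have : (asPolyT N).coeff k = 0 := by
      ext1 m
      rw [coeff_asPolyT, hN m k hk, coeff_zero]
    rw [this, map_zero]
  rw [key, eval_eq_sum_inv_z hfd t ht, formXpSq]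
  refine Finset.sum_congr rfl fun a _ => ?_
  set c := algebraMap (K n) E (z a)⁻¹ with hc
  have hza := z_algebraMap_ne_zero (E := E) a
  have hzc : algebraMap (K n) E (z a) * c = 1 := by
    rw [hc, ← map_mul, mul_inv_cancel₀ (z_ne_zero a), map_one]
  set U : PowerSeries E := PowerSeries.C c + PowerSeries.X with hU
  set ι := HahnSeries.ofPowerSeries ℤ E
  have hιC : ∀ r : E, ι (PowerSeries.C r) = HahnSeries.C r := fun r => HahnSeries.ofPowerSeries_C r
  have hu : (HahnSeries.C c + HahnSeries.single 1 1 : LaurentSeries E) = ι U := by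
    rw [hU, map_add, hιC, HahnSeries.ofPowerSeries_X]
  set ψ : MvPolynomial (Fin n) ℂ →+* PowerSeries E := PowerSeries.C.comp φ with hψ
  have hιψ : (algebraMap (K n) (LaurentSeries E)).comp (toK n) = ι.comp ψ := by
    refine RingHom.ext fun r => ?_
    simp only [hψ, hφ, RingHom.comp_apply, HahnSeries.algebraMap_apply']
    rw [PowerSeries.algebraMap_apply]
  set num : PowerSeries E := eval₂ ψ (Fin.snoc (Fin.snoc (fun i => PowerSeries.C (x i)) (-U) :
    Fin (l + 1) → PowerSeries E) U : Fin (l + 2) → PowerSeries E) p with hnum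
  -- The simple zero of Θ at 1/z_a is split off: with u = 1/z_a + ε, the a-th factor 1 - z_a u is
  -- -z_a ε.
  set H : PowerSeries E := PowerSeries.C (-algebraMap (K n) E (z a)) *
    ∏ b ∈ Finset.univ.erase a, (1 - PowerSeries.C (algebraMap (K n) E (z b)) * U) with hH
  have hthU : th ψ U = PowerSeries.X * H := by
    rw [th, ← Finset.mul_prod_erase _ _ (Finset.mem_univ a), hH, ← mul_assoc]
    congr 1
    have : ψ (X a) = PowerSeries.C (algebraMap (K n) E (z a)) := rfl
    rw [this, hU, mul_add, ← map_mul, hzc]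
    simp
    ring
  have hcU : PowerSeries.constantCoeff U = c := by simp [hU]
  have hth0 : ∀ V : PowerSeries E, PowerSeries.constantCoeff (th ψ V) =
      th φ (PowerSeries.constantCoeff V) := fun V => by
    rw [map_th]
    congr 1
  have hnum0 : PowerSeries.constantCoeff num = - (f.eval c * th φ (-c)) := by
    have h1 : PowerSeries.constantCoeff num =
        ev φ c x (sqSub (map Polynomial.C p)) := by
      rw [ev_sqSub, hnum, ← ev_map_C ψ U, map_ev, hcU]
      congr 2
      funext i
      refine Fin.lastCases ?_ (fun i => ?_) i
      · simp [hcU]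
      · refine Fin.lastCases ?_ (fun i => ?_) i <;> simp [hcU]
    have h2 : th φ c = 0 := th_eq_zero_of_mul_eq_one _ _ a (by rw [mul_comm]; exact hzc)
    rw [h1, ← hd, ev_polyDiff, h2, ← key]
    ring
  have hthc : th φ (-c) ≠ 0 := by
    have : th φ (-c) = algebraMap (K n) E (th (toK n) (-(z a)⁻¹)) := by
      rw [map_th, map_neg, hc]
    rw [this, Ne, map_eq_zero]
    exact th_neg_inv_z_ne_zero a
  have hct : c - t ≠ 0 := by
    intro h
    refine ht (th_eq_zero_of_mul_eq_one _ _ a ?_)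
    rw [← sub_eq_zero.1 h, mul_comm]; exact hzc
  have hH0 : PowerSeries.constantCoeff H = -algebraMap (K n) E (z a) *
      ∏ b ∈ Finset.univ.erase a, (1 - algebraMap (K n) E (z b) * c) := by
    rw [hH, map_mul, map_prod]
    simp [hcU]
  have hH1 : ∏ b ∈ Finset.univ.erase a, (1 - algebraMap (K n) E (z b) * c) ≠ 0 := by
    refine Finset.prod_ne_zero_iff.2 fun b hb h => Finset.ne_of_mem_erase hb ?_
    refine z_injective ((algebraMap (K n) E).injective ?_)
    linear_combination (-algebraMap (K n) E (z a)) * h - algebraMap (K n) E (z b) * hzc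
  have hcT : PowerSeries.constantCoeff (th ψ (-U) * H * (U - PowerSeries.C t)) =
      th φ (-c) * (-algebraMap (K n) E (z a) *
        ∏ b ∈ Finset.univ.erase a, (1 - algebraMap (K n) E (z b) * c)) * (c - t) := by
    rw [map_mul, map_mul, hth0, hH0, map_neg, hcU, map_sub, hcU]
    simp
  rw [residue_eq _ c num (th ψ (-U) * H * (U - PowerSeries.C t))]
  · rw [hcT, hnum0]
    field_simp
  · rw [hcT]
    exact mul_ne_zero (mul_ne_zero hthc (mul_ne_zero (neg_ne_zero.2 hza) hH1)) hct
  · have hT : ∀ V, Theta n (ι V) = ι (th ψ V) := fun V => by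
      rw [Theta_eq_th, hιψ, ← map_th]
    have hA : aeval (Fin.snoc (Fin.snoc (fun i => HahnSeries.C (x i)) (-ι U) :
        Fin (l + 1) → LaurentSeries E) (ι U) : Fin (l + 2) → LaurentSeries E) P = ι num := by
      rw [aeval_eq_ev_map_C (ι U) _ hp, hιψ, hnum, ← ev_map_C ψ U, map_ev]
      congr 2
      funext i
      refine Fin.lastCases ?_ (fun i => ?_) i
      · simp
      · refine Fin.lastCases ?_ (fun i => ?_) i <;> simp [hιC]
    simp only [hu]
    rw [hA, ← map_neg, hT, hT, hthU, ← hιC, ← map_sub]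
    simp only [map_mul]
    rw [div_mul_div_comm, mul_one]
    congr 1
    ring

variable {κ : Prop} {V : ∀ l, Set ((Fin l → ℂ) × (Fin n → ℂ))} {S : Subalgebra ℂ (K n)}

theorem formXpSq_hasCoeffs (hV : IsLocus κ V) {M : Submodule ℂ (A n l)}
    (hM : IsStable S M) (hle : Cyc (R n) V l ≤ M) {t : Ser n l} (ht : Adm S t)
    {P : A n (l + 2)} (hP : P ∈ Cyc (R n) V (l + 2)) :
    formXpSq P.1 t (xVar n l) ∈ HasCoeffs M := by
  obtain ⟨p, hp, hgood⟩ := exists_good hV hP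
  obtain ⟨N, hN, hNd, hd⟩ := hgood.exists_polyDiff
  rw [formXpSq_eq hp hNd hd t _ ht.th_ne]
  exact HasCoeffs.mul hM ht.inv_mem (hN.hasCoeffs hV hM hle ht.mem)

end Residue

end Cycles

end

noncomputable section
namespace Cycles
open MvPolynomial

/-! ## Homogeneity of the formulas -/

section Homogeneity

variable {n l : ℕ} {E : Type} [Field E] [Algebra (K n) E] (c : K n)

theorem wedge_smul {a b : ℕ} (f : (Fin a → E) → E) (g g' : (Fin b → E) → E) (r : E)
    (h : ∀ y, g' y = r * g y) (x : Fin (a + b) → E) : wedge f g' x = r * wedge f g x := by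
  rw [wedge, wedge, mul_left_comm, Finset.mul_sum (a := r)]
  congr 1
  refine Finset.sum_congr rfl fun σ _ => ?_
  rw [h]
  ring

theorem formXm_smul (P : MvPolynomial (Fin l) (K n)) (t : E) (x : Fin (1 + l) → E) :
    formXm (C c * P) t x = algebraMap (K n) E c * formXm P t x :=
  wedge_smul _ _ _ _ (fun y => by rw [map_mul, aeval_C]) x

theorem formXmSq_smul (P : MvPolynomial (Fin l) (K n)) (t : E) (x : Fin (2 + l) → E) :
    formXmSq (C c * P) t x = algebraMap (K n) E c * formXmSq P t x :=
  wedge_smul _ _ _ _ (fun y => by rw [map_mul, aeval_C]) x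

theorem formAPos_smul (P : MvPolynomial (Fin l) (K n)) (t : E) (x : Fin l → E) :
    formAPos (C c * P) t x = algebraMap (K n) E c * formAPos P t x := by
  simp only [formAPos, formAPos.br, map_mul, aeval_C]
  rw [mul_add, Finset.mul_sum]
  congr 1
  · ring
  · exact Finset.sum_congr rfl fun p _ => by ring

theorem formANeg_smul (P : MvPolynomial (Fin l) (K n)) (t : E) (x : Fin l → E) :
    formANeg (C c * P) t x = algebraMap (K n) E c * formANeg P t x := by
  simp only [formANeg, formANeg.br, map_mul, aeval_C]
  rw [mul_sub, Finset.mul_sum]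
  congr 1
  · ring
  · exact Finset.sum_congr rfl fun p _ => by ring

theorem formXp_smul (P : MvPolynomial (Fin (l + 1)) (K n)) (t : E) (x : Fin l → E) :
    formXp (C c * P) t x = algebraMap (K n) E c * formXp P t x := by
  simp only [formXp, map_mul, aeval_C]
  ring

theorem formXpSq_smul (P : MvPolynomial (Fin (l + 2)) (K n)) (t : E) (x : Fin l → E) :
    formXpSq (C c * P) t x = algebraMap (K n) E c * formXpSq P t x := by
  simp only [formXpSq, map_mul, aeval_C]
  rw [Finset.mul_sum]
  refine Finset.sum_congr rfl fun a _ => ?_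
  rw [residue, residue, HahnSeries.algebraMap_apply', PowerSeries.algebraMap_apply,
    HahnSeries.ofPowerSeries_C, mul_div_assoc, mul_assoc, HahnSeries.C_mul_eq_smul,
    HahnSeries.coeff_smul, smul_eq_mul]

end Homogeneity

/-! ## Stability under the formulas -/

section Stability

variable {n l : ℕ} {κ : Prop} {V : ∀ l, Set ((Fin l → ℂ) × (Fin n → ℂ))}

theorem inv_zProd_mul_mem {l' : ℕ} (N : ℕ) {f : Ser n l'}
    (hf : algebraMap (K n) (Ser n l') (toK n (zProd n) ^ N) * f ∈ HasCoeffs (Cyc (RHat n) V l')) :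
    f ∈ HasCoeffs (Cyc (RHat n) V l') := by
  have h := HasCoeffs.mul (isStable_cyc le_rfl)
    (algebraMap_mem_coeffIn (l := l') (inv_zProd_pow_mem n N)) hf
  rwa [← mul_assoc, ← map_mul, inv_mul_cancel₀ (pow_ne_zero _ (toK_zProd_ne_zero n)), map_one,
    one_mul] at h

/-- A homogeneous formula which maps cycles with polynomial coefficients to cycles with Laurent
polynomial coefficients is defined on all cycles with Laurent polynomial coefficients. -/
theorem hasCoeffs_of_smul {l' : ℕ} (f : MvPolynomial (Fin l) (K n) → Ser n l')
    (hf : ∀ c P, f (C c * P) = algebraMap (K n) (Ser n l') c * f P)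
    (h : ∀ P ∈ Cyc (R n) V l, f P.1 ∈ HasCoeffs (Cyc (RHat n) V l')) {P : A n l}
    (hP : P ∈ Cyc (RHat n) V l) : f P.1 ∈ HasCoeffs (Cyc (RHat n) V l') := by
  obtain ⟨N, hN⟩ := exists_smul_mem hP
  refine inv_zProd_mul_mem N ?_
  rw [← hf, ← coe_smul_A]
  exact h _ hN

theorem Adm.mono {S S' : Subalgebra ℂ (K n)} (h : S ≤ S') {t : Ser n l} (ht : Adm S t) :
    Adm S' t where
  mem := coeffIn_mono h ht.mem
  ne_zero := ht.ne_zero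
  th_ne := ht.th_ne
  th_neg_ne := ht.th_neg_ne
  inv_mem := coeffIn_mono h ht.inv_mem
  inv_neg_mem := coeffIn_mono h ht.inv_neg_mem
  x_ne := ht.x_ne
  x_ne_neg := ht.x_ne_neg

theorem adm_tZero' : Adm (RHat n) (tZero n l) := adm_tZero.mono (R_le_RHat n)

theorem incl_mem_total {M : ∀ l, Submodule ℂ (A n l)} {Q : A n l} (hQ : Q ∈ M l) :
    incl l Q ∈ total M := by
  intro k
  by_cases h : l = k
  · subst h
    rwa [incl, DirectSum.lof_eq_of, DirectSum.of_eq_same]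
  · rw [incl, DirectSum.lof_eq_of, DirectSum.of_eq_of_ne _ _ _ (Ne.symm h)]
    exact (M k).zero_mem

theorem formXm_laurent (hV : IsLocus κ V) {t : Ser n (1 + l)} (ht : Adm (RHat n) t)
    {P : A n l} (hP : P ∈ Cyc (RHat n) V l) :
    formXm P.1 t (xVar n (1 + l)) ∈ HasCoeffs (Cyc (RHat n) V (1 + l)) :=
  hasCoeffs_of_smul (fun P => formXm P t (xVar n (1 + l))) (fun c P => formXm_smul c P _ _)
    (fun _ hP => formXm_hasCoeffs hV (isStable_cyc le_rfl) cyc_mono ht hP) hP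

theorem formXmSq_laurent (hV : IsLocus κ V) {t : Ser n (2 + l)} (ht : Adm (RHat n) t)
    {P : A n l} (hP : P ∈ Cyc (RHat n) V l) :
    formXmSq P.1 t (xVar n (2 + l)) ∈ HasCoeffs (Cyc (RHat n) V (2 + l)) :=
  hasCoeffs_of_smul (fun P => formXmSq P t (xVar n (2 + l))) (fun c P => formXmSq_smul c P _ _)
    (fun _ hP => formXmSq_hasCoeffs hV (isStable_cyc le_rfl) cyc_mono ht hP) hP

theorem formAPos_laurent (hV : IsLocus κ V) {t : Ser n l} (ht : Adm (RHat n) t)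
    {P : A n l} (hP : P ∈ Cyc (RHat n) V l) :
    formAPos P.1 t (xVar n l) ∈ HasCoeffs (Cyc (RHat n) V l) :=
  hasCoeffs_of_smul (fun P => formAPos P t (xVar n l)) (fun c P => formAPos_smul c P _ _)
    (fun _ hP => formAPos_hasCoeffs hV (isStable_cyc le_rfl) cyc_mono ht hP) hP

theorem formANeg_laurent (hV : IsLocus κ V) {t : Ser n l} (ht : Adm (RHat n) t)
    {P : A n l} (hP : P ∈ Cyc (RHat n) V l) :
    formANeg P.1 t (xVar n l) ∈ HasCoeffs (Cyc (RHat n) V l) :=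
  hasCoeffs_of_smul (fun P => formANeg P t (xVar n l)) (fun c P => formANeg_smul c P _ _)
    (fun _ hP => formANeg_hasCoeffs hV (isStable_cyc le_rfl) cyc_mono ht hP) hP

theorem formXp_laurent (hV : IsLocus κ V) {t : Ser n l} (ht : Adm (RHat n) t)
    {P : A n (l + 1)} (hP : P ∈ Cyc (RHat n) V (l + 1)) :
    formXp P.1 t (xVar n l) ∈ HasCoeffs (Cyc (RHat n) V l) :=
  hasCoeffs_of_smul (fun P => formXp P t (xVar n l)) (fun c P => formXp_smul c P _ _)
    (fun _ hP => formXp_hasCoeffs hV (isStable_cyc le_rfl) cyc_mono ht hP) hP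

theorem formXpSq_laurent (hV : IsLocus κ V) {t : Ser n l} (ht : Adm (RHat n) t)
    {P : A n (l + 2)} (hP : P ∈ Cyc (RHat n) V (l + 2)) :
    formXpSq P.1 t (xVar n l) ∈ HasCoeffs (Cyc (RHat n) V l) :=
  hasCoeffs_of_smul (fun P => formXpSq P t (xVar n l)) (fun c P => formXpSq_smul c P _ _)
    (fun _ hP => formXpSq_hasCoeffs hV (isStable_cyc le_rfl) cyc_mono ht hP) hP

open Complex in
theorem neg_four_I_ne_zero : (-4 * I : ℂ) ≠ 0 := by simp

open Complex in
theorem stableUnderRule_laurent (hV : IsLocus κ V) :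
    StableUnderRule Set.univ (fun l => Cyc (RHat n) V l) := by
  have hI : ∀ k : ℤ, (I : ℂ) ^ k ≠ 0 := fun k => zpow_ne_zero _ I_ne_zero
  have hI1 : (I * (-1) ^ (n + 1) : ℂ) ≠ 0 := mul_ne_zero I_ne_zero (pow_ne_zero _ (by norm_num))
  intro g _ l P hP
  cases g with
  | t => exact ⟨_, (total _).smul_mem _ (incl_mem_total hP), Rule.t l P⟩
  | tInv => exact ⟨_, (total _).smul_mem _ (incl_mem_total hP), Rule.tInv l P⟩
  | xmPos j =>
    obtain ⟨Q, hQ, h⟩ := HasCoeffs.exists_isCoeff (formXm_laurent hV adm_tZero' hP) j one_ne_zero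
    exact ⟨_, incl_mem_total hQ, Rule.xmPos j l P Q h⟩
  | xmNonpos j =>
    obtain ⟨Q, hQ, h⟩ := HasCoeffs.exists_isCoeff (formXm_laurent hV adm_tInf hP) j
        (neg_ne_zero.2 one_ne_zero)
    exact ⟨_, incl_mem_total hQ, Rule.xmNonpos j l P Q h⟩
  | xmPosSq j =>
    obtain ⟨Q, hQ, h⟩ := HasCoeffs.exists_isCoeff (formXmSq_laurent hV adm_tZero' hP) j
        neg_four_I_ne_zero
    exact ⟨_, incl_mem_total hQ, Rule.xmPosSq j l P Q h⟩
  | xmNonposSq j =>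
    obtain ⟨Q, hQ, h⟩ := HasCoeffs.exists_isCoeff (formXmSq_laurent hV adm_tInf hP) j
        neg_four_I_ne_zero
    exact ⟨_, incl_mem_total hQ, Rule.xmNonposSq j l P Q h⟩
  | aPos j =>
    obtain ⟨Q, hQ, h⟩ := HasCoeffs.exists_isCoeff (formAPos_laurent hV adm_tZero' hP) j one_ne_zero
    exact ⟨_, incl_mem_total hQ, Rule.aPos j l P Q h⟩
  | aNeg j =>
    obtain ⟨Q, hQ, h⟩ := HasCoeffs.exists_isCoeff (formANeg_laurent hV adm_tInf hP) j one_ne_zero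
    exact ⟨_, incl_mem_total hQ, Rule.aNeg j l P Q h⟩
  | xpNonneg j =>
    rcases l with _ | l
    · exact ⟨0, (total _).zero_mem, Rule.xpNonneg_zero j P⟩
    obtain ⟨Q, hQ, h⟩ := HasCoeffs.exists_isCoeff (formXp_laurent hV adm_tZero' hP) j (hI _)
    exact ⟨_, incl_mem_total hQ, Rule.xpNonneg j l P Q h⟩
  | xpNeg j =>
    rcases l with _ | l
    · exact ⟨0, (total _).zero_mem, Rule.xpNeg_zero j P⟩
    obtain ⟨Q, hQ, h⟩ := HasCoeffs.exists_isCoeff (formXp_laurent hV adm_tInf hP) j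
        (neg_ne_zero.2 (hI _))
    exact ⟨_, incl_mem_total hQ, Rule.xpNeg j l P Q h⟩
  | xpNonnegSq j =>
    rcases l with _ | _ | l
    · exact ⟨0, (total _).zero_mem, Rule.xpNonnegSq_zero j P⟩
    · exact ⟨0, (total _).zero_mem, Rule.xpNonnegSq_one j P⟩
    obtain ⟨Q, hQ, h⟩ := HasCoeffs.exists_isCoeff (formXpSq_laurent hV adm_tZero' hP) j hI1
    exact ⟨_, incl_mem_total hQ, Rule.xpNonnegSq j l P Q h⟩
  | xpNegSq j =>
    rcases l with _ | _ | l
    · exact ⟨0, (total _).zero_mem, Rule.xpNegSq_zero j P⟩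
    · exact ⟨0, (total _).zero_mem, Rule.xpNegSq_one j P⟩
    obtain ⟨Q, hQ, h⟩ := HasCoeffs.exists_isCoeff (formXpSq_laurent hV adm_tInf hP) j hI1
    exact ⟨_, incl_mem_total hQ, Rule.xpNegSq j l P Q h⟩

theorem formXpSq_isCoeff (hV : IsLocus κ V) {P : A n (l + 2)} (hP : P ∈ Cyc (RHat n) V (l + 2))
    {t : Ser n l} (ht : Adm (RHat n) t) (j : ℕ) :
    ∃ Q ∈ Cyc (RHat n) V l, IsCoeff (formXpSq P.1 t (xVar n l)) j 1 Q :=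
  HasCoeffs.exists_isCoeff (formXpSq_laurent hV ht hP) j one_ne_zero

/-! ### The constant terms at `t = ∞` -/

/-- The polynomials in the `X_i` with coefficients in `R_n`, in `K_n(X_1, …, X_l)`. -/
def polyR (n l : ℕ) : Subring (KX n l) :=
  ((algebraMap (MvPolynomial (Fin l) (K n)) (KX n l)).comp (map (R n).val.toRingHom)).range

/-- The power series in `T` with constant term in `R_n[X_1, …, X_l]`. -/
def constR (n l : ℕ) : Subring (Ser n l) :=
  (Subring.comap (PowerSeries.constantCoeff (R := KX n l)) (polyR n l)).map
    (HahnSeries.ofPowerSeries ℤ (KX n l))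

theorem algebraMap_mem_polyR {s : K n} (hs : s ∈ R n) : algebraMap (K n) (KX n l) s ∈ polyR n l :=
  ⟨C ⟨s, hs⟩, by
    rw [RingHom.comp_apply, map_C, IsScalarTower.algebraMap_apply (K n) (MvPolynomial (Fin l) (K n))]
    rfl⟩

theorem algebraMap_mem_constR {s : K n} (hs : s ∈ R n) : algebraMap (K n) (Ser n l) s ∈ constR n l :=
  ⟨PowerSeries.C (algebraMap (K n) (KX n l) s), by
    simpa using algebraMap_mem_polyR hs, by
    rw [algebraMap_eq_C, HahnSeries.ofPowerSeries_C]⟩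

theorem xVar_mem_constR (i : Fin l) : xVar n l i ∈ constR n l :=
  ⟨PowerSeries.C (algebraMap (MvPolynomial (Fin l) (K n)) (KX n l) (X i)), ⟨X i, by simp⟩, by
    rw [HahnSeries.ofPowerSeries_C]; rfl⟩

theorem zSer_mem_constR {p : MvPolynomial (Fin n) ℂ} (hp : p.IsSymmetric) :
    zSer n l p ∈ constR n l := algebraMap_mem_constR ⟨p, hp, rfl⟩

theorem const_mem_constR (c : ℂ) :
    algebraMap (K n) (Ser n l) (algebraMap ℂ (K n) c) ∈ constR n l :=
  algebraMap_mem_constR ((R n).algebraMap_mem c)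

theorem inv_natCast_mem_constR (k : ℕ) : ((k : Ser n l))⁻¹ ∈ constR n l := by
  have := const_mem_constR (n := n) (l := l) ((k : ℂ)⁻¹)
  rwa [map_inv₀, map_inv₀, map_natCast, map_natCast] at this

theorem inv_mem_constR (g : PowerSeries (KX n l)) (h : PowerSeries.constantCoeff g ≠ 0)
    (h' : (PowerSeries.constantCoeff g)⁻¹ ∈ polyR n l) :
    (HahnSeries.ofPowerSeries ℤ (KX n l) g)⁻¹ ∈ constR n l := by
  refine ⟨g⁻¹, by simpa using h', ?_⟩
  refine eq_inv_of_mul_eq_one_left ?_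
  rw [← map_mul, PowerSeries.inv_mul_cancel g h, map_one]

/-- The coefficients of a symmetric q are symmetric polynomials in the z_j, that is, elements of
R_n; everything else lies in the subring by assumption. -/
theorem Sym.ev_mem_constR {k : ℕ} {q : Poly n k} (hq : Sym q) {s : Ser n l} (hs : s ∈ constR n l)
    {y : Fin k → Ser n l} (hy : ∀ i, y i ∈ constR n l) : Cycles.ev (zSer n l) s y q ∈ constR n l := by
  rw [Cycles.ev, coe_eval₂Hom, eval₂_eq']
  refine Subring.sum_mem _ fun m _ => Subring.mul_mem _ ?_
    (Subring.prod_mem _ fun i _ => Subring.pow_mem _ (hy i) _)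
  rw [Polynomial.coe_eval₂RingHom, Polynomial.eval₂_eq_sum_range]
  refine Subring.sum_mem _ fun j _ => Subring.mul_mem _ (zSer_mem_constR fun σ => ?_)
    (Subring.pow_mem _ hs _)
  have h := coeff_ev_rename σ q m
  rw [hq σ] at h
  conv_rhs => rw [h]
  rw [Polynomial.coeff_map]
  rfl

theorem Sym.th_mem_constR {x : Ser n l} (hx : x ∈ constR n l) : th (zSer n l) x ∈ constR n l := by
  have := (sym_th (n := n) (sym_X (0 : Fin 1))).ev_mem_constR (Subring.zero_mem (constR n l))
    (y := fun _ => x) fun _ => hx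
  rwa [ev_th, ev_X] at this

/-- With t = T⁻¹ this is 1/(xT - 1), of constant term -1. -/
theorem tInf_div_mem_constR (x : KX n l) :
    tInf n l / (HahnSeries.C x - tInf n l) ∈ constR n l := by
  have h := inv_mem_constR (n := n) (l := l) (PowerSeries.C x * PowerSeries.X - 1) (by simp)
    (by simp)
  rw [map_sub, map_mul, HahnSeries.ofPowerSeries_C, HahnSeries.ofPowerSeries_X,
    map_one (HahnSeries.ofPowerSeries ℤ (KX n l))] at h
  have h0 : tInf n l ≠ 0 := adm_tInf.ne_zero
  have h1 : (HahnSeries.single 1 1 : Ser n l) = (tInf n l)⁻¹ :=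
    eq_inv_of_mul_eq_one_left tZero_mul_tInf
  rw [h1] at h
  convert h using 1
  rw [← inv_div]
  congr 1
  field_simp

theorem tInf_div_xVar_sub_mem (i : Fin l) :
    tInf n l / (xVar n l i - tInf n l) ∈ constR n l := tInf_div_mem_constR _

theorem tInf_div_xVar_add_mem (i : Fin l) :
    tInf n l / (xVar n l i + tInf n l) ∈ constR n l := by
  have h := Subring.neg_mem _ (tInf_div_mem_constR (n := n)
    (-algebraMap (MvPolynomial (Fin l) (K n)) (KX n l) (X i)))
  convert h using 1
  rw [map_neg, ← div_neg]
  congr 1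
  rw [xVar]
  ring

/-- Each factor (1 + z_j t)/(1 - z_j t) tends to -1 at infinity. The inverse of Θ(t) alone would
involve 1/(z_1⋯z_n), but F and F^{(2)} contain t only through this quotient and t/(X ± t); this is
why x_0^- preserves polynomial coefficients. -/
theorem th_neg_div_th_mem_constR :
    th (zSer n l) (-tInf n l) / th (zSer n l) (tInf n l) ∈ constR n l := by
  rw [th, th, ← Finset.prod_div_distrib]
  refine Subring.prod_mem _ fun j _ => ?_
  set w : KX n l := algebraMap (K n) (KX n l) (z j) with hw
  have hw0 : w ≠ 0 := z_algebraMap_ne_zero j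
  have hz : zSer n l (X j) = HahnSeries.C w := algebraMap_eq_C _
  have h0 : tInf n l ≠ 0 := adm_tInf.ne_zero
  have h1 : HahnSeries.ofPowerSeries ℤ (KX n l) PowerSeries.X = (tInf n l)⁻¹ := by
    rw [HahnSeries.ofPowerSeries_X]; exact eq_inv_of_mul_eq_one_left tZero_mul_tInf
  have hne : 1 - zSer n l (X j) * tInf n l ≠ 0 :=
    Finset.prod_ne_zero_iff.1 (adm_tInf (n := n) (l := l)).th_ne j (Finset.mem_univ j)
  have h2 : HahnSeries.ofPowerSeries ℤ (KX n l) (PowerSeries.X - PowerSeries.C w)⁻¹ =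
      (HahnSeries.ofPowerSeries ℤ (KX n l) (PowerSeries.X - PowerSeries.C w))⁻¹ := by
    refine eq_inv_of_mul_eq_one_left ?_
    rw [← map_mul, PowerSeries.inv_mul_cancel _ (by simp [hw0]),
      map_one (HahnSeries.ofPowerSeries ℤ (KX n l))]
  refine ⟨(PowerSeries.X + PowerSeries.C w) * (PowerSeries.X - PowerSeries.C w)⁻¹, ?_, ?_⟩
  · have : PowerSeries.constantCoeff ((PowerSeries.X + PowerSeries.C w) *
        (PowerSeries.X - PowerSeries.C w)⁻¹) = -1 := by
      simp
      field_simp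
    change PowerSeries.constantCoeff (R := KX n l) _ ∈ polyR n l
    rw [this]
    exact Subring.neg_mem _ (Subring.one_mem _)
  · rw [map_mul, h2, map_add, map_sub, h1, HahnSeries.ofPowerSeries_C, ← hz, ← div_eq_mul_inv]
    have h3 : (tInf n l)⁻¹ - zSer n l (X j) = (tInf n l)⁻¹ * (1 - zSer n l (X j) * tInf n l) := by
      field_simp
    rw [h3]
    field_simp
    ring

theorem F_mem_constR (i : Fin l) : F n (tInf n l) (xVar n l i) ∈ constR n l := by
  have hθ := (adm_tInf (n := n) (l := l)).th_ne
  have h : F n (tInf n l) (xVar n l i) = ((2 : ℕ) : Ser n l)⁻¹ *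
      (tInf n l / (xVar n l i - tInf n l)) * (th (zSer n l) (-xVar n l i) -
        th (zSer n l) (-tInf n l) / th (zSer n l) (tInf n l) * th (zSer n l) (xVar n l i)) := by
    rw [F, Theta2, Theta_eq_th, Theta_eq_th, Theta_eq_th, Theta_eq_th, neg_neg, Nat.cast_ofNat]
    change _ / _ * (_ / th (zSer n l) (tInf n l)) = _
    change _ / _ * ((th (zSer n l) _ * th (zSer n l) _ - th (zSer n l) _ * th (zSer n l) _) / _) = _
    have h1 := (adm_tInf (n := n) (l := l)).x_ne i
    field_simp
  rw [h]
  exact Subring.mul_mem _ (Subring.mul_mem _ (inv_natCast_mem_constR 2) (tInf_div_xVar_sub_mem i))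
    (Subring.sub_mem _ (Sym.th_mem_constR (Subring.neg_mem _ (xVar_mem_constR i)))
      (Subring.mul_mem _ th_neg_div_th_mem_constR (Sym.th_mem_constR (xVar_mem_constR i))))

theorem sym_theta_quotient {h : Poly n 2} (hh : (X 0 + X 1) * h =
    th zc (X 0) * th zc (X 1) - th zc (-X 0) * th zc (-X 1)) : Sym h := by
  refine sym_of_mul (r := X 0 + X 1) ?_ ((sym_X 0).add (sym_X 1)) ?_
  · intro h
    have := congrArg (ev (eval 0) (0 : ℂ) (fun _ => 1)) h
    norm_num at this
  · rw [hh]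
    exact ((sym_th (sym_X 0)).mul (sym_th (sym_X 1))).sub
      ((sym_th (sym_X 0).neg).mul (sym_th (sym_X 1).neg))

theorem F2_eq_of_quotient {E : Type} [Field E] [Algebra (K n) E] (t x y Q : E) (hxy : x + y ≠ 0)
    (hQ : Theta2 n x y = (x + y) * Q) :
    F2 n t x y = t / (x + t) * (t / (y + t)) * (x - y) * Q
      + t / (x - t) * (t / (y + t)) * Theta n (-y) * (Theta2 n t (-x) / Theta n t)
      - t / (y - t) * (t / (x + t)) * Theta n (-x) * (Theta2 n t (-y) / Theta n t) := by
  have h : (x - y) / (x + y) * ((x + y) * Q) = (x - y) * Q := by field_simp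
  rw [F2, hQ]
  linear_combination t / (x + t) * (t / (y + t)) * h

/-- The denominator X + Y is not invertible in the ring of constant terms, so Θ(X,Y) has to be
divided by it as a polynomial beforehand. -/
theorem F2_mem_constR (i j : Fin l) :
    F2 n (tInf n l) (xVar n l i) (xVar n l j) ∈ constR n l := by
  obtain ⟨q, hq⟩ := exists_theta_quotient n
  have hx := fun i => xVar_mem_constR (n := n) (l := l) i
  have hθ := (adm_tInf (n := n) (l := l)).th_ne
  have hQ : ∃ Q ∈ constR n l, Theta2 n (xVar n l i) (xVar n l j) =
      (xVar n l i + xVar n l j) * Q := by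
    refine ⟨ev (zSer n l) 0 ![xVar n l i, xVar n l j] q, (sym_theta_quotient hq).ev_mem_constR
      (Subring.zero_mem _) (by
        intro k
        fin_cases k
        · exact hx i
        · exact hx j), ?_⟩
    have h1 := congrArg (ev (zSer n l) 0 ![xVar n l i, xVar n l j]) hq
    simp only [map_mul, map_add, map_sub, ev_X, ev_th, map_neg, Matrix.cons_val_zero,
      Matrix.cons_val_one] at h1
    rw [h1]
    rfl
  obtain ⟨Q, hQ, hQ'⟩ := hQ
  have hS : ∀ x ∈ constR n l, Theta2 n (tInf n l) (-x) / th (zSer n l) (tInf n l) ∈ constR n l := by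
    intro x hx
    have : Theta2 n (tInf n l) (-x) / th (zSer n l) (tInf n l) = th (zSer n l) (-x) -
        th (zSer n l) (-tInf n l) / th (zSer n l) (tInf n l) * th (zSer n l) x := by
      rw [Theta2, neg_neg]
      change (th (zSer n l) _ * th (zSer n l) _ - th (zSer n l) _ * th (zSer n l) _) / _ = _
      field_simp
    rw [this]
    exact Subring.sub_mem _ (Sym.th_mem_constR (Subring.neg_mem _ hx))
      (Subring.mul_mem _ th_neg_div_th_mem_constR (Sym.th_mem_constR hx))
  rw [F2_eq_of_quotient _ _ _ Q (xVar_add_ne_zero (n := n) i j) hQ']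
  have m1 := fun i => tInf_div_xVar_sub_mem (n := n) (l := l) i
  have m2 := fun i => tInf_div_xVar_add_mem (n := n) (l := l) i
  have m3 := fun i => Sym.th_mem_constR (Subring.neg_mem _ (hx i))
  exact Subring.sub_mem _ (Subring.add_mem _
    (Subring.mul_mem _ (Subring.mul_mem _ (Subring.mul_mem _ (m2 i) (m2 j))
      (Subring.sub_mem _ (hx i) (hx j))) hQ)
    (Subring.mul_mem _ (Subring.mul_mem _ (Subring.mul_mem _ (m1 i) (m2 j)) (m3 j)) (hS _ (hx i))))
    (Subring.mul_mem _ (Subring.mul_mem _ (Subring.mul_mem _ (m1 j) (m2 i)) (m3 i)) (hS _ (hx j)))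

theorem wedge_mem_constR {a b : ℕ} {f : (Fin a → Ser n l) → Ser n l}
    {g : (Fin b → Ser n l) → Ser n l} {x : Fin (a + b) → Ser n l}
    (hf : ∀ e : Fin a → Fin (a + b), f (fun i => x (e i)) ∈ constR n l)
    (hg : ∀ e : Fin b → Fin (a + b), g (fun i => x (e i)) ∈ constR n l) :
    wedge f g x ∈ constR n l := by
  rw [wedge, ← Nat.cast_mul]
  refine Subring.mul_mem _ (inv_natCast_mem_constR _) (Subring.sum_mem _ fun σ _ => ?_)
  exact Subring.mul_mem _ (intCast_mem _ _) (Subring.mul_mem _ (hf _) (hg _))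

theorem aeval_mem_constR {k : ℕ} {P : A n k} (hP : P ∈ withCoeffs (R n) k) {y : Fin k → Ser n l}
    (hy : ∀ i, y i ∈ constR n l) : aeval y (P : MvPolynomial (Fin k) (K n)) ∈ constR n l := by
  rw [aeval_def, eval₂_eq']
  exact Subring.sum_mem _ fun m _ => Subring.mul_mem _ (algebraMap_mem_constR (hP m))
    (Subring.prod_mem _ fun i _ => Subring.pow_mem _ (hy i) _)

theorem mem_withCoeffs_of_isCoeff {f : Ser n l} (hf : f ∈ constR n l) {c : ℂ} (hc : c ≠ 0)
    {Q : A n l} (hQ : IsCoeff f 0 c Q) : Q ∈ withCoeffs (R n) l := by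
  obtain ⟨g, ⟨p, hp⟩, rfl⟩ := hf
  have h0 := HahnSeries.ofPowerSeries_apply_coeff (Γ := ℤ) g 0
  rw [IsCoeff] at hQ
  rw [h0, PowerSeries.coeff_zero_eq_constantCoeff_apply, ← hp, RingHom.comp_apply] at hQ
  have h := algebraMap_KX_injective n l hQ
  intro m
  have h1 := congrArg (coeff m) h
  rw [coeff_map, coeff_smul] at h1
  have h2 : coeff m (Q : MvPolynomial (Fin l) (K n)) = c⁻¹ • ((R n).val.toRingHom (coeff m p)) := by
    rw [h1, inv_smul_smul₀ hc]
  rw [h2]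
  exact (R n).smul_mem (coeff m p).2 _

open Complex in
-- For the expansions at t = 0 everything takes place over R_n. For x_0^- and its divided square,
-- the Laurent case supplies the coefficient and its vanishing on the locus, and `constR` shows that
-- its coefficients are polynomials in the z_j.
theorem stableUnderRule_polynomial (hV : IsLocus κ V) :
    StableUnderRule {g | g.InBplus} (fun l => Cyc (R n) V l) := by
  have hS : ∀ l, IsStable (R n) (Cyc (R n) V l) := fun l => isStable_cyc (R_le_RHat n)
  have hI : ∀ k : ℤ, (I : ℂ) ^ k ≠ 0 := fun k => zpow_ne_zero _ I_ne_zero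
  have hI1 : (I * (-1) ^ (n + 1) : ℂ) ≠ 0 := mul_ne_zero I_ne_zero (pow_ne_zero _ (by norm_num))
  intro g hg l P hP
  cases hg with
  | t => exact ⟨_, (total _).smul_mem _ (incl_mem_total hP), Rule.t l P⟩
  | tInv => exact ⟨_, (total _).smul_mem _ (incl_mem_total hP), Rule.tInv l P⟩
  | xmPos j =>
    obtain ⟨Q, hQ, h⟩ := HasCoeffs.exists_isCoeff
      (formXm_hasCoeffs hV (hS _) le_rfl adm_tZero hP) j one_ne_zero
    exact ⟨_, incl_mem_total hQ, Rule.xmPos j l P Q h⟩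
  | xmPosSq j =>
    obtain ⟨Q, hQ, h⟩ := HasCoeffs.exists_isCoeff
      (formXmSq_hasCoeffs hV (hS _) le_rfl adm_tZero hP) j neg_four_I_ne_zero
    exact ⟨_, incl_mem_total hQ, Rule.xmPosSq j l P Q h⟩
  | xmZero =>
    obtain ⟨Q, hQ, h⟩ := HasCoeffs.exists_isCoeff
      (formXm_laurent hV adm_tInf (cyc_mono hP)) 0 (neg_ne_zero.2 one_ne_zero)
    have hR : formXm P.1 (tInf n (1 + l)) (xVar n (1 + l)) ∈ constR n (1 + l) :=
      wedge_mem_constR (fun e => F_mem_constR _)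
        (fun e => aeval_mem_constR hP.1 fun i => xVar_mem_constR _)
    exact ⟨_, incl_mem_total (M := fun l => Cyc (R n) V l)
      ⟨mem_withCoeffs_of_isCoeff hR (neg_ne_zero.2 one_ne_zero) h, hQ.2⟩, Rule.xmNonpos 0 l P Q h⟩
  | xmZeroSq =>
    obtain ⟨Q, hQ, h⟩ := HasCoeffs.exists_isCoeff
      (formXmSq_laurent hV adm_tInf (cyc_mono hP)) 0 neg_four_I_ne_zero
    have hR : formXmSq P.1 (tInf n (2 + l)) (xVar n (2 + l)) ∈ constR n (2 + l) :=
      wedge_mem_constR (fun e => F2_mem_constR _ _)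
        (fun e => aeval_mem_constR hP.1 fun i => xVar_mem_constR _)
    exact ⟨_, incl_mem_total (M := fun l => Cyc (R n) V l)
      ⟨mem_withCoeffs_of_isCoeff hR neg_four_I_ne_zero h, hQ.2⟩, Rule.xmNonposSq 0 l P Q h⟩
  | aPos j =>
    obtain ⟨Q, hQ, h⟩ := HasCoeffs.exists_isCoeff
      (formAPos_hasCoeffs hV (hS _) le_rfl adm_tZero hP) j one_ne_zero
    exact ⟨_, incl_mem_total hQ, Rule.aPos j l P Q h⟩
  | xpNonneg j =>
    rcases l with _ | l
    · exact ⟨0, (total _).zero_mem, Rule.xpNonneg_zero j P⟩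
    obtain ⟨Q, hQ, h⟩ := HasCoeffs.exists_isCoeff
      (formXp_hasCoeffs hV (hS _) le_rfl adm_tZero hP) j (hI _)
    exact ⟨_, incl_mem_total hQ, Rule.xpNonneg j l P Q h⟩
  | xpNonnegSq j =>
    rcases l with _ | _ | l
    · exact ⟨0, (total _).zero_mem, Rule.xpNonnegSq_zero j P⟩
    · exact ⟨0, (total _).zero_mem, Rule.xpNonnegSq_one j P⟩
    obtain ⟨Q, hQ, h⟩ := HasCoeffs.exists_isCoeff
      (formXpSq_hasCoeffs hV (hS _) le_rfl adm_tZero hP) j hI1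
    exact ⟨_, incl_mem_total hQ, Rule.xpNonnegSq j l P Q h⟩

end Stability

end Cycles

end

noncomputable section
namespace QLoop

/-! ## Scalars -/

theorem q_zpow_ne_one {m : ℤ} (hm : m ≠ 0) : q ^ m ≠ 1 := by
  have hpos : ∀ k : ℕ, k ≠ 0 → q ^ k ≠ 1 := by
    intro k hk h
    rw [q, ← RatFunc.algebraMap_X, ← map_pow, ← map_one (algebraMap (Polynomial ℂ) (RatFunc ℂ))] at h
    have h1 := RatFunc.algebraMap_injective ℂ h
    have h2 := congrArg Polynomial.natDegree h1
    rw [Polynomial.natDegree_X_pow, Polynomial.natDegree_one] at h2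
    exact hk h2
  rcases le_total 0 m with h | h
  · lift m to ℕ using h
    rw [zpow_natCast]
    exact hpos m (by exact_mod_cast hm)
  · obtain ⟨k, rfl⟩ := Int.exists_eq_neg_ofNat h
    rw [zpow_neg, zpow_natCast, Ne, inv_eq_one]
    exact hpos k (by simpa using hm)

theorem q_zpow_sub_ne_zero {m : ℤ} (hm : m ≠ 0) : q ^ m - q ^ (-m) ≠ 0 := fun h => by
  refine q_zpow_ne_one (m := 2 * m) (by simpa using hm) ?_
  have h1 : q ^ m ≠ 0 := zpow_ne_zero _ q_ne_zero
  rw [zpow_neg, sub_eq_zero] at h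
  rw [two_mul, zpow_add₀ q_ne_zero]
  nth_rewrite 1 [h]
  exact inv_mul_cancel₀ h1

theorem q_sub_inv_ne_zero : q - q⁻¹ ≠ 0 := by
  simpa using q_zpow_sub_ne_zero one_ne_zero

theorem qInt_ne_zero {m : ℤ} (hm : m ≠ 0) : qInt m ≠ 0 :=
  div_ne_zero (q_zpow_sub_ne_zero hm) q_sub_inv_ne_zero

theorem qInt_one : qInt 1 = 1 := by
  rw [qInt, zpow_one, zpow_neg_one, div_self q_sub_inv_ne_zero]

theorem qInt_two : qInt 2 = q + q⁻¹ := by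
  rw [qInt, div_eq_iff q_sub_inv_ne_zero, zpow_neg]
  have := q_ne_zero
  field_simp
  ring

theorem qFact_zero : qFact 0 = 1 := by simp [qFact]

theorem qFact_succ (r : ℕ) : qFact (r + 1) = qFact r * qInt (r + 1) := by
  rw [qFact, Finset.prod_range_succ]; rfl

theorem qFact_one : qFact 1 = 1 := by
  rw [qFact_succ, qFact_zero]; simp [qInt_one]

theorem qFact_two : qFact 2 = qInt 2 := by
  rw [qFact_succ, qFact_one, one_mul]; norm_num

theorem qFact_ne_zero (r : ℕ) : qFact r ≠ 0 :=
  Finset.prod_ne_zero_iff.2 fun j _ => qInt_ne_zero (by omega)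

/-- The evaluation at `q = √-1`. -/
def evalI : ℂ[T;T⁻¹] →+* ℂ :=
  LaurentPolynomial.eval₂ (RingHom.id ℂ) (Units.mk0 Complex.I Complex.I_ne_zero)

theorem evalQ_T (k : ℤ) : evalQ (LaurentPolynomial.T k) = q ^ k := by
  simp [evalQ]

theorem evalI_T (k : ℤ) : evalI (LaurentPolynomial.T k) = Complex.I ^ k := by
  simp [evalI]

/-- `∑_{l < m} T^{d (m - 1 - 2 l)}`. -/
def geom (m : ℕ) (d : ℤ) : ℂ[T;T⁻¹] :=
  ∑ l ∈ Finset.range m, LaurentPolynomial.T (d * (m - 1 - 2 * l))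

/-- The sum telescopes. It is stated over any field so that it serves both at the indeterminate q
and at √-1. -/
theorem sum_zpow_mul {F : Type*} [Field F] {a : F} (ha : a ≠ 0) (m : ℕ) (d : ℤ) :
    (∑ l ∈ Finset.range m, a ^ (d * (m - 1 - 2 * l))) * (a ^ d - a ^ (-d)) =
      a ^ (d * m) - a ^ (-(d * m)) := by
  have h : ∀ l ∈ Finset.range m, a ^ (d * (m - 1 - 2 * l)) * (a ^ d - a ^ (-d)) =
      a ^ (d * (m - 2 * (l : ℕ))) - a ^ (d * (m - 2 * ((l + 1 : ℕ) : ℤ))) := by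
    intro l _
    rw [mul_sub, ← zpow_add₀ ha, ← zpow_add₀ ha]
    congr 2
    · ring
    · push_cast; ring
  rw [Finset.sum_mul, Finset.sum_congr rfl h,
    Finset.sum_range_sub' (fun l : ℕ => a ^ (d * (m - 2 * (l : ℤ))))]
  congr 2
  ring

theorem evalQ_geom (m : ℕ) {d : ℤ} (hd : d ≠ 0) :
    evalQ (geom m d) = (q ^ (d * m) - q ^ (-(d * m))) / (q ^ d - q ^ (-d)) := by
  rw [eq_div_iff (q_zpow_sub_ne_zero hd), ← sum_zpow_mul q_ne_zero]
  simp only [geom, map_sum, evalQ_T]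

/-- For odd exponents i^m - i^{-m} = ±2i, so the quantum integer [m] does not vanish at q = √-1. -/
theorem evalI_geom_one_ne_zero (j : ℕ) : evalI (geom (2 * j + 1) 1) ≠ 0 := fun h => by
  have h1 := sum_zpow_mul Complex.I_ne_zero (2 * j + 1) 1
  simp only [geom, map_sum, evalI_T] at h
  rw [h, zero_mul, one_mul] at h1
  have h2 : (Complex.I : ℂ) ^ (((2 * j + 1 : ℕ)) : ℤ) = (-1) ^ j * Complex.I := by
    rw [zpow_natCast, pow_succ, pow_mul, Complex.I_sq]
  rw [zpow_neg, h2] at h1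
  rcases neg_one_pow_eq_or ℂ j with h3 | h3 <;> rw [h3] at h1 <;> simp at h1 <;>
  · have := congrArg Complex.im h1
    norm_num at this

/-- At q = √-1 all j + 1 terms are equal to (-1)^j. Thus [2j+2]/[2] has the non-zero value ±(j + 1),
although [2j+2] and [2] both vanish. -/
theorem evalI_geom_two_ne_zero (j : ℕ) : evalI (geom (j + 1) 2) ≠ 0 := by
  have h : ∀ l ∈ Finset.range (j + 1),
      (Complex.I : ℂ) ^ (2 * (((j + 1 : ℕ) : ℤ) - 1 - 2 * l)) = (-1) ^ (j : ℤ) := by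
    intro l _
    rw [zpow_mul]
    have : (Complex.I : ℂ) ^ (2 : ℤ) = -1 := by
      rw [show (2 : ℤ) = ((2 : ℕ) : ℤ) from rfl, zpow_natCast, Complex.I_sq]
    rw [this, show (((j + 1 : ℕ) : ℤ) - 1 - 2 * l) = j - 2 * l by push_cast; ring,
      zpow_sub₀ (by norm_num), zpow_mul]
    norm_num
  simp only [geom, map_sum, evalI_T]
  rw [Finset.sum_congr rfl h, Finset.sum_const, Finset.card_range, nsmul_eq_mul]
  exact mul_ne_zero (by exact_mod_cast j.succ_ne_zero) (zpow_ne_zero _ (by norm_num))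

/-- `[r+1] [r+2] / [2]` is a Laurent polynomial which does not vanish at `q = √-1`. -/
theorem exists_evalQ_eq (r : ℕ) :
    ∃ c : ℂ[T;T⁻¹], evalQ c = qInt (r + 1) * qInt (r + 2) / qInt 2 ∧ evalI c ≠ 0 := by
  have h2 := qInt_ne_zero (m := 2) (by norm_num)
  have hodd : ∀ j : ℕ, evalQ (geom (2 * j + 1) 1) = qInt (2 * j + 1) := fun j => by
    rw [evalQ_geom _ one_ne_zero, qInt, zpow_one, zpow_neg_one]
    push_cast
    rw [one_mul]
  have heven : ∀ j : ℕ, evalQ (geom (j + 1) 2) = qInt (2 * j + 2) / qInt 2 := fun j => by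
    rw [evalQ_geom _ two_ne_zero, qInt, qInt, div_div_div_cancel_right₀ q_sub_inv_ne_zero]
    push_cast
    rw [mul_add, mul_one]
  -- Of r + 1 and r + 2 one is odd, giving a non-vanishing [·], and the other is even, absorbing the
  -- denominator [2].
  rcases Nat.even_or_odd' r with ⟨j, rfl | rfl⟩
  · refine ⟨geom (2 * j + 1) 1 * geom (j + 1) 2, ?_, ?_⟩
    · rw [map_mul, hodd, heven]
      push_cast
      ring
    · rw [map_mul]
      exact mul_ne_zero (evalI_geom_one_ne_zero j) (evalI_geom_two_ne_zero j)
  · refine ⟨geom (2 * (j + 1) + 1) 1 * geom (j + 1) 2, ?_, ?_⟩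
    · rw [map_mul, hodd, heven]
      push_cast
      rw [show (2 * (j : ℤ) + 1 + 1) = 2 * j + 2 by ring,
        show (2 * (j : ℤ) + 1 + 2) = 2 * (j + 1) + 1 by ring]
      ring
    · rw [map_mul]
      exact mul_ne_zero (evalI_geom_one_ne_zero (j + 1)) (evalI_geom_two_ne_zero j)

theorem evalI_T_sub_ne_zero : evalI (LaurentPolynomial.T 1 - LaurentPolynomial.T (-1)) ≠ 0 := by
  rw [map_sub, evalI_T, evalI_T]
  simp

theorem smul_eq_evalQ_smul (c : ℂ[T;T⁻¹]) (y : Uq) : c • y = evalQ c • y := by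
  rw [Algebra.smul_def, Algebra.smul_def]; rfl

theorem q_zpow_smul (k : ℤ) (y : Uq) : q ^ k • y = (LaurentPolynomial.T k : ℂ[T;T⁻¹]) • y := by
  rw [smul_eq_evalQ_smul, evalQ_T]

end QLoop

namespace Cycles
open QLoop

/-! ## The elements of `U_q^res` which preserve a subspace -/

section Module

variable {n : ℕ} {ρ : Ui →ₐ[ℂ] Module.End (K n) (ATot n)} {M : ∀ l : ℕ, Submodule ℂ (A n l)}

theorem spec_algebraMap (c : ℂ[T;T⁻¹]) :
    spec (algebraMap ℂ[T;T⁻¹] Ures c) = algebraMap ℂ Ui (evalI c) :=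
  (Algebra.TensorProduct.includeRight : Ures →ₐ[ℂ[T;T⁻¹]] Ui).commutes c

theorem map_spec_smul (c : ℂ[T;T⁻¹]) (u : Ures) (P : ATot n) :
    ρ (spec (c • u)) P = evalI c • ρ (spec u) P := by
  rw [Algebra.smul_def, map_mul, spec_algebraMap, map_mul, AlgHom.commutes]
  rfl

variable (ρ M) in
/-- The elements of `U_q^res` which preserve `⊕_l M_l`. -/
def stab : Subalgebra ℂ[T;T⁻¹] Uq where
  carrier := {y | ∃ h : y ∈ Ures, ∀ P ∈ total M, ρ (spec ⟨y, h⟩) P ∈ total M}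
  mul_mem' := by
    rintro a b ⟨ha, ha'⟩ ⟨hb, hb'⟩
    refine ⟨Ures.mul_mem ha hb, fun P hP => ?_⟩
    have : (⟨a * b, Ures.mul_mem ha hb⟩ : Ures) = ⟨a, ha⟩ * ⟨b, hb⟩ := rfl
    rw [this, map_mul, map_mul]
    exact ha' _ (hb' _ hP)
  add_mem' := by
    rintro a b ⟨ha, ha'⟩ ⟨hb, hb'⟩
    refine ⟨Ures.add_mem ha hb, fun P hP => ?_⟩
    have : (⟨a + b, Ures.add_mem ha hb⟩ : Ures) = ⟨a, ha⟩ + ⟨b, hb⟩ := rfl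
    rw [this, map_add, map_add]
    exact (total M).add_mem (ha' _ hP) (hb' _ hP)
  algebraMap_mem' := fun c => ⟨Ures.algebraMap_mem c, fun P hP => by
    have : (⟨algebraMap ℂ[T;T⁻¹] Uq c, Ures.algebraMap_mem c⟩ : Ures) =
      algebraMap ℂ[T;T⁻¹] Ures c := rfl
    rw [this, spec_algebraMap, AlgHom.commutes]
    exact (total M).smul_mem _ hP⟩

/-- In the specialization c becomes the non-zero number c(√-1), by which one can divide. The
membership of y in `Ures` must be known beforehand: it does not follow from that of c • y. -/
theorem mem_stab_of_smul {c : ℂ[T;T⁻¹]} (hc : evalI c ≠ 0) {y : Uq} (hy : y ∈ Ures)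
    (h : c • y ∈ stab ρ M) : y ∈ stab ρ M := by
  obtain ⟨h', h⟩ := h
  refine ⟨hy, fun P hP => ?_⟩
  have h1 := h P hP
  have : (⟨c • y, h'⟩ : Ures) = c • ⟨y, hy⟩ := rfl
  rw [this, map_spec_smul] at h1
  have h2 := (total M).smul_mem (evalI c)⁻¹ h1
  rwa [inv_smul_smul₀ hc] at h2

theorem mem_total_induction {N : Submodule ℂ (ATot n)} {f : Module.End (K n) (ATot n)}
    (h : ∀ l, ∀ P ∈ M l, f (incl l P) ∈ N) {P : ATot n} (hP : P ∈ total M) : f P ∈ N := by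
  classical
  rw [← DirectSum.sum_support_of P, map_sum]
  exact N.sum_mem fun l _ => h l _ (hP l)

theorem elt_mem_stab (hρ : FollowsRule ρ) {G : Set Gen} (hM : StableUnderRule G M) {g : Gen}
    (hg : g ∈ G) (h : g.elt ∈ Ures) : g.elt ∈ stab ρ M := by
  refine ⟨h, fun P hP => mem_total_induction (M := M) (fun l P hP => ?_) hP⟩
  obtain ⟨Q, hQ, hr⟩ := hM g hg l P hP
  rw [hρ g _ rfl _ _ hr]
  exact hQ

theorem map_mem_total_of_mem_stab (h : ∀ u : Ures, (u : Uq) ∈ stab ρ M) (v : Ui) {P : ATot n}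
    (hP : P ∈ total M) : ρ v P ∈ total M := by
  induction v using TensorProduct.induction_on with
  | zero => rw [map_zero]; exact (total M).zero_mem
  | tmul a u =>
    obtain ⟨b, hb⟩ : ∃ b : ℂ, a = algebraMap ℂ AtI b := ⟨a, rfl⟩
    have : (a ⊗ₜ u : Ui) = b • spec u := by
      rw [hb, Algebra.algebraMap_eq_smul_one, ← TensorProduct.smul_tmul']
      rfl
    rw [this, map_smul]
    obtain ⟨_, h'⟩ := h u
    exact (total M).smul_mem _ (h' P hP)
  | add v w hv hw => rw [map_add]; exact (total M).add_mem hv hw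

theorem map_mem_total_of_mem_bplus (h : BplusQ ≤ stab ρ M) {v : Ui} (hv : v ∈ Bplus) {P : ATot n}
    (hP : P ∈ total M) : ρ v P ∈ total M := by
  induction hv using Algebra.adjoin_induction generalizing P with
  | mem x hx =>
    obtain ⟨u, hu, rfl⟩ := hx
    obtain ⟨_, h'⟩ := h hu
    exact h' P hP
  | algebraMap r => rw [AlgHom.commutes]; exact (total M).smul_mem r hP
  | add x y _ _ hx hy => rw [map_add]; exact (total M).add_mem (hx hP) (hy hP)
  | mul x y _ _ hx hy => rw [map_mul]; exact hx (hy hP)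

end Module

end Cycles

end

noncomputable section
namespace QLoop

/-! ## Relations in `U_q` -/

theorem mk_rel {a b : Free} (h : Rel a b) : Uq.mk a = Uq.mk b := RingQuot.mkAlgHom_rel Cq h

theorem t_mul_tInv : Uq.t * Uq.tInv = 1 := by
  have := mk_rel Rel.t_mul_tInv
  rwa [map_mul, map_one] at this

theorem tInv_mul_t : Uq.tInv * Uq.t = 1 := by
  have := mk_rel Rel.tInv_mul_t
  rwa [map_mul, map_one] at this

theorem t_mul_x (s : ℤˣ) (k : ℤ) : Uq.t * Uq.x s k = q ^ (2 * (s : ℤ)) • (Uq.x s k * Uq.t) := by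
  have h : Uq.t * Uq.x s k * Uq.tInv = q ^ (2 * (s : ℤ)) • Uq.x s k := by
    have := mk_rel (Rel.t_x s k)
    rwa [map_mul, map_mul, map_smul] at this
  have h' := congrArg (· * Uq.t) h
  simp only [mul_assoc, tInv_mul_t, mul_one, smul_mul_assoc] at h'
  exact h'

theorem tInv_mul_x (s : ℤˣ) (k : ℤ) :
    Uq.tInv * Uq.x s k = q ^ (-(2 * (s : ℤ))) • (Uq.x s k * Uq.tInv) := by
  have h := congrArg (fun y => Uq.tInv * y * Uq.tInv) (t_mul_x s k)
  simp only [mul_smul_comm, smul_mul_assoc] at h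
  rw [← mul_assoc, tInv_mul_t, one_mul, mul_assoc Uq.tInv, mul_assoc (Uq.x s k), t_mul_tInv,
    mul_one] at h
  rw [h, smul_smul, ← zpow_add₀ q_ne_zero, neg_add_cancel, zpow_zero, one_smul]

theorem x_mul_x_add (s : ℤˣ) (k l : ℤ) :
    Uq.x s (k + 1) * Uq.x s l + Uq.x s (l + 1) * Uq.x s k =
      q ^ (2 * (s : ℤ)) • (Uq.x s l * Uq.x s (k + 1) + Uq.x s k * Uq.x s (l + 1)) := by
  have h : Uq.x s (k + 1) * Uq.x s l - q ^ (2 * (s : ℤ)) • (Uq.x s l * Uq.x s (k + 1)) =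
      q ^ (2 * (s : ℤ)) • (Uq.x s k * Uq.x s (l + 1)) - Uq.x s (l + 1) * Uq.x s k := by
    have := mk_rel (Rel.x_x s k l)
    simp only [map_sub, map_mul, map_smul] at this
    exact this
  rw [smul_add]
  rw [sub_eq_iff_eq_add] at h
  rw [h]
  abel

theorem xp_mul_xm : Uq.x 1 0 * Uq.x (-1) 0 =
    Uq.x (-1) 0 * Uq.x 1 0 + (q - q⁻¹)⁻¹ • (Uq.t - Uq.tInv) := by
  have h := mk_rel (Rel.xp_xm 0 0)
  have h1 : Free.phi 1 (0 + 0) = Free.t := by simp [Free.phi]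
  have h2 : Free.phi (-1) (0 + 0) = Free.tInv := by simp [Free.phi]
  rw [h1, h2] at h
  simp only [map_sub, map_mul, map_smul] at h
  rw [add_comm, ← sub_eq_iff_eq_add]
  exact h

theorem divPow_zero (y : Uq) : Uq.divPow y 0 = 1 := by
  rw [Uq.divPow, qFact_zero, inv_one, one_smul, pow_zero]

theorem divPow_one (y : Uq) : Uq.divPow y 1 = y := by
  rw [Uq.divPow, qFact_one, inv_one, one_smul, pow_one]

/-- The step is by two because y^{(r)} y = [r+1] y^{(r+1)} has a coefficient which vanishes at q =
√-1 for odd r. -/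
theorem divPow_mul_divPow_two (y : Uq) (r : ℕ) :
    Uq.divPow y r * Uq.divPow y 2 =
      (qInt (r + 1) * qInt (r + 2) / qInt 2) • Uq.divPow y (r + 2) := by
  have h0 := qFact_ne_zero r
  have h1 := qInt_ne_zero (m := r + 1) (by omega)
  have h2 := qInt_ne_zero (m := r + 2) (by omega)
  have h3 := qInt_ne_zero (m := 2) (by omega)
  have h4 : ((r + 1 : ℕ) : ℤ) + 1 = r + 2 := by push_cast; ring
  rw [Uq.divPow, Uq.divPow, Uq.divPow, smul_mul_smul_comm, ← pow_add, smul_smul, qFact_succ (r + 1),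
    qFact_succ r, qFact_two, h4]
  congr 1
  field_simp

/-! ## Divided squares of the half currents -/

theorem one_add_q_zpow (s : ℤˣ) : 1 + q ^ (2 * (s : ℤ)) = q ^ (s : ℤ) * qInt 2 := by
  have h := q_ne_zero
  rw [qInt_two]
  rcases Int.units_eq_one_or s with rfl | rfl
  · norm_num
    field_simp
    ring
  · norm_num
    field_simp

/-- Modulo [2] one has q^{±2} ≡ -1. Let A_J denote the symmetrized product on the left of the first
identity. The quadratic relation for the indices k + J and k - J - 1 says A_{J+1} + A_J = (1 +
q^{2s}) r = q^s [2] r, whence A_J ≡ 2(-1)^J x_k², and the partial sums x_k² + A_1 + ⋯ + A_J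
alternate as (-1)^J x_k². -/
theorem exists_sum_x_mul_x {N : Subalgebra ℂ[T;T⁻¹] Uq} {s : ℤˣ} {k : ℤ} {J : ℕ}
    (hN : ∀ j : ℕ, j ≤ J → Uq.x s (k - j) ∈ N ∧ Uq.x s (k + j) ∈ N) :
    ∃ v ∈ N, ∃ w ∈ N,
      Uq.x s (k - J) * Uq.x s (k + J) + Uq.x s (k + J) * Uq.x s (k - J) =
        (-1 : Cq) ^ J • (2 : Cq) • Uq.x s k ^ 2 + qInt 2 • v ∧
      Uq.x s k ^ 2 + ∑ j ∈ Finset.range J,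
          (Uq.x s (k - (j + 1 : ℕ)) * Uq.x s (k + (j + 1 : ℕ)) +
            Uq.x s (k + (j + 1 : ℕ)) * Uq.x s (k - (j + 1 : ℕ))) =
        (-1 : Cq) ^ J • Uq.x s k ^ 2 + qInt 2 • w := by
  induction J with
  | zero =>
    refine ⟨0, N.zero_mem, 0, N.zero_mem, ?_, ?_⟩
    · simp [pow_two, two_smul]
    · simp
  | succ J ih =>
    obtain ⟨v, hv, w, hw, hv', hw'⟩ := ih fun j hj => hN j (hj.trans J.le_succ)
    have hrel := x_mul_x_add s (k + J) (k - (J + 1 : ℕ))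
    have e1 : k + (J : ℤ) + 1 = k + (J + 1 : ℕ) := by push_cast; ring
    have e2 : k - ((J + 1 : ℕ) : ℤ) + 1 = k - J := by push_cast; ring
    rw [e1, e2] at hrel
    set r := Uq.x s (k - (J + 1 : ℕ)) * Uq.x s (k + (J + 1 : ℕ)) + Uq.x s (k + J) * Uq.x s (k - J)
      with hr
    have hrN : q ^ (s : ℤ) • r ∈ N := by
      rw [q_zpow_smul]
      exact N.smul_mem (N.add_mem (N.mul_mem (hN _ le_rfl).1 (hN _ le_rfl).2)
        (N.mul_mem (hN _ J.le_succ).2 (hN _ J.le_succ).1)) _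
    have hS : Uq.x s (k - (J + 1 : ℕ)) * Uq.x s (k + (J + 1 : ℕ)) +
        Uq.x s (k + (J + 1 : ℕ)) * Uq.x s (k - (J + 1 : ℕ)) =
        (-1 : Cq) ^ (J + 1) • (2 : Cq) • Uq.x s k ^ 2 + qInt 2 • (q ^ (s : ℤ) • r - v) := by
      have h1 : qInt 2 • q ^ (s : ℤ) • r = r + q ^ (2 * (s : ℤ)) • r := by
        rw [smul_smul, mul_comm, ← one_add_q_zpow, add_smul, one_smul]
      rw [smul_sub, h1, ← hrel, pow_succ, mul_neg_one, neg_smul, hr, ← sub_eq_zero]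
      rw [← sub_eq_zero] at hv'
      rw [← neg_eq_zero, ← hv']
      abel
    refine ⟨q ^ (s : ℤ) • r - v, N.sub_mem hrN hv, w + (q ^ (s : ℤ) • r - v),
      N.add_mem hw (N.sub_mem hrN hv), hS, ?_⟩
    rw [Finset.sum_range_succ, ← add_assoc, hw', hS, smul_add (qInt 2), pow_succ (-1 : Cq),
      mul_neg_one, neg_smul, neg_smul, two_smul, smul_add ((-1 : Cq) ^ J)]
    abel

theorem coeff_two_mul_sq {B : Type*} [Ring B] (g : PowerSeries B) (k : ℕ) :
    PowerSeries.coeff (2 * k) (g ^ 2) = PowerSeries.coeff k g ^ 2 +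
      ∑ j ∈ Finset.range k, (PowerSeries.coeff (k - (j + 1)) g * PowerSeries.coeff (k + (j + 1)) g +
        PowerSeries.coeff (k + (j + 1)) g * PowerSeries.coeff (k - (j + 1)) g) := by
  rw [pow_two, PowerSeries.coeff_mul, Finset.Nat.sum_antidiagonal_eq_sum_range_succ
    (fun i j => PowerSeries.coeff i g * PowerSeries.coeff j g), Finset.sum_add_distrib,
    show (2 * k).succ = k + (1 + k) by omega, Finset.sum_range_add, Finset.sum_range_add,
    ← Finset.sum_range_reflect, Finset.sum_range_one, pow_two]
  have h1 : ∀ j ∈ Finset.range k, PowerSeries.coeff (k - 1 - j) g *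
      PowerSeries.coeff (2 * k - (k - 1 - j)) g =
      PowerSeries.coeff (k - (j + 1)) g * PowerSeries.coeff (k + (j + 1)) g := fun j hj => by
    have := Finset.mem_range.1 hj
    congr 3 <;> omega
  have h2 : ∀ j ∈ Finset.range k, PowerSeries.coeff (k + (1 + j)) g *
      PowerSeries.coeff (2 * k - (k + (1 + j))) g =
      PowerSeries.coeff (k + (j + 1)) g * PowerSeries.coeff (k - (j + 1)) g := fun j hj => by
    have := Finset.mem_range.1 hj
    congr 3 <;> omega
  rw [Finset.sum_congr rfl h1, Finset.sum_congr rfl h2, show 2 * k - (k + 0) = k by omega, add_zero]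
  abel

/-- The coefficient of index 2k of a square is x_k² plus symmetrized products around k. By
`exists_sum_x_mul_x` it is ± x_k² modulo [2], so dividing by [2]! = [2] isolates the divided square
up to an element w of N. The sign ε distinguishes series in t from series in t⁻¹. -/
theorem exists_sqCoeff_eq {N : Subalgebra ℂ[T;T⁻¹] Uq} {s ε : ℤˣ} {g : PowerSeries Uq} {k : ℕ}
    (hg : ∀ i : ℕ, i ≠ 0 → PowerSeries.coeff i g = q ^ (-((ε : ℤ) * i)) • Uq.x s (ε * i))
    (hg0 : PowerSeries.coeff 0 g = Uq.x s 0 ∨ PowerSeries.coeff 0 g = 0 ∧ k ≠ 0)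
    (hN : ∀ i : ℕ, Uq.x s (ε * i) ∈ N) :
    ∃ J : ℕ, ∃ w ∈ N, sqCoeff g (2 * k) =
      q ^ (-((ε : ℤ) * (2 * k))) • ((-1 : Cq) ^ J • Uq.divPow (Uq.x s (ε * k)) 2 + w) := by
  have key : ∀ J : ℕ, J ≤ k → (∀ i : ℕ, k - J ≤ i →
      PowerSeries.coeff i g = q ^ (-((ε : ℤ) * i)) • Uq.x s (ε * i)) →
      ∃ w ∈ N, PowerSeries.coeff k g ^ 2 +
      ∑ j ∈ Finset.range J, (PowerSeries.coeff (k - (j + 1)) g * PowerSeries.coeff (k + (j + 1)) g +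
        PowerSeries.coeff (k + (j + 1)) g * PowerSeries.coeff (k - (j + 1)) g) =
      q ^ (-((ε : ℤ) * (2 * k))) • ((-1 : Cq) ^ J • Uq.x s (ε * k) ^ 2 + qInt 2 • w) := by
    intro J hJ hgJ
    have hsub : ∀ j : ℕ, j ≤ J → Uq.x s (ε * k - ε * j) ∈ N := fun j hj => by
      have := hN (k - j)
      rwa [Nat.cast_sub (hj.trans hJ), mul_sub] at this
    have hadd : ∀ j : ℕ, Uq.x s (ε * k + ε * j) ∈ N := fun j => by
      have := hN (k + j)
      rwa [Nat.cast_add, mul_add] at this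
    obtain ⟨-, -, w, hw, -, hw'⟩ := exists_sum_x_mul_x (N := N) (s := s) (k := ε * k) (J := J)
      fun j hj => by
        have h1 := hsub j hj
        have h2 := hadd j
        rcases Int.units_eq_one_or ε with rfl | rfl
        · simp only [Units.val_one, one_mul] at h1 h2 ⊢
          exact ⟨h1, h2⟩
        · simp only [Units.val_neg, Units.val_one, neg_mul, one_mul, sub_neg_eq_add] at h1 h2 ⊢
          exact ⟨h2, h1⟩
    refine ⟨w, hw, ?_⟩
    rw [← hw', smul_add, Finset.smul_sum]
    congr 1
    · rw [hgJ k (by omega), smul_pow, ← zpow_natCast, ← zpow_mul]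
      congr 2
      push_cast
      ring
    · refine Finset.sum_congr rfl fun j hj => ?_
      have hj' := Finset.mem_range.1 hj
      rw [hgJ _ (show k - J ≤ k - (j + 1) by omega), hgJ _ (show k - J ≤ k + (j + 1) by omega),
        smul_mul_smul_comm, smul_mul_smul_comm, ← zpow_add₀ q_ne_zero, ← zpow_add₀ q_ne_zero,
        Nat.cast_sub (by omega : j + 1 ≤ k), Nat.cast_add k (j + 1),
        show -((ε : ℤ) * (k - (j + 1 : ℕ))) + -(ε * (k + (j + 1 : ℕ))) = -(ε * (2 * k)) by ring,
        show -((ε : ℤ) * (k + (j + 1 : ℕ))) + -(ε * (k - (j + 1 : ℕ))) = -(ε * (2 * k)) by ring,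
        ← smul_add]
      congr 1
      rcases Int.units_eq_one_or ε with rfl | rfl
      · simp only [Units.val_one, one_mul]
      · rw [add_comm]
        simp only [Units.val_neg, Units.val_one, neg_mul, one_mul, mul_add, sub_eq_add_neg,
          neg_neg, add_comm]
  have fin : ∀ (J : ℕ) (w : Uq),
      (qFact 2)⁻¹ • q ^ (-((ε : ℤ) * (2 * k))) • ((-1 : Cq) ^ J • Uq.x s (ε * k) ^ 2 + qInt 2 • w) =
      q ^ (-((ε : ℤ) * (2 * k))) • ((-1 : Cq) ^ J • Uq.divPow (Uq.x s (ε * k)) 2 + w) := by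
    intro J w
    rw [smul_comm, smul_add (qFact 2)⁻¹, qFact_two, inv_smul_smul₀ (qInt_ne_zero two_ne_zero),
      Uq.divPow, qFact_two, smul_comm (qInt 2)⁻¹]
  rw [sqCoeff, coeff_two_mul_sq]
  rcases hg0 with h0 | ⟨h0, hk⟩
  · obtain ⟨w, hw, h⟩ := key k le_rfl fun i _ => by
      rcases eq_or_ne i 0 with rfl | hi
      · simp [h0]
      · exact hg i hi
    exact ⟨k, w, hw, by rw [h, fin]⟩
  -- A current without constant term loses the outermost pair of indices 0 and 2k, so only k - 1
  -- pairs contribute.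
  · obtain ⟨J, rfl⟩ := Nat.exists_eq_succ_of_ne_zero hk
    obtain ⟨w, hw, h⟩ := key J J.le_succ fun i hi => hg i (by omega)
    refine ⟨J, w, hw, ?_⟩
    rw [Finset.sum_range_succ, Nat.succ_eq_add_one, Nat.sub_self, h0, zero_mul, mul_zero, add_zero,
      add_zero]
    rw [Nat.succ_eq_add_one] at h
    rw [h, fin]

end QLoop

end

noncomputable section
namespace QLoop

/-! ## The `q`-binomials -/

theorem q_zpow_sub_eq (m : ℤ) : q ^ m - q ^ (-m) = qInt m * (q - q⁻¹) := by
  rw [qInt, div_mul_cancel₀ _ q_sub_inv_ne_zero]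

theorem tBinom_zero (c : ℤ) : Uq.tBinom c 0 = 1 := rfl

theorem tBinom_one (c : ℤ) :
    Uq.tBinom c 1 = (q - q⁻¹)⁻¹ • (q ^ c • Uq.t - q ^ (-c) • Uq.tInv) := by
  simp [Uq.tBinom]

theorem tBinom_succ (c : ℤ) (r : ℕ) :
    Uq.tBinom c (r + 1) = (qInt (r + 1))⁻¹ • (Uq.tBinom c r * Uq.tBinom (c - r) 1) := by
  rw [Uq.tBinom, List.range_succ, List.map_append, List.prod_append, List.map_singleton,
    List.prod_singleton, q_zpow_sub_eq, tBinom_one, mul_inv, mul_smul, mul_smul_comm, neg_sub]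
  rfl

theorem tBinom_two (c : ℤ) :
    Uq.tBinom c 2 = (qInt 2)⁻¹ • (Uq.tBinom c 1 * Uq.tBinom (c - 1) 1) := by
  rw [tBinom_succ]
  norm_num

theorem tBinom_mul_tBinom_two (c : ℤ) (r : ℕ) :
    Uq.tBinom c r * Uq.tBinom (c - r) 2 =
      (qInt (r + 1) * qInt (r + 2) / qInt 2) • Uq.tBinom c (r + 2) := by
  have h1 := qInt_ne_zero (m := r + 1) (by omega)
  have h2 := qInt_ne_zero (m := r + 2) (by omega)
  rw [tBinom_succ c (r + 1), tBinom_succ c r, tBinom_two, mul_smul_comm, smul_mul_assoc, smul_smul,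
    smul_smul, mul_assoc, show c - ((r + 1 : ℕ) : ℤ) = c - r - 1 by push_cast; ring,
    show ((r + 1 : ℕ) : ℤ) + 1 = r + 2 by push_cast; ring]
  congr 1
  · field_simp
  · rw [mul_assoc]

theorem tBinom_one_mul_x (s : ℤˣ) (c k : ℤ) :
    Uq.tBinom c 1 * Uq.x s k = Uq.x s k * Uq.tBinom (c + 2 * s) 1 := by
  rw [tBinom_one, tBinom_one, smul_mul_assoc, mul_smul_comm, sub_mul, mul_sub, smul_mul_assoc,
    smul_mul_assoc, t_mul_x, tInv_mul_x, mul_smul_comm, mul_smul_comm, smul_smul, smul_smul,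
    ← zpow_add₀ q_ne_zero, ← zpow_add₀ q_ne_zero, neg_add]

theorem tBinom_one_add (c : ℤ) :
    Uq.tBinom (c + 1) 1 + Uq.tBinom (c - 1) 1 = qInt 2 • Uq.tBinom c 1 := by
  have h1 : q ^ (c + 1) + q ^ (c - 1) = qInt 2 * q ^ c := by
    rw [zpow_add₀ q_ne_zero, zpow_sub₀ q_ne_zero, zpow_one, qInt_two]
    ring
  have h2 : q ^ (-(c + 1)) + q ^ (-(c - 1)) = qInt 2 * q ^ (-c) := by
    rw [neg_add, neg_sub, sub_eq_add_neg, add_comm 1, zpow_add₀ q_ne_zero, zpow_add₀ q_ne_zero,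
      zpow_one, zpow_neg_one, qInt_two]
    ring
  simp only [tBinom_one]
  rw [← smul_add, smul_comm (qInt 2), smul_sub (qInt 2), smul_smul, smul_smul, ← h1, ← h2, add_smul,
    add_smul]
  congr 1
  abel

theorem tBinom_one_succ (c : ℤ) :
    Uq.tBinom (c + 1) 1 = q ^ (2 : ℤ) • Uq.tBinom (c - 1) 1 + qInt 2 • q ^ (1 - c) • Uq.tInv := by
  have h0 := q_sub_inv_ne_zero
  have h1 : q ^ (2 : ℤ) * q ^ (c - 1) = q ^ (c + 1) := by
    rw [← zpow_add₀ q_ne_zero]; congr 1; ring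
  have h2 : q ^ (2 : ℤ) * q ^ (-(c - 1)) = q ^ (-(c + 1)) + (q - q⁻¹) * qInt 2 * q ^ (1 - c) := by
    rw [neg_sub, neg_add, ← sub_eq_add_neg, sub_eq_add_neg 1 c, zpow_add₀ q_ne_zero 1,
      zpow_sub₀ q_ne_zero, qInt_two, zpow_one, zpow_ofNat]
    have := q_ne_zero
    field_simp
    ring
  have h3 : qInt 2 • q ^ (1 - c) • Uq.tInv =
      (q - q⁻¹)⁻¹ • ((q - q⁻¹) * qInt 2 * q ^ (1 - c)) • Uq.tInv := by
    rw [smul_smul, smul_smul, mul_assoc, inv_mul_cancel_left₀ h0]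
  simp only [tBinom_one]
  rw [h3, smul_comm (q ^ (2 : ℤ)), ← smul_add, smul_sub (q ^ (2 : ℤ)), smul_smul, smul_smul, h1, h2,
    add_smul]
  congr 1
  abel

theorem tBinom_one_mul_tInv (c : ℤ) :
    Uq.tInv * Uq.tBinom c 1 = Uq.tBinom c 1 * Uq.tInv := by
  rw [tBinom_one, mul_smul_comm, smul_mul_assoc, mul_sub, sub_mul, mul_smul_comm, mul_smul_comm,
    smul_mul_assoc, smul_mul_assoc, tInv_mul_t, t_mul_tInv]

/-- A shift of c with coefficients in ℂ[q, q⁻¹], so that no division by [2], which vanishes at q =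
√-1, is needed to pass from one c to the next. -/
theorem tBinom_two_succ (c : ℤ) :
    Uq.tBinom (c + 1) 2 =
      q ^ (2 : ℤ) • Uq.tBinom c 2 + q ^ (1 - c) • (Uq.tBinom c 1 * Uq.tInv) := by
  have h : Uq.tBinom (c + 1) 1 * Uq.tBinom c 1 = q ^ (2 : ℤ) • (Uq.tBinom c 1 * Uq.tBinom (c - 1) 1)
      + qInt 2 • q ^ (1 - c) • (Uq.tBinom c 1 * Uq.tInv) := by
    have hc : Uq.tBinom (c - 1) 1 * Uq.tBinom c 1 = Uq.tBinom c 1 * Uq.tBinom (c - 1) 1 := by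
      rw [tBinom_one c]
      simp only [mul_smul_comm, smul_mul_assoc, mul_sub, sub_mul, tBinom_one_mul_tInv]
      congr 3
      rw [tBinom_one]
      simp only [mul_smul_comm, smul_mul_assoc, mul_sub, sub_mul, tInv_mul_t, t_mul_tInv]
    rw [tBinom_one_succ, add_mul, smul_mul_assoc, smul_mul_assoc, smul_mul_assoc, hc,
      tBinom_one_mul_tInv]
  rw [tBinom_two, add_sub_cancel_right, h, smul_add, smul_comm _ (q ^ (2 : ℤ)), ← tBinom_two,
    inv_smul_smul₀ (qInt_ne_zero two_ne_zero)]

/-- With B(c) for the q-binomials of order 1, moving e past f twice gives e f² = f² e + [2] f B(-1),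
and then e² f² = f² e² + [2]² f B(-2) e + [2] B(0) B(-1). Dividing by [2]² leaves B(0) B(-1)/[2],
the q-binomial of order 2, as the only term not built from divided powers and order-one q-binomials.
-/
theorem xp_sq_mul_xm_sq :
    Uq.divPow (Uq.x 1 0) 2 * Uq.divPow (Uq.x (-1) 0) 2 =
      Uq.divPow (Uq.x (-1) 0) 2 * Uq.divPow (Uq.x 1 0) 2 +
        Uq.x (-1) 0 * Uq.tBinom (-2) 1 * Uq.x 1 0 + Uq.tBinom 0 2 := by
  have h2 := qInt_ne_zero (m := 2) two_ne_zero
  set e := Uq.x 1 0 with he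
  set f := Uq.x (-1) 0 with hf
  have hEF : e * f = f * e + Uq.tBinom 0 1 := by
    rw [tBinom_one, neg_zero, zpow_zero, one_smul, one_smul]
    exact xp_mul_xm
  have hfc : ∀ c, Uq.tBinom c 1 * f = f * Uq.tBinom (c - 2) 1 := fun c => by
    rw [hf, tBinom_one_mul_x]
    norm_num [sub_eq_add_neg]
  have hec : ∀ c, Uq.tBinom (c - 2) 1 * e = e * Uq.tBinom c 1 := fun c => by
    rw [he, tBinom_one_mul_x]
    norm_num
  have hEFF : e * f * f = f * f * e + qInt 2 • (f * Uq.tBinom (-1) 1) := by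
    have h := tBinom_one_add (-1)
    norm_num at h
    rw [hEF, add_mul, mul_assoc, hEF, hfc, ← mul_smul_comm, ← h]
    norm_num [mul_add, mul_assoc, add_assoc]
  have hEEFF : e * e * (f * f) = f * f * (e * e) + (qInt 2 ^ 2) • (f * Uq.tBinom (-2) 1 * e) +
      qInt 2 • (Uq.tBinom 0 1 * Uq.tBinom (-1) 1) := by
    have h := tBinom_one_add (-2)
    have h' := hec (-1)
    norm_num at h h'
    have h3 : qInt 2 ^ 2 • (f * Uq.tBinom (-2) 1 * e) =
        qInt 2 • (f * Uq.tBinom (-1) 1 * e) + qInt 2 • (f * e * Uq.tBinom (-1) 1) := by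
      have h4 : qInt 2 • (f * Uq.tBinom (-2) 1 * e) = f * qInt 2 • Uq.tBinom (-2) 1 * e := by
        rw [mul_smul_comm, smul_mul_assoc]
      rw [pow_two, mul_smul, h4, ← h, mul_add, add_mul, smul_add, mul_assoc f (Uq.tBinom (-3) 1), h',
        mul_assoc f e]
    calc e * e * (f * f) = e * (e * f * f) := by simp only [mul_assoc]
      _ = e * (f * f * e + qInt 2 • (f * Uq.tBinom (-1) 1)) := by rw [hEFF]
      _ = e * f * f * e + qInt 2 • (e * f * Uq.tBinom (-1) 1) := by
        rw [mul_add, mul_smul_comm]; simp only [mul_assoc]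
      _ = _ := by
        rw [hEFF, hEF, add_mul, smul_mul_assoc, add_mul, smul_add, h3]
        simp only [mul_assoc]
        abel
  rw [tBinom_two, zero_sub, Uq.divPow, Uq.divPow, qFact_two, smul_mul_smul_comm, smul_mul_smul_comm,
    pow_two, pow_two, hEEFF, smul_add, smul_add, smul_smul, smul_smul]
  congr 1
  · congr 1
    rw [show (qInt 2)⁻¹ * (qInt 2)⁻¹ * qInt 2 ^ 2 = 1 by field_simp, one_smul]
  · congr 1
    field_simp

/-! ## Membership in the restricted form -/

theorem divPow_mem_Ures (s : ℤˣ) (k : ℤ) (r : ℕ) : Uq.divPow (Uq.x s k) r ∈ Ures :=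
  Algebra.subset_adjoin (Or.inl (Or.inl (Or.inl ⟨s, k, r, rfl⟩)))

theorem x_mem_Ures (s : ℤˣ) (k : ℤ) : Uq.x s k ∈ Ures := by
  simpa only [divPow_one] using divPow_mem_Ures s k 1

theorem t_mem_Ures : Uq.t ∈ Ures := Algebra.subset_adjoin (Or.inl (Or.inl (Or.inr (Or.inl rfl))))

theorem tInv_mem_Ures : Uq.tInv ∈ Ures :=
  Algebra.subset_adjoin (Or.inl (Or.inl (Or.inr (Or.inr rfl))))

theorem tBinom_mem_Ures (c : ℤ) (r : ℕ) : Uq.tBinom c r ∈ Ures :=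
  Algebra.subset_adjoin (Or.inl (Or.inr ⟨c, r, rfl⟩))

theorem aTilde_mem_Ures (m : ℤ) (hm : m ≠ 0) : Uq.aTilde m hm ∈ Ures :=
  Algebra.subset_adjoin (Or.inr ⟨m, hm, rfl⟩)

end QLoop

namespace Cycles
open QLoop

/-! ### From the formulas to the whole specialized algebra -/

section Module

variable {n : ℕ} {ρ : Ui →ₐ[ℂ] Module.End (K n) (ATot n)} {M : ∀ l : ℕ, Submodule ℂ (A n l)}
  {G : Set Gen}

/-- The powers of q in the currents are units of ℂ[q, q⁻¹] and can be removed. -/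
theorem mem_stab_of_elt_eq (hρ : FollowsRule ρ) (hM : StableUnderRule G M) {g : Gen} (hg : g ∈ G)
    {k : ℤ} {y : Uq} (hy : y ∈ Ures) (h : g.elt = q ^ k • y) : y ∈ stab ρ M := by
  have h1 : g.elt ∈ stab ρ M := elt_mem_stab hρ hM hg (by
    rw [h, q_zpow_smul]; exact Ures.smul_mem hy _)
  have h2 : y = q ^ (-k) • g.elt := by
    rw [h, smul_smul, ← zpow_add₀ q_ne_zero, neg_add_cancel, zpow_zero, one_smul]
  rw [h2, q_zpow_smul]
  exact (stab ρ M).smul_mem h1 _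

theorem divPow_two_mem_stab (hρ : FollowsRule ρ) (hM : StableUnderRule G M) {s ε : ℤˣ}
    {Y : PowerSeries Uq} {k : ℕ}
    (hY : ∀ i : ℕ, i ≠ 0 → PowerSeries.coeff i Y = q ^ (-((ε : ℤ) * i)) • Uq.x s (ε * i))
    (hY0 : PowerSeries.coeff 0 Y = Uq.x s 0 ∨ PowerSeries.coeff 0 Y = 0 ∧ k ≠ 0)
    (hN : ∀ i : ℕ, Uq.x s (ε * i) ∈ stab ρ M) {g : Gen} (hg : g ∈ G)
    (h : g.elt = sqCoeff Y (2 * k)) : Uq.divPow (Uq.x s (ε * k)) 2 ∈ stab ρ M := by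
  obtain ⟨J, w, hw, hJ⟩ := exists_sqCoeff_eq hY hY0 hN
  have hd := divPow_mem_Ures s (ε * k) 2
  rw [hJ] at h
  rcases neg_one_pow_eq_or Cq J with h1 | h1 <;> rw [h1] at h
  · rw [one_smul] at h
    have h2 := mem_stab_of_elt_eq hρ hM hg (Ures.add_mem hd hw.1) h
    simpa using (stab ρ M).sub_mem h2 hw
  · rw [neg_smul, one_smul] at h
    have h2 := mem_stab_of_elt_eq hρ hM hg (Ures.add_mem (Ures.neg_mem hd) hw.1) h
    simpa using (stab ρ M).sub_mem hw h2

/-- Induction in steps of two: y^{(r)} y^{(2)} is a multiple of y^{(r+2)} by a scalar that is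
non-zero at q = √-1. -/
theorem divPow_mem_stab {s : ℤˣ} {k : ℤ} (h1 : Uq.x s k ∈ stab ρ M)
    (h2 : Uq.divPow (Uq.x s k) 2 ∈ stab ρ M) (r : ℕ) : Uq.divPow (Uq.x s k) r ∈ stab ρ M := by
  induction r using Nat.twoStepInduction with
  | zero => rw [divPow_zero]; exact (stab ρ M).one_mem
  | one => rwa [divPow_one]
  | more r ih _ =>
    obtain ⟨c, hc, hc'⟩ := exists_evalQ_eq r
    refine mem_stab_of_smul hc' (divPow_mem_Ures s k _) ?_
    rw [smul_eq_evalQ_smul, hc, ← divPow_mul_divPow_two]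
    exact (stab ρ M).mul_mem ih h2

/-- The denominator q - q⁻¹ takes the value 2i at q = √-1, so it can be cleared and divided out. -/
theorem tBinom_one_mem_stab (ht : Uq.t ∈ stab ρ M) (ht' : Uq.tInv ∈ stab ρ M) (c : ℤ) :
    Uq.tBinom c 1 ∈ stab ρ M := by
  refine mem_stab_of_smul evalI_T_sub_ne_zero (tBinom_mem_Ures c 1) ?_
  rw [smul_eq_evalQ_smul, map_sub, evalQ_T, evalQ_T, zpow_one, zpow_neg_one, tBinom_one,
    smul_inv_smul₀ q_sub_inv_ne_zero, q_zpow_smul, q_zpow_smul]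
  exact (stab ρ M).sub_mem ((stab ρ M).smul_mem ht _) ((stab ρ M).smul_mem ht' _)

/-- The rule says nothing about q-binomials. Order 2 with c = 0 is obtained from the product of
divided squares of x^±_0, other c from the shift recursion, and higher orders as for divided powers.
-/
theorem tBinom_mem_stab (ht : Uq.t ∈ stab ρ M) (ht' : Uq.tInv ∈ stab ρ M)
    (hx : ∀ s r, Uq.divPow (Uq.x s 0) r ∈ stab ρ M) (c : ℤ) (r : ℕ) :
    Uq.tBinom c r ∈ stab ρ M := by
  have h1 := tBinom_one_mem_stab ht ht'
  have hx1 : ∀ s, Uq.x s 0 ∈ stab ρ M := fun s => by simpa only [divPow_one] using hx s 1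
  have h2 : ∀ c, Uq.tBinom c 2 ∈ stab ρ M := by
    have hstep : ∀ c, q ^ (1 - c) • (Uq.tBinom c 1 * Uq.tInv) ∈ stab ρ M := fun c => by
      rw [q_zpow_smul]
      exact (stab ρ M).smul_mem ((stab ρ M).mul_mem (h1 c) ht') _
    intro c
    induction c using Int.induction_on with
    | zero =>
      have h := xp_sq_mul_xm_sq
      rw [← sub_eq_iff_eq_add'] at h
      rw [← h]
      exact (stab ρ M).sub_mem ((stab ρ M).mul_mem (hx _ _) (hx _ _))
        ((stab ρ M).add_mem ((stab ρ M).mul_mem (hx _ _) (hx _ _))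
          ((stab ρ M).mul_mem ((stab ρ M).mul_mem (hx1 _) (h1 _)) (hx1 _)))
    | succ c ih =>
      rw [tBinom_two_succ, q_zpow_smul 2]
      exact (stab ρ M).add_mem ((stab ρ M).smul_mem ih _) (hstep _)
    -- Downwards the same recursion is inverted; its leading coefficient q² is a unit.
    | pred c ih =>
      have h := tBinom_two_succ (-(c : ℤ) - 1)
      rw [sub_add_cancel] at h
      have h' : Uq.tBinom (-(c : ℤ) - 1) 2 = q ^ (-2 : ℤ) • (Uq.tBinom (-(c : ℤ)) 2 -
          q ^ (1 - (-(c : ℤ) - 1)) • (Uq.tBinom (-(c : ℤ) - 1) 1 * Uq.tInv)) := by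
        rw [h, add_sub_cancel_right, smul_smul, ← zpow_add₀ q_ne_zero]
        norm_num
      rw [h', q_zpow_smul (-2)]
      exact (stab ρ M).smul_mem ((stab ρ M).sub_mem ih (hstep _)) _
  induction r using Nat.twoStepInduction with
  | zero => rw [tBinom_zero]; exact (stab ρ M).one_mem
  | one => exact h1 c
  | more r ih _ =>
    obtain ⟨b, hb, hb'⟩ := exists_evalQ_eq r
    refine mem_stab_of_smul hb' (tBinom_mem_Ures c _) ?_
    rw [smul_eq_evalQ_smul, hb, ← tBinom_mul_tBinom_two]
    exact (stab ρ M).mul_mem ih (h2 _)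

theorem t_mem_stab (hρ : FollowsRule ρ) (hM : StableUnderRule G M) (hg : Gen.t ∈ G) :
    Uq.t ∈ stab ρ M :=
  elt_mem_stab hρ hM hg t_mem_Ures

theorem tInv_mem_stab (hρ : FollowsRule ρ) (hM : StableUnderRule G M) (hg : Gen.tInv ∈ G) :
    Uq.tInv ∈ stab ρ M :=
  elt_mem_stab hρ hM hg tInv_mem_Ures

theorem aTilde_mem_stab (hρ : FollowsRule ρ) (hM : StableUnderRule G M) {m : ℤ} (hm : m ≠ 0)
    (hpos : 0 < m → Gen.aPos m.natAbs ∈ G) (hneg : m < 0 → Gen.aNeg m.natAbs ∈ G) :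
    Uq.aTilde m hm ∈ stab ρ M := by
  have hu := aTilde_mem_Ures m hm
  rcases lt_or_gt_of_ne hm with h | h
  · have he : (Gen.aNeg m.natAbs).elt = Uq.aTilde m hm := by
      simp only [Gen.elt, curA, PowerSeries.coeff_mk, Int.natAbs_eq_zero, hm, dite_false]
      congr 1
      simp [abs_of_neg h]
    rw [← he] at hu ⊢
    exact elt_mem_stab hρ hM (hneg h) hu
  · have he : (Gen.aPos m.natAbs).elt = Uq.aTilde m hm := by
      simp only [Gen.elt, curA, PowerSeries.coeff_mk, Int.natAbs_eq_zero, hm, dite_false]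
      congr 1
      simp [abs_of_pos h]
    rw [← he] at hu ⊢
    exact elt_mem_stab hρ hM (hpos h) hu

theorem divPow_xp_nonneg_mem_stab (hρ : FollowsRule ρ) (hM : StableUnderRule G M)
    (h1 : ∀ j, Gen.xpNonneg j ∈ G) (h2 : ∀ j, Gen.xpNonnegSq j ∈ G) (k r : ℕ) :
    Uq.divPow (Uq.x 1 k) r ∈ stab ρ M := by
  have hx : ∀ i : ℕ, Uq.x 1 i ∈ stab ρ M := fun i =>
    mem_stab_of_elt_eq hρ hM (h1 i) (k := -i) (x_mem_Ures 1 i) (by simp [Gen.elt, curNonneg])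
  have := divPow_two_mem_stab hρ hM (s := 1) (ε := 1) (Y := curNonneg 1) (k := k)
    (fun i _ => by simp [curNonneg]) (Or.inl (by simp [curNonneg]))
    (fun i => by simpa using hx i) (h2 (2 * k)) rfl
  exact divPow_mem_stab (hx k) (by simpa using this) r

theorem divPow_xm_pos_mem_stab (hρ : FollowsRule ρ) (hM : StableUnderRule G M)
    (h0 : Gen.xmNonpos 0 ∈ G) (h1 : ∀ j, Gen.xmPos j ∈ G) (h2 : ∀ j, Gen.xmPosSq j ∈ G) {k : ℕ}
    (hk : k ≠ 0) (r : ℕ) : Uq.divPow (Uq.x (-1) k) r ∈ stab ρ M := by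
  -- The error term w for x^-_k with k > 0 may involve x^-_0, which is absent from the positive
  -- current and is taken from the one at infinity.
  have hx : ∀ i : ℕ, Uq.x (-1) i ∈ stab ρ M := fun i => by
    rcases eq_or_ne i 0 with rfl | hi
    · exact mem_stab_of_elt_eq hρ hM h0 (k := 0) (x_mem_Ures (-1) _) (by simp [Gen.elt, curNonpos])
    · exact mem_stab_of_elt_eq hρ hM (h1 i) (k := -i) (x_mem_Ures (-1) i)
        (by simp [Gen.elt, curPos, hi])
  have := divPow_two_mem_stab hρ hM (s := -1) (ε := 1) (Y := curPos (-1)) (k := k)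
    (fun i hi => by simp [curPos, hi]) (Or.inr ⟨by simp [curPos], hk⟩)
    (fun i => by simpa using hx i) (h2 (2 * k)) rfl
  exact divPow_mem_stab (hx k) (by simpa using this) r

/-- The constant term of the squared series is exactly (x^-_0)², so no correction term arises and
only the two constant coefficients are used. This suits B^+, where no other coefficient at infinity
is available. -/
theorem divPow_xm_zero_mem_stab (hρ : FollowsRule ρ) (hM : StableUnderRule G M)
    (h1 : Gen.xmNonpos 0 ∈ G) (h2 : Gen.xmNonposSq 0 ∈ G) (r : ℕ) :
    Uq.divPow (Uq.x (-1) 0) r ∈ stab ρ M := by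
  refine divPow_mem_stab (mem_stab_of_elt_eq hρ hM h1 (k := 0) (x_mem_Ures (-1) _)
    (by simp [Gen.elt, curNonpos])) ?_ r
  refine mem_stab_of_elt_eq hρ hM h2 (k := 0) (divPow_mem_Ures (-1) 0 2) ?_
  simp [Gen.elt, sqCoeff, curNonpos, Uq.divPow, PowerSeries.coeff_mul, pow_two]

theorem divPow_xm_nonpos_mem_stab (hρ : FollowsRule ρ) (hM : StableUnderRule G M)
    (h1 : ∀ j, Gen.xmNonpos j ∈ G) (h2 : ∀ j, Gen.xmNonposSq j ∈ G) (k r : ℕ) :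
    Uq.divPow (Uq.x (-1) (-k)) r ∈ stab ρ M := by
  have hx : ∀ i : ℕ, Uq.x (-1) (-i) ∈ stab ρ M := fun i =>
    mem_stab_of_elt_eq hρ hM (h1 i) (k := i) (x_mem_Ures (-1) _) (by simp [Gen.elt, curNonpos])
  have := divPow_two_mem_stab hρ hM (s := -1) (ε := -1) (Y := curNonpos (-1)) (k := k)
    (fun i _ => by simp [curNonpos]) (Or.inl (by simp [curNonpos]))
    (fun i => by simpa using hx i) (h2 (2 * k)) rfl
  exact divPow_mem_stab (hx k) (by simpa using this) r

theorem divPow_xp_neg_mem_stab (hρ : FollowsRule ρ) (hM : StableUnderRule G M)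
    (h0 : Gen.xpNonneg 0 ∈ G) (h1 : ∀ j, Gen.xpNeg j ∈ G) (h2 : ∀ j, Gen.xpNegSq j ∈ G) {k : ℕ}
    (hk : k ≠ 0) (r : ℕ) : Uq.divPow (Uq.x 1 (-k)) r ∈ stab ρ M := by
  have hx : ∀ i : ℕ, Uq.x 1 (-i) ∈ stab ρ M := fun i => by
    rcases eq_or_ne i 0 with rfl | hi
    · exact mem_stab_of_elt_eq hρ hM h0 (k := 0) (x_mem_Ures 1 _) (by simp [Gen.elt, curNonneg])
    · exact mem_stab_of_elt_eq hρ hM (h1 i) (k := i) (x_mem_Ures 1 _)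
        (by simp [Gen.elt, curNeg, hi])
  have := divPow_two_mem_stab hρ hM (s := 1) (ε := -1) (Y := curNeg 1) (k := k)
    (fun i hi => by simp [curNeg, hi]) (Or.inr ⟨by simp [curNeg], hk⟩)
    (fun i => by simpa using hx i) (h2 (2 * k)) rfl
  exact divPow_mem_stab (hx k) (by simpa using this) r

/-- For each generator x^±_k, the sign of k selects the half current in which it occurs; index 0
belongs to the raising current at t = 0 and to the lowering current at t = ∞. -/
theorem laurent_stable (hρ : FollowsRule ρ) (hM : StableUnderRule Set.univ M) (u : Ui)
    (P : ATot n) (hP : P ∈ total M) : ρ u P ∈ total M := by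
  have hx : ∀ (s : ℤˣ) (k : ℤ) (r : ℕ), Uq.divPow (Uq.x s k) r ∈ stab ρ M := by
    intro s k r
    rcases Int.units_eq_one_or s with rfl | rfl
    · rcases le_or_gt 0 k with hk | hk
      · lift k to ℕ using hk
        exact divPow_xp_nonneg_mem_stab hρ hM (fun _ => trivial) (fun _ => trivial) k r
      · obtain ⟨m, rfl⟩ := Int.exists_eq_neg_ofNat hk.le
        exact divPow_xp_neg_mem_stab hρ hM trivial (fun _ => trivial) (fun _ => trivial)
          (by omega) r
    · rcases lt_or_ge 0 k with hk | hk
      · lift k to ℕ using hk.le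
        exact divPow_xm_pos_mem_stab hρ hM trivial (fun _ => trivial) (fun _ => trivial)
          (by omega) r
      · obtain ⟨m, rfl⟩ := Int.exists_eq_neg_ofNat hk
        exact divPow_xm_nonpos_mem_stab hρ hM (fun _ => trivial) (fun _ => trivial) m r
  have ht := t_mem_stab hρ hM (Set.mem_univ _)
  have ht' := tInv_mem_stab hρ hM (Set.mem_univ _)
  have hle : Ures ≤ stab ρ M := by
    refine Algebra.adjoin_le ?_
    rintro y (((⟨s, k, r, rfl⟩ | rfl | rfl) | ⟨c, r, rfl⟩) | ⟨m, hm, rfl⟩)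
    · exact hx s k r
    · exact ht
    · exact ht'
    · exact tBinom_mem_stab ht ht' (fun s r => hx s 0 r) c r
    · exact aTilde_mem_stab hρ hM hm (fun _ => trivial) (fun _ => trivial)
  exact map_mem_total_of_mem_stab (fun u => hle u.2) u hP

theorem bplus_stable (hρ : FollowsRule ρ) (hM : StableUnderRule {g | g.InBplus} M) (u : Ui)
    (hu : u ∈ Bplus) (P : ATot n) (hP : P ∈ total M) : ρ u P ∈ total M := by
  refine map_mem_total_of_mem_bplus (Algebra.adjoin_le ?_) hu hP
  rintro y ((⟨s, k, r, rfl⟩ | rfl | rfl) | ⟨m, hm, rfl⟩)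
  · rcases Int.units_eq_one_or s with rfl | rfl
    · exact divPow_xp_nonneg_mem_stab hρ hM .xpNonneg .xpNonnegSq k r
    · rcases eq_or_ne k 0 with rfl | hk
      · exact divPow_xm_zero_mem_stab hρ hM .xmZero .xmZeroSq r
      · exact divPow_xm_pos_mem_stab hρ hM .xmZero .xmPos .xmPosSq hk r
  · exact t_mem_stab hρ hM .t
  · exact tInv_mem_stab hρ hM .tInv
  · exact aTilde_mem_stab hρ hM hm.ne' (fun _ => .aPos _) (fun h => absurd h hm.not_gt)

end Module

end Cycles

end

theorem lemma2p2 (n : ℕ) :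
    -- the formulas of the action preserve the spaces
    (StableUnderRule Set.univ (DHat n) ∧ StableUnderRule Set.univ (WHat n) ∧
      StableUnderRule {g | g.InBplus} (DPol n) ∧ StableUnderRule {g | g.InBplus} (WPol n)) ∧
    -- the module structure on `A_n` given by these formulas restricts to the spaces
    (∀ ρ : Ui →ₐ[ℂ] Module.End (K n) (ATot n), FollowsRule ρ →
      (∀ u : Ui, ∀ P ∈ total (DHat n), ρ u P ∈ total (DHat n)) ∧
      (∀ u : Ui, ∀ P ∈ total (WHat n), ρ u P ∈ total (WHat n)) ∧
      (∀ u ∈ Bplus, ∀ P ∈ total (DPol n), ρ u P ∈ total (DPol n)) ∧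
      (∀ u ∈ Bplus, ∀ P ∈ total (WPol n), ρ u P ∈ total (WPol n))) ∧
    -- no poles at `z_a + z_b = 0` on weakly minimal cycles
    (∀ (l : ℕ) (P : A n (l + 2)), P ∈ DHat n (l + 2) → ∀ j : ℕ,
      (∃ Q ∈ CHat n l, IsCoeff (formXpSq P.1 (tZero n l) (xVar n l)) j 1 Q) ∧
      (∃ Q ∈ CHat n l, IsCoeff (formXpSq P.1 (tInf n l) (xVar n l)) j 1 Q)) := by
  refine ⟨⟨stableUnderRule_laurent isLocus_weak, stableUnderRule_laurent isLocus_min,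
    stableUnderRule_polynomial isLocus_weak, stableUnderRule_polynomial isLocus_min⟩,
    fun ρ hρ => ?_, fun l P hP j => ?_⟩
  · exact ⟨laurent_stable hρ (stableUnderRule_laurent isLocus_weak),
      laurent_stable hρ (stableUnderRule_laurent isLocus_min),
      bplus_stable hρ (stableUnderRule_polynomial isLocus_weak),
      bplus_stable hρ (stableUnderRule_polynomial isLocus_min)⟩
  · obtain ⟨Q, hQ, h⟩ := formXpSq_isCoeff isLocus_weak hP adm_tZero' j
    obtain ⟨Q', hQ', h'⟩ := formXpSq_isCoeff isLocus_weak hP adm_tInf j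
    exact ⟨⟨Q, hQ.1, h⟩, ⟨Q', hQ'.1, h'⟩⟩
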